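/- Let $\mathbb D$ be the open unit disc, $H(\mathbb D)$ the space of analytic functions on $\mathbb D$, and $dm=\frac1\pi\,dx\,dy$. For an arc $I\subset\partial\mathbb D$ (of positive length) let $|I|\in(0,1]$ be its normalized arc length and $S(I)=\{re^{i\theta}: 1-|I|\le r<1,\ e^{i\theta}\in I\}$ its Carleson box. For $0<\lambda<1$, the analytic Morrey space $\mathcal L^{2,\lambda}$ consists of the functions $f$ in the Hardy space $H^2$ whose boundary function satisfies $$\sup_{I}\Big(\frac1{|I|^{\lambda}}\int_I|f(\zeta)-f_I|^2\frac{|d\zeta|}{2\pi}\Big)^{1/2}<\infty,\qquad f_I=\frac1{|I|}\int_I f(\zeta)\frac{|d\zeta|}{2\pi},$$ with the norm $$\|f\|_{\mathcal L^{2,\lambda}}=|f(0)|+\sup_I\Big(\frac1{|I|^\lambda}\int_{S(I)}|f'(z)|^2(1-|z|^2)\,dm(z)\Big)^{1/2}.$$ The Bloch space $B$ consists of the $f\in H(\mathbb D)$ with $\sup_{z\in\mathbb D}(1-|z|^2)|f'(z)|<\infty$, with the norm $|f(0)|+\sup_{z\in\mathbb D}(1-|z|^2)|f'(z)|$. For $p>1$,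 the little Bloch--Morrey type space $B\mathcal L^{p,\lambda}_0$ consists of the $g\in H(\mathbb D)$ such that $$\sup_I\Big(\frac1{|I|^{p-\lambda+1}}\int_{S(I)}|g'(z)|^2(1-|z|^2)^p\,dm(z)\Big)^{1/2}<\infty\quad\text{and}\quad \lim_{|I|\to0}\Big(\frac1{|I|^{p-\lambda+1}}\int_{S(I)}|g'(z)|^2(1-|z|^2)^p\,dm(z)\Big)^{1/2}=0 .$$ For $f,g\in H(\mathbb D)$ and $z\in\mathbb D$ put $$T_gf(z)=\int_0^z f(w)g'(w)\,dw,\qquad I_gf(z)=\int_0^z f'(w)g(w)\,dw .$$ Suppose that $0<\lambda<1$, $p>1$ and $g\in H(\mathbb D)$. Then: (i) $I_g:\mathcal L^{2,\lambda}\to B$ is compact if and only if $g=0$. (ii) $T_g:\mathcal L^{2,\lambda}\to B$ is compact if and only if $g\in B\mathcal L^{p,\lambda}_0$. Here "$T:\mathcal L^{2,\lambda}\to B$ is compact" means that $T$ maps $\mathcal L^{2,\lambda}$ into $B$ and is a compact operator for the above norms. -/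

import Mathlib

open Set Filter Topology MeasureTheory
open scoped ENNReal

noncomputable section

namespace MorreyBloch

/-! ### Analytic functions on the unit disc -/

/-- The open unit disc. -/
abbrev disc : Set ℂ := Metric.ball (0 : ℂ) 1

/-- The analytic functions on the unit disc, each one represented by its extension by zero to `ℂ`
(so that two of them are equal if and only if they agree on the disc). -/
def holSubmodule : Submodule ℂ (ℂ → ℂ) where
  carrier := {f | DifferentiableOn ℂ f disc ∧ ∀ z ∉ disc, f z = 0}
  zero_mem' := ⟨differentiableOn_const 0, fun _ _ => rfl⟩
  add_mem' := fun {f g} hf hg =>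
    ⟨hf.1.add hg.1, fun z hz => by simp [hf.2 z hz, hg.2 z hz]⟩
  smul_mem' := fun c f hf =>
    ⟨hf.1.const_smul c, fun z hz => by simp [hf.2 z hz]⟩

/-- The space `H(𝔻)` of all analytic functions on the unit disc. -/
def HolD : Type := holSubmodule

namespace HolD

instance : AddCommGroup HolD := inferInstanceAs (AddCommGroup holSubmodule)

instance : Module ℂ HolD := inferInstanceAs (Module ℂ holSubmodule)

instance : FunLike HolD ℂ ℂ where
  coe f := (show holSubmodule from f).1
  coe_injective _ _ h := Subtype.ext h

theorem differentiableOn (f : HolD) : DifferentiableOn ℂ f disc := f.2.1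

theorem differentiableAt (f : HolD) {z : ℂ} (hz : z ∈ disc) : DifferentiableAt ℂ f z :=
  f.differentiableOn.differentiableAt (Metric.isOpen_ball.mem_nhds hz)

theorem apply_of_notMem (f : HolD) {z : ℂ} (hz : z ∉ disc) : f z = 0 := f.2.2 z hz

theorem ext_disc {f g : HolD} (h : ∀ z ∈ disc, f z = g z) : f = g := by
  refine DFunLike.ext _ _ fun z => ?_
  by_cases hz : z ∈ disc
  · exact h z hz
  · exact (f.apply_of_notMem hz).trans (g.apply_of_notMem hz).symm

@[simp] theorem zero_apply (z : ℂ) : (0 : HolD) z = 0 := rfl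

@[simp] theorem add_apply (f g : HolD) (z : ℂ) : (f + g) z = f z + g z := rfl

@[simp] theorem smul_apply (c : ℂ) (f : HolD) (z : ℂ) : (c • f) z = c * f z := rfl

theorem deriv_zero (z : ℂ) : deriv (0 : HolD) z = 0 := by
  have : ((0 : HolD) : ℂ → ℂ) = fun _ => 0 := rfl
  rw [this]; simp

theorem deriv_add (f g : HolD) {z : ℂ} (hz : z ∈ disc) :
    deriv (f + g : HolD) z = deriv f z + deriv g z :=
  _root_.deriv_add (f.differentiableAt hz) (g.differentiableAt hz)

theorem deriv_smul (c : ℂ) (f : HolD) {z : ℂ} (hz : z ∈ disc) :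
    deriv (c • f : HolD) z = c * deriv f z :=
  deriv_const_mul c (f.differentiableAt hz)

theorem differentiableOn_deriv (f : HolD) : DifferentiableOn ℂ (deriv f) disc :=
  f.differentiableOn.deriv Metric.isOpen_ball

end HolD

/-! ### The integral operators -/

theorem HolD.differentiableOn_mul_deriv (f g : HolD) :
    DifferentiableOn ℂ (fun w => f w * deriv g w) disc :=
  f.differentiableOn.mul g.differentiableOn_deriv

theorem HolD.differentiableOn_deriv_mul (f g : HolD) :
    DifferentiableOn ℂ (fun w => deriv f w * g w) disc :=
  f.differentiableOn_deriv.mul g.differentiableOn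

theorem smul_mem_disc {z : ℂ} (hz : z ∈ disc) {t : ℝ} (ht : t ∈ Icc (0 : ℝ) 1) :
    (t : ℂ) * z ∈ disc := by
  rw [mem_ball_zero_iff] at hz ⊢
  rw [norm_mul, Complex.norm_real, Real.norm_of_nonneg ht.1]
  nlinarith [norm_nonneg z, ht.1, ht.2]

/-- The integral `∫₀ᶻ h(w) dw` along the segment from `0` to `z`. -/
def segmentIntegral (h : ℂ → ℂ) (z : ℂ) : ℂ := ∫ t in (0 : ℝ)..1, h (t * z) * z

theorem intervalIntegrable_segment {h : ℂ → ℂ} (hh : DifferentiableOn ℂ h disc)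
    {z : ℂ} (hz : z ∈ disc) :
    IntervalIntegrable (fun t : ℝ => h (t * z) * z) volume 0 1 := by
  apply ContinuousOn.intervalIntegrable
  rw [uIcc_of_le zero_le_one]
  refine ContinuousOn.mul (hh.continuousOn.comp (by fun_prop) ?_) continuousOn_const
  exact fun t ht => smul_mem_disc hz ht

theorem segmentIntegral_add {h k : ℂ → ℂ} (hh : DifferentiableOn ℂ h disc)
    (hk : DifferentiableOn ℂ k disc) {z : ℂ} (hz : z ∈ disc) :
    segmentIntegral (fun w => h w + k w) z = segmentIntegral h z + segmentIntegral k z := by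
  unfold segmentIntegral
  rw [← intervalIntegral.integral_add (intervalIntegrable_segment hh hz)
    (intervalIntegrable_segment hk hz)]
  simp only [add_mul]

theorem segmentIntegral_const_mul (c : ℂ) (h : ℂ → ℂ) (z : ℂ) :
    segmentIntegral (fun w => c * h w) z = c * segmentIntegral h z := by
  unfold segmentIntegral
  rw [← intervalIntegral.integral_const_mul]
  simp only [mul_assoc]

theorem segmentIntegral_congr {h k : ℂ → ℂ} (hhk : ∀ w ∈ disc, h w = k w) {z : ℂ}
    (hz : z ∈ disc) : segmentIntegral h z = segmentIntegral k z := by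
  refine intervalIntegral.integral_congr fun t ht => ?_
  rw [uIcc_of_le zero_le_one] at ht
  simp only [hhk _ (smul_mem_disc hz ht)]

theorem differentiableOn_segmentIntegral {h : ℂ → ℂ} (hh : DifferentiableOn ℂ h disc) :
    DifferentiableOn ℂ (segmentIntegral h) disc := by
  obtain ⟨P, hP⟩ := hh.isExactOn_ball
  have key : ∀ z ∈ disc, segmentIntegral h z = P z - P 0 := by
    intro z hz
    have h1 : ∀ t ∈ uIcc (0 : ℝ) 1,
        HasDerivAt (fun t : ℝ => P (t * z)) (h (t * z) * z) t := by
      intro t ht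
      rw [uIcc_of_le zero_le_one] at ht
      have h2 : HasDerivAt (fun t : ℝ => (t : ℂ) * z) (1 * z) t :=
        (Complex.ofRealCLM.hasDerivAt (x := t)).mul_const z
      rw [one_mul] at h2
      exact (hP _ (smul_mem_disc hz ht)).comp t h2
    have h3 := intervalIntegral.integral_eq_sub_of_hasDerivAt h1
      (intervalIntegrable_segment hh hz)
    simpa [segmentIntegral] using h3
  refine DifferentiableOn.congr (f := fun z => P z - P 0) ?_ key
  exact fun z hz => ((hP z hz).differentiableAt.sub_const _).differentiableWithinAt

/-- The analytic function `z ↦ ∫₀ᶻ h(w) dw` on the disc. -/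
def primitive (h : ℂ → ℂ) (hh : DifferentiableOn ℂ h disc) : HolD :=
  ⟨disc.indicator (segmentIntegral h),
    (differentiableOn_segmentIntegral hh).congr fun _ hz => indicator_of_mem hz _,
    fun _ hz => indicator_of_notMem hz _⟩

theorem primitive_apply (h : ℂ → ℂ) (hh : DifferentiableOn ℂ h disc) {z : ℂ} (hz : z ∈ disc) :
    primitive h hh z = segmentIntegral h z :=
  indicator_of_mem hz _

/-- The Volterra-type operator `T_g f(z) = ∫₀ᶻ f(w) g'(w) dw` on `H(𝔻)`. -/
def volterraT (g : HolD) : HolD →ₗ[ℂ] HolD where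
  toFun f := primitive (fun w => f w * deriv g w) (f.differentiableOn_mul_deriv g)
  map_add' f₁ f₂ := by
    refine HolD.ext_disc fun z hz => ?_
    rw [HolD.add_apply, primitive_apply _ _ hz, primitive_apply _ _ hz, primitive_apply _ _ hz,
      ← segmentIntegral_add (f₁.differentiableOn_mul_deriv g) (f₂.differentiableOn_mul_deriv g) hz]
    refine segmentIntegral_congr (fun w hw => ?_) hz
    rw [HolD.add_apply, add_mul]
  map_smul' c f := by
    refine HolD.ext_disc fun z hz => ?_
    rw [RingHom.id_apply, HolD.smul_apply, primitive_apply _ _ hz, primitive_apply _ _ hz,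
      ← segmentIntegral_const_mul]
    refine segmentIntegral_congr (fun w hw => ?_) hz
    rw [HolD.smul_apply, mul_assoc]

/-- The companion operator `I_g f(z) = ∫₀ᶻ f'(w) g(w) dw` on `H(𝔻)`. -/
def companionI (g : HolD) : HolD →ₗ[ℂ] HolD where
  toFun f := primitive (fun w => deriv f w * g w) (f.differentiableOn_deriv_mul g)
  map_add' f₁ f₂ := by
    refine HolD.ext_disc fun z hz => ?_
    rw [HolD.add_apply, primitive_apply _ _ hz, primitive_apply _ _ hz, primitive_apply _ _ hz,
      ← segmentIntegral_add (f₁.differentiableOn_deriv_mul g) (f₂.differentiableOn_deriv_mul g) hz]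
    refine segmentIntegral_congr (fun w hw => ?_) hz
    rw [HolD.deriv_add f₁ f₂ hw, add_mul]
  map_smul' c f := by
    refine HolD.ext_disc fun z hz => ?_
    rw [RingHom.id_apply, HolD.smul_apply, primitive_apply _ _ hz, primitive_apply _ _ hz,
      ← segmentIntegral_const_mul]
    refine segmentIntegral_congr (fun w hw => ?_) hz
    rw [HolD.deriv_smul c f hw, mul_assoc]

/-! ### Arcs, Carleson boxes and Carleson-type quantities -/

/-- A (nondegenerate) closed arc `{e^{iθ} : start ≤ θ ≤ start + 2π len}` of the unit circle, of
normalized length `len`; the whole circle is the case `len = 1`. -/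
structure Arc where
  start : ℝ
  len : ℝ
  len_pos : 0 < len
  len_le_one : len ≤ 1

/-- The angles of the points of an arc. -/
def Arc.angles (I : Arc) : Set ℝ := Icc I.start (I.start + 2 * Real.pi * I.len)

/-- The Carleson box `S(I)`: the points `r e^{iθ}` of the disc with `1 - |I| ≤ r < 1` and
`e^{iθ} ∈ I`. -/
def Arc.box (I : Arc) : Set ℂ :=
  {z | ∃ r θ : ℝ, 1 - I.len ≤ r ∧ r < 1 ∧ θ ∈ I.angles ∧ z = circleMap 0 r θ}

theorem Arc.box_subset (I : Arc) : I.box ⊆ disc := by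
  rintro z ⟨r, θ, h1, h2, -, rfl⟩
  have h0 : 0 ≤ r := by linarith [I.len_le_one]
  simpa [abs_of_nonneg h0] using h2

theorem Arc.measurableSet_box (I : Arc) : MeasurableSet I.box := by
  have : I.box = (fun x : ℝ × ℝ => circleMap 0 x.1 x.2) '' (Icc (1 - I.len) 1 ×ˢ I.angles) ∩ disc := by
    ext z
    constructor
    · intro hz
      obtain ⟨r, θ, h1, h2, h3, rfl⟩ := id hz
      exact ⟨⟨(r, θ), ⟨⟨h1, h2.le⟩, h3⟩, rfl⟩, I.box_subset hz⟩
    · rintro ⟨⟨⟨r, θ⟩, ⟨⟨h1, h2⟩, h3⟩, rfl⟩, hz⟩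
      have h0 : 0 ≤ r := by
        have := I.len_le_one
        simp only at h1
        linarith
      refine ⟨r, θ, h1, ?_, h3, rfl⟩
      simpa [abs_of_nonneg h0] using hz
  rw [this]
  refine MeasurableSet.inter (IsCompact.measurableSet ?_) Metric.isOpen_ball.measurableSet
  refine (isCompact_Icc.prod isCompact_Icc).image ?_
  unfold circleMap
  fun_prop

/-- The normalized area measure `dm = dx dy / π`. -/
def areaMeasure : Measure ℂ := ENNReal.ofReal Real.pi⁻¹ • volume

/-- `( |I|^{-s} ∫_{S(I)} |f'(z)|² (1 - |z|²)^p dm(z) )^{1/2}`, as an extended nonnegative real. -/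
def carleson (p s : ℝ) (f : HolD) (I : Arc) : ℝ≥0∞ :=
  (ENNReal.ofReal (I.len ^ (-s)) *
    ∫⁻ z in I.box, ‖deriv f z‖ₑ ^ (2 : ℝ) * ENNReal.ofReal ((1 - ‖z‖ ^ 2) ^ p) ∂areaMeasure)
      ^ (1 / 2 : ℝ)

theorem carleson_zero (p s : ℝ) (I : Arc) : carleson p s 0 I = 0 := by
  simp [carleson, HolD.deriv_zero]

theorem carleson_smul (p s : ℝ) (c : ℂ) (f : HolD) (I : Arc) :
    carleson p s (c • f) I = ‖c‖ₑ * carleson p s f I := by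
  unfold carleson
  have h : ∫⁻ z in I.box, ‖deriv (c • f : HolD) z‖ₑ ^ (2 : ℝ) *
        ENNReal.ofReal ((1 - ‖z‖ ^ 2) ^ p) ∂areaMeasure
      = ∫⁻ z in I.box, ‖c‖ₑ ^ (2 : ℝ) * (‖deriv f z‖ₑ ^ (2 : ℝ) *
        ENNReal.ofReal ((1 - ‖z‖ ^ 2) ^ p)) ∂areaMeasure := by
    refine setLIntegral_congr_fun I.measurableSet_box fun z hz => ?_
    simp only [HolD.deriv_smul c f (I.box_subset hz), enorm_mul]
    rw [ENNReal.mul_rpow_of_nonneg _ _ (by norm_num), mul_assoc]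
  rw [h, lintegral_const_mul' _ _ (by simp), mul_left_comm,
    ENNReal.mul_rpow_of_nonneg _ _ (by norm_num), ← ENNReal.rpow_mul]
  norm_num

theorem carleson_add_le (p s : ℝ) (f g : HolD) (I : Arc) :
    carleson p s (f + g) I ≤ carleson p s f I + carleson p s g I := by
  set w : ℂ → ℝ≥0∞ := fun z => ENNReal.ofReal ((1 - ‖z‖ ^ 2) ^ p) ^ (1 / 2 : ℝ) with hw
  have hwm : Measurable w := by
    apply Measurable.pow_const
    fun_prop
  have h2 : (0 : ℝ) ≤ 1 / 2 := by norm_num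
  have e : ∀ h : HolD, carleson p s h I = ENNReal.ofReal (I.len ^ (-s)) ^ (1 / 2 : ℝ) *
      (∫⁻ z in I.box, (‖deriv h z‖ₑ * w z) ^ (2 : ℝ) ∂areaMeasure) ^ (1 / (2 : ℝ)) := by
    intro h
    unfold carleson
    rw [ENNReal.mul_rpow_of_nonneg _ _ h2]
    congr 3
    ext z
    rw [ENNReal.mul_rpow_of_nonneg _ _ (by norm_num), hw]
    simp only
    rw [← ENNReal.rpow_mul]
    norm_num
  have hm : ∀ h : HolD, AEMeasurable (fun z => ‖deriv h z‖ₑ * w z)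
      (areaMeasure.restrict I.box) := fun h =>
    ((measurable_deriv h).enorm.mul hwm).aemeasurable
  rw [e, e, e, ← mul_add]
  gcongr
  refine le_trans ?_ (ENNReal.lintegral_Lp_add_le (hm f) (hm g) (by norm_num))
  refine ENNReal.rpow_le_rpow (setLIntegral_mono' I.measurableSet_box fun z hz => ?_) h2
  refine ENNReal.rpow_le_rpow ?_ (by norm_num)
  rw [HolD.deriv_add f g (I.box_subset hz), Pi.add_apply, ← add_mul]
  gcongr
  exact enorm_add_le _ _

/-! ### The analytic Morrey space -/

/-- Membership in the Hardy space `H²`. -/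
def IsHardy (f : HolD) : Prop :=
  ∃ C : ℝ, ∀ r ∈ Ioo (0 : ℝ) 1,
    1 / (2 * Real.pi) * ∫ θ in (0 : ℝ)..2 * Real.pi, ‖f (circleMap 0 r θ)‖ ^ 2 ≤ C

/-- `F` is a boundary function of `f`: `F(e^{iθ}) = lim_{r → 1-} f(r e^{iθ})` for almost every
`θ`. -/
def IsBoundaryFunction (f : HolD) (F : Circle → ℂ) : Prop :=
  ∀ᵐ θ : ℝ, Tendsto (fun r : ℝ => f (circleMap 0 r θ)) (𝓝[<] 1) (𝓝 (F (Circle.exp θ)))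

/-- The average `F_I = |I|⁻¹ ∫_I F(ζ) |dζ| / 2π`. -/
def arcAverage (F : Circle → ℂ) (I : Arc) : ℂ :=
  ((1 / I.len * (1 / (2 * Real.pi)) : ℝ) : ℂ) * ∫ θ in I.angles, F (Circle.exp θ)

/-- `( |I|^{-lam} ∫_I |F(ζ) - F_I|² |dζ| / 2π )^{1/2}`, as an extended nonnegative real. -/
def oscillation (lam : ℝ) (F : Circle → ℂ) (I : Arc) : ℝ≥0∞ :=
  (ENNReal.ofReal (I.len ^ (-lam) * (1 / (2 * Real.pi))) *
    ∫⁻ θ in I.angles, ‖F (Circle.exp θ) - arcAverage F I‖ₑ ^ (2 : ℝ)) ^ (1 / 2 : ℝ)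

theorem circleMap_mem_disc {r : ℝ} (hr : r ∈ Ioo (0 : ℝ) 1) (θ : ℝ) : circleMap 0 r θ ∈ disc := by
  simpa [abs_of_pos hr.1] using hr.2

theorem HolD.continuous_circle (f : HolD) {r : ℝ} (hr : r ∈ Ioo (0 : ℝ) 1) :
    Continuous fun θ : ℝ => f (circleMap 0 r θ) :=
  f.differentiableOn.continuousOn.comp_continuous (continuous_circleMap 0 r)
    (circleMap_mem_disc hr)

theorem IsHardy.zero : IsHardy 0 := ⟨0, fun r _ => by simp⟩

theorem IsHardy.add {f g : HolD} (hf : IsHardy f) (hg : IsHardy g) : IsHardy (f + g) := by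
  obtain ⟨C, hC⟩ := hf
  obtain ⟨D, hD⟩ := hg
  refine ⟨2 * C + 2 * D, fun r hr => ?_⟩
  have cf : Continuous fun θ : ℝ => ‖f (circleMap 0 r θ)‖ ^ 2 :=
    (f.continuous_circle hr).norm.pow 2
  have cg : Continuous fun θ : ℝ => ‖g (circleMap 0 r θ)‖ ^ 2 :=
    (g.continuous_circle hr).norm.pow 2
  have cfg : Continuous fun θ : ℝ => ‖(f + g) (circleMap 0 r θ)‖ ^ 2 :=
    ((f + g).continuous_circle hr).norm.pow 2
  have h1 : ∫ θ in (0 : ℝ)..2 * Real.pi, ‖(f + g) (circleMap 0 r θ)‖ ^ 2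
      ≤ ∫ θ in (0 : ℝ)..2 * Real.pi,
        (2 * ‖f (circleMap 0 r θ)‖ ^ 2 + 2 * ‖g (circleMap 0 r θ)‖ ^ 2) := by
    refine intervalIntegral.integral_mono (by positivity) (cfg.intervalIntegrable _ _)
      (((cf.const_mul 2).add (cg.const_mul 2)).intervalIntegrable _ _) fun θ => ?_
    have := norm_add_le (f (circleMap 0 r θ)) (g (circleMap 0 r θ))
    simp only [HolD.add_apply]
    nlinarith [sq_nonneg (‖f (circleMap 0 r θ)‖ - ‖g (circleMap 0 r θ)‖),
      norm_nonneg (f (circleMap 0 r θ) + g (circleMap 0 r θ)), norm_nonneg (f (circleMap 0 r θ)),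
      norm_nonneg (g (circleMap 0 r θ))]
  rw [intervalIntegral.integral_add ((cf.const_mul 2).intervalIntegrable _ _)
    ((cg.const_mul 2).intervalIntegrable _ _), intervalIntegral.integral_const_mul,
    intervalIntegral.integral_const_mul] at h1
  have h2 := mul_le_mul_of_nonneg_left h1 (by positivity : (0 : ℝ) ≤ 1 / (2 * Real.pi))
  have h3 := hC r hr
  have h4 := hD r hr
  linarith

theorem IsHardy.smul (c : ℂ) {f : HolD} (hf : IsHardy f) : IsHardy (c • f) := by
  obtain ⟨C, hC⟩ := hf
  refine ⟨‖c‖ ^ 2 * C, fun r hr => ?_⟩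
  have := mul_le_mul_of_nonneg_left (hC r hr) (sq_nonneg ‖c‖)
  simp only [HolD.smul_apply, norm_mul, mul_pow, intervalIntegral.integral_const_mul]
  linarith

theorem IsBoundaryFunction.aemeasurable {f : HolD} {F : Circle → ℂ} (h : IsBoundaryFunction f F) :
    AEMeasurable (fun θ : ℝ => F (Circle.exp θ)) volume := by
  have hu : Tendsto (fun n : ℕ => (1 : ℝ) - 1 / ((n : ℝ) + 2)) atTop (𝓝[<] 1) := by
    refine tendsto_nhdsWithin_iff.2 ⟨?_, Eventually.of_forall fun n => ?_⟩
    · have h1 : Tendsto (fun n : ℕ => 1 / ((n : ℝ) + 2)) atTop (𝓝 0) :=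
        tendsto_const_nhds.div_atTop (tendsto_atTop_add_const_right _ _ tendsto_natCast_atTop_atTop)
      simpa using h1.const_sub 1
    · have : (0 : ℝ) < 1 / ((n : ℝ) + 2) := by positivity
      simp only [mem_Iio]
      linarith
  refine aemeasurable_of_tendsto_metrizable_ae atTop
    (f := fun (n : ℕ) θ => f (circleMap 0 (1 - 1 / ((n : ℝ) + 2)) θ)) (fun n => ?_)
    (h.mono fun θ hθ => hθ.comp hu)
  have hn : (1 : ℝ) / ((n : ℝ) + 2) < 1 := by
    rw [div_lt_one (by positivity)]
    have : (0 : ℝ) ≤ n := n.cast_nonneg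
    linarith
  have hn' : (0 : ℝ) < 1 / ((n : ℝ) + 2) := by positivity
  exact (f.continuous_circle ⟨by linarith, by linarith⟩).aemeasurable

theorem oscillation_zero (lam : ℝ) (I : Arc) : oscillation lam (fun _ => 0) I = 0 := by
  simp [oscillation, arcAverage]

theorem oscillation_smul (lam : ℝ) (c : ℂ) (F : Circle → ℂ) (I : Arc) :
    oscillation lam (fun ζ => c * F ζ) I = ‖c‖ₑ * oscillation lam F I := by
  have h : arcAverage (fun ζ => c * F ζ) I = c * arcAverage F I := by
    simp only [arcAverage, integral_const_mul]
    ring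
  unfold oscillation
  simp only [h, ← mul_sub, enorm_mul]
  simp only [ENNReal.mul_rpow_of_nonneg _ _ (by norm_num : (0 : ℝ) ≤ 2)]
  rw [lintegral_const_mul' _ _ (by simp), mul_left_comm,
    ENNReal.mul_rpow_of_nonneg _ _ (by norm_num), ← ENNReal.rpow_mul]
  norm_num

theorem integrableOn_of_oscillation_lt_top {lam : ℝ} {F : Circle → ℂ} {I : Arc}
    (hF : AEMeasurable (fun θ : ℝ => F (Circle.exp θ)) volume) (h : oscillation lam F I < ⊤) :
    IntegrableOn (fun θ : ℝ => F (Circle.exp θ)) I.angles := by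
  have hpos : 0 < I.len ^ (-lam) * (1 / (2 * Real.pi)) := by
    have := Real.rpow_pos_of_pos I.len_pos (-lam)
    positivity
  have hfin : ∫⁻ θ in I.angles, ‖F (Circle.exp θ) - arcAverage F I‖ₑ ^ (2 : ℝ) < ⊤ := by
    rw [lt_top_iff_ne_top]
    intro htop
    rw [oscillation, htop, ENNReal.mul_top (by simpa using hpos),
      ENNReal.top_rpow_of_pos (by norm_num)] at h
    exact lt_irrefl _ h
  have : IsFiniteMeasure (volume.restrict I.angles) :=
    ⟨by rw [Measure.restrict_apply_univ]; exact isCompact_Icc.measure_lt_top⟩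
  have hmeas : AEStronglyMeasurable (fun θ : ℝ => F (Circle.exp θ) - arcAverage F I)
      (volume.restrict I.angles) :=
    (hF.sub_const _).aestronglyMeasurable.restrict
  have hLp : MemLp (fun θ : ℝ => F (Circle.exp θ) - arcAverage F I) 2
      (volume.restrict I.angles) := by
    refine ⟨hmeas, ?_⟩
    rw [eLpNorm_lt_top_iff_lintegral_rpow_enorm_lt_top (by norm_num) (by norm_num)]
    simpa using hfin
  have hint := (hLp.integrable (by norm_num)).add (integrable_const (arcAverage F I))
  refine hint.congr (Eventually.of_forall fun θ => ?_)
  simp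

theorem oscillation_add_le {lam : ℝ} {F G : Circle → ℂ} {I : Arc}
    (hF : AEMeasurable (fun θ : ℝ => F (Circle.exp θ)) volume)
    (hG : AEMeasurable (fun θ : ℝ => G (Circle.exp θ)) volume)
    (hF' : oscillation lam F I < ⊤) (hG' : oscillation lam G I < ⊤) :
    oscillation lam (fun ζ => F ζ + G ζ) I ≤ oscillation lam F I + oscillation lam G I := by
  have h : arcAverage (fun ζ => F ζ + G ζ) I = arcAverage F I + arcAverage G I := by
    simp only [arcAverage]
    rw [integral_add (integrableOn_of_oscillation_lt_top hF hF')
      (integrableOn_of_oscillation_lt_top hG hG')]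
    ring
  have h2 : (0 : ℝ) ≤ 1 / 2 := by norm_num
  unfold oscillation
  rw [h, ENNReal.mul_rpow_of_nonneg _ _ h2, ENNReal.mul_rpow_of_nonneg _ _ h2,
    ENNReal.mul_rpow_of_nonneg _ _ h2, ← mul_add]
  gcongr
  refine le_trans ?_ (ENNReal.lintegral_Lp_add_le
    ((hF.sub_const (arcAverage F I)).enorm.restrict)
    ((hG.sub_const (arcAverage G I)).enorm.restrict) (by norm_num))
  refine ENNReal.rpow_le_rpow (lintegral_mono fun θ => ?_) h2
  refine ENNReal.rpow_le_rpow ?_ (by norm_num)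
  rw [Pi.add_apply, add_sub_add_comm]
  exact enorm_add_le _ _

/-- The analytic Morrey space `𝓛^{2,lam}`: the `f ∈ H²` whose boundary function `F` satisfies
`sup_I ( |I|^{-lam} ∫_I |F(ζ) - F_I|² |dζ| / 2π )^{1/2} < ∞`. -/
def Morrey (lam : ℝ) : Submodule ℂ HolD where
  carrier := {f | IsHardy f ∧ ∃ F, IsBoundaryFunction f F ∧ ⨆ I, oscillation lam F I < ⊤}
  zero_mem' := by
    refine ⟨IsHardy.zero, fun _ => 0, Eventually.of_forall fun θ => ?_, ?_⟩
    · simp only [HolD.zero_apply]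
      exact tendsto_const_nhds
    · simp [oscillation_zero]
  add_mem' := by
    rintro f g ⟨hf, F, hF, hF'⟩ ⟨hg, G, hG, hG'⟩
    refine ⟨hf.add hg, fun ζ => F ζ + G ζ, ?_, ?_⟩
    · filter_upwards [hF, hG] with θ h1 h2
      exact h1.add h2
    · refine lt_of_le_of_lt (iSup_le fun I => ?_) (ENNReal.add_lt_top.2 ⟨hF', hG'⟩)
      refine (oscillation_add_le hF.aemeasurable hG.aemeasurable
        ((le_iSup _ I).trans_lt hF') ((le_iSup _ I).trans_lt hG')).trans ?_
      exact add_le_add (le_iSup (oscillation lam F) I) (le_iSup (oscillation lam G) I)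
  smul_mem' := by
    rintro c f ⟨hf, F, hF, hF'⟩
    refine ⟨hf.smul c, fun ζ => c * F ζ, ?_, ?_⟩
    · filter_upwards [hF] with θ h1
      exact h1.const_mul c
    · simp only [oscillation_smul, ← ENNReal.mul_iSup]
      exact ENNReal.mul_lt_top (by simp) hF'

/-- The norm `‖f‖ = |f(0)| + sup_I ( |I|^{-lam} ∫_{S(I)} |f'(z)|² (1 - |z|²) dm(z) )^{1/2}` of
`𝓛^{2,lam}`, as an extended nonnegative real. -/
def morreyNorm (lam : ℝ) (f : HolD) : ℝ≥0∞ := ‖f 0‖ₑ + ⨆ I, carleson 1 lam f I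

theorem morreyNorm_zero (lam : ℝ) : morreyNorm lam 0 = 0 := by
  simp [morreyNorm, carleson_zero]

theorem morreyNorm_add_le (lam : ℝ) (f g : HolD) :
    morreyNorm lam (f + g) ≤ morreyNorm lam f + morreyNorm lam g := by
  unfold morreyNorm
  rw [add_add_add_comm]
  refine add_le_add (enorm_add_le _ _) (iSup_le fun I => ?_)
  exact (carleson_add_le 1 lam f g I).trans
    (add_le_add (le_iSup (carleson 1 lam f) I) (le_iSup (carleson 1 lam g) I))

theorem morreyNorm_smul (lam : ℝ) (c : ℂ) (f : HolD) :
    morreyNorm lam (c • f) = ‖c‖ₑ * morreyNorm lam f := by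
  simp only [morreyNorm, carleson_smul, ← ENNReal.mul_iSup, mul_add, HolD.smul_apply, enorm_mul]

/-- `𝓛^{2,lam}` carries the distance `‖f - g‖` of its norm, and the topology of that distance.
(For `0 < lam < 1` the norm is finite on `𝓛^{2,lam}`, by the equivalence of the oscillation and
Carleson box conditions; nothing here presupposes this.) -/
instance (lam : ℝ) : PseudoEMetricSpace (Morrey lam) where
  edist f g := morreyNorm lam (f - g : HolD)
  edist_self f := by rw [sub_self, morreyNorm_zero]
  edist_comm f g := by
    have h := morreyNorm_smul lam (-1) (f - g : HolD)
    rw [neg_one_smul, neg_sub] at h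
    simpa using h.symm
  edist_triangle f g h := by
    rw [← sub_add_sub_cancel (f : HolD) g h]
    exact morreyNorm_add_le lam _ _

/-! ### The Bloch space -/

/-- `(1 - |z|²) |f'(z)|` at a point of the disc. -/
def blochQuantity (f : HolD) (z : disc) : ℝ := (1 - ‖(z : ℂ)‖ ^ 2) * ‖deriv f z‖

theorem disc_weight_pos (z : disc) : 0 < 1 - ‖(z : ℂ)‖ ^ 2 := by
  have h := mem_ball_zero_iff.1 z.2
  nlinarith [norm_nonneg (z : ℂ)]

instance : Nonempty disc := ⟨⟨0, by simp⟩⟩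

theorem blochQuantity_nonneg (f : HolD) (z : disc) : 0 ≤ blochQuantity f z :=
  mul_nonneg (disc_weight_pos z).le (norm_nonneg _)

theorem blochQuantity_add_le (f g : HolD) (z : disc) :
    blochQuantity (f + g) z ≤ blochQuantity f z + blochQuantity g z := by
  unfold blochQuantity
  rw [HolD.deriv_add f g z.2, ← mul_add]
  exact mul_le_mul_of_nonneg_left (norm_add_le _ _) (disc_weight_pos z).le

theorem blochQuantity_smul (c : ℂ) (f : HolD) (z : disc) :
    blochQuantity (c • f) z = ‖c‖ * blochQuantity f z := by
  unfold blochQuantity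
  rw [HolD.deriv_smul c f z.2, norm_mul]
  ring

/-- The Bloch space `B`: the `f ∈ H(𝔻)` with `sup_z (1 - |z|²) |f'(z)| < ∞`. -/
def Bloch : Submodule ℂ HolD where
  carrier := {f | BddAbove (range (blochQuantity f))}
  zero_mem' := ⟨0, by
    rintro _ ⟨z, rfl⟩
    simp [blochQuantity, HolD.deriv_zero]⟩
  add_mem' := by
    rintro f g ⟨C, hC⟩ ⟨D, hD⟩
    refine ⟨C + D, ?_⟩
    rintro _ ⟨z, rfl⟩
    exact (blochQuantity_add_le f g z).trans
      (add_le_add (hC (mem_range_self z)) (hD (mem_range_self z)))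
  smul_mem' := by
    rintro c f ⟨C, hC⟩
    refine ⟨‖c‖ * C, ?_⟩
    rintro _ ⟨z, rfl⟩
    rw [blochQuantity_smul]
    exact mul_le_mul_of_nonneg_left (hC (mem_range_self z)) (norm_nonneg _)

/-- The norm `|f(0)| + sup_z (1 - |z|²) |f'(z)|` of the Bloch space. -/
instance : Norm Bloch := ⟨fun f => ‖(f : HolD) 0‖ + ⨆ z, blochQuantity f z⟩

theorem Bloch.norm_def (f : Bloch) : ‖f‖ = ‖(f : HolD) 0‖ + ⨆ z, blochQuantity f z := rfl

theorem Bloch.core : NormedSpace.Core ℂ Bloch where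
  norm_nonneg f := add_nonneg (norm_nonneg _) (Real.iSup_nonneg (blochQuantity_nonneg _))
  norm_smul c f := by
    simp only [Bloch.norm_def, Submodule.coe_smul, blochQuantity_smul, HolD.smul_apply, norm_mul,
      ← Real.mul_iSup_of_nonneg (norm_nonneg c), mul_add]
  norm_triangle f g := by
    simp only [Bloch.norm_def, Submodule.coe_add, HolD.add_apply]
    rw [add_add_add_comm]
    refine add_le_add (norm_add_le _ _) (ciSup_le fun z => ?_)
    exact (blochQuantity_add_le f g z).trans (add_le_add (le_ciSup f.2 z) (le_ciSup g.2 z))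
  norm_eq_zero_iff f := by
    constructor
    · intro h
      rw [Bloch.norm_def] at h
      have hs := Real.iSup_nonneg (blochQuantity_nonneg (f : HolD))
      have h0 : (f : HolD) 0 = 0 := norm_eq_zero.1 (by linarith [norm_nonneg ((f : HolD) 0)])
      have h1 : ∀ z ∈ disc, deriv (f : HolD) z = 0 := by
        intro z hz
        have h2 := le_ciSup f.2 ⟨z, hz⟩
        have h3 := blochQuantity_nonneg (f : HolD) ⟨z, hz⟩
        have h4 : blochQuantity (f : HolD) ⟨z, hz⟩ = 0 := by
          linarith [norm_nonneg ((f : HolD) 0)]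
        exact norm_eq_zero.1 ((mul_eq_zero.1 h4).resolve_left (disc_weight_pos ⟨z, hz⟩).ne')
      refine Subtype.ext (HolD.ext_disc fun z hz => ?_)
      have := Metric.isOpen_ball.is_const_of_deriv_eq_zero
        (convex_ball (0 : ℂ) 1).isPreconnected (f : HolD).differentiableOn h1 hz
        (by simp : (0 : ℂ) ∈ disc)
      rw [this, h0]
      rfl
    · rintro rfl
      simp [Bloch.norm_def, blochQuantity, HolD.deriv_zero]

instance : NormedAddCommGroup Bloch := NormedAddCommGroup.ofCore Bloch.core

instance : NormedSpace ℂ Bloch := NormedSpace.ofCore Bloch.core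

/-! ### The Bloch–Morrey type spaces -/

/-- The Bloch–Morrey type space: the `g ∈ H(𝔻)` with
`sup_I ( |I|^{-(p-lam+1)} ∫_{S(I)} |g'(z)|² (1 - |z|²)^p dm(z) )^{1/2} < ∞`. -/
def BlochMorrey (p lam : ℝ) : Set HolD := {g | ⨆ I, carleson p (p - lam + 1) g I < ⊤}

/-- The little Bloch–Morrey type space: the `g` in the Bloch–Morrey type space for which
`( |I|^{-(p-lam+1)} ∫_{S(I)} |g'(z)|² (1 - |z|²)^p dm(z) )^{1/2} → 0` as `|I| → 0`. -/
def LittleBlochMorrey (p lam : ℝ) : Set HolD :=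
  {g | g ∈ BlochMorrey p lam ∧
    Tendsto (carleson p (p - lam + 1) g) (comap Arc.len (𝓝 0)) (𝓝 0)}

/-! ### Compactness -/

/-- A linear operator `T` on `H(𝔻)` is compact as an operator `𝓛^{2,lam} → B`: it maps
`𝓛^{2,lam}` into `B`, and the resulting linear map is a compact operator. -/
def IsCompactMorreyBloch (lam : ℝ) (T : HolD →ₗ[ℂ] HolD) : Prop :=
  ∃ h : ∀ f ∈ Morrey lam, T f ∈ Bloch, IsCompactOperator (T.restrict h)

end MorreyBloch

end

noncomputable section

namespace MorreyBloch

open scoped ComplexConjugate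

/-! ### Integrals over Carleson boxes and discs -/

/-! Put `s = (1 - lam) / 2` and `b = (1 + lam) / 2`, so that `1 - s = b`. A function of the Morrey
space grows at most like `(1 - |z|)^(-s)`. Since `(T_g f)' = f g'`, the Bloch quantity of `T_g f` is
then controlled by `(1 - |z|)^b |g'(z)|`. The condition on the symbol is therefore `(1 - |z|)^b
|g'(z)| → 0` at the circle (`IsLittleBloch`). This is the little Bloch–Morrey condition for every `p
> 1`. One direction is the sub-mean value property of `|g'|²` on a disc inside a box of comparable
size. The other is integration of the pointwise bound over the box, where the remaining weight `(1 -
|z|²)^(p - 1 - lam)` has exponent above `-1`.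

Sufficiency for `T_g` needs the growth estimate twice. Membership in the space is an oscillation
condition on the boundary function, whereas the topology comes from a Carleson norm, and the two are
not compared. For one member (`exists_norm_le_of_mem_morrey`), the oscillation bound gives a Morrey
bound for `∫_I |F|`, and Cauchy's formula carries it into the disc. On the unit ball of the norm
(`exists_norm_le_of_morreyNorm_le_one`), the Carleson integrals bound `f'`, and a radial integration
gives a uniform constant. The functions obeying a fixed growth bound form a normal family closed
under pointwise limits. Its image under `T_g` is compact in the Bloch space
(`isCompact_volterraT_growthBall`): locally uniform convergence handles the interior, and the little
Bloch condition handles the rim.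

Necessity uses the functions `(1 - |a|²)^b / (1 - conj a * z)`, whose Morrey norms are bounded
uniformly in `a` (`exists_morreyNorm_testFun_le`). After a fixed scaling, a compact operator sends
them all into one compact set. For `I_g`, boundedness of that set already forces `|a| |g(a)| = O((1
- |a|²)^s)`, and the maximum principle gives `g = 0`. For `T_g`, the derivatives of the images tend
to zero pointwise as `|a| → 1`, so a limit in the Bloch space has zero derivative; evaluating at `a`
then shows that `(1 - |a|)^b |g'(a)|` cannot stay away from zero. -/

theorem polarCoord_symm_eq_circleMap (p : ℝ × ℝ) :
    Complex.polarCoord.symm p = circleMap 0 p.1 p.2 := by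
  rw [Complex.polarCoord_symm_apply, circleMap, Complex.exp_mul_I]
  simp

/-- Rotating by the midpoint of the arc makes the box symmetric about the positive axis, where the
polar angle in `(-π, π)` does not wrap: the two angles differ by `2πn` with `|2πn| < 2π`, because
half the arc spans at most `π`. -/
theorem Arc.circleMap_mul_mem_box {I : Arc} {r θ : ℝ} (hr : 0 < r)
    (hθ : θ ∈ Ioo (-Real.pi) Real.pi)
    (h : circleMap 0 1 (I.start + Real.pi * I.len) * circleMap 0 r θ ∈ I.box) :
    r ∈ Ico (1 - I.len) 1 ∧ θ ∈ Icc (-(Real.pi * I.len)) (Real.pi * I.len) := by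
  obtain ⟨r', θ', h1, h2, h3, h4⟩ := h
  have hr' : 0 ≤ r' := by linarith [I.len_le_one]
  have hn := congrArg norm h4
  simp only [norm_mul, norm_circleMap_zero, abs_one, one_mul, abs_of_pos hr, abs_of_nonneg hr']
    at hn
  subst hn
  refine ⟨⟨h1, h2⟩, ?_⟩
  simp only [circleMap, zero_add, Complex.ofReal_one, one_mul] at h4
  rw [mul_left_comm] at h4
  have h5 := mul_left_cancel₀ (Complex.ofReal_ne_zero.2 hr.ne') h4
  rw [← Complex.exp_add, Complex.exp_eq_exp_iff_exists_int] at h5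
  obtain ⟨n, hn⟩ := h5
  have h6 : (I.start + Real.pi * I.len) + θ = θ' + n * (2 * Real.pi) := by
    have := congrArg Complex.im hn
    simpa [Complex.add_im, Complex.mul_im] using this
  have hl := I.len_le_one
  have hp := Real.pi_pos
  rw [Arc.angles, mem_Icc] at h3
  have hpl : Real.pi * I.len ≤ Real.pi := by nlinarith
  have hn1 : (n : ℝ) < 1 := by
    by_contra hc
    push Not at hc
    nlinarith [hθ.2]
  have hn2 : (-1 : ℝ) < n := by
    by_contra hc
    push Not at hc
    nlinarith [hθ.1]
  have hn0 : n = 0 := by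
    have a1 : n < 1 := by exact_mod_cast hn1
    have a2 : -1 < n := by exact_mod_cast hn2
    omega
  subst hn0
  simp only [Int.cast_zero, zero_mul, add_zero] at h6
  constructor <;> linarith [h3.1, h3.2]

theorem Arc.lintegral_box_norm_le (I : Arc) {φ : ℝ → ℝ≥0∞} (hφ : Measurable φ) :
    ∫⁻ z in I.box, φ ‖z‖ ≤
      ENNReal.ofReal (2 * Real.pi * I.len) * ∫⁻ r in Ico (1 - I.len) 1, φ r := by
  set u : Circle := Circle.exp (I.start + Real.pi * I.len) with hu
  have huc : (u : ℂ) = circleMap 0 1 (I.start + Real.pi * I.len) := by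
    simp only [hu, circleMap, Circle.coe_exp, zero_add, Complex.ofReal_one, one_mul]
  rw [← lintegral_indicator I.measurableSet_box,
    ← (rotation u).measurePreserving.lintegral_comp_emb
      (rotation u).toHomeomorph.measurableEmbedding,
    ← Complex.lintegral_comp_polarCoord_symm]
  set S : Set (ℝ × ℝ) := Ico (1 - I.len) 1 ×ˢ Icc (-(Real.pi * I.len)) (Real.pi * I.len) with hS
  have hSm : MeasurableSet S := measurableSet_Ico.prod measurableSet_Icc
  calc ∫⁻ p in polarCoord.target, ENNReal.ofReal p.1 •
        I.box.indicator (fun z => φ ‖z‖) (rotation u (Complex.polarCoord.symm p))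
      ≤ ∫⁻ p in polarCoord.target, S.indicator (fun p => φ p.1) p := by
        refine setLIntegral_mono' polarCoord.open_target.measurableSet fun p hp => ?_
        rw [polarCoord_target] at hp
        rw [polarCoord_symm_eq_circleMap, rotation_apply, huc]
        by_cases hb : circleMap 0 1 (I.start + Real.pi * I.len) * circleMap 0 p.1 p.2 ∈ I.box
        · have hm := Arc.circleMap_mul_mem_box hp.1 hp.2 hb
          rw [indicator_of_mem hb, indicator_of_mem (show p ∈ S from hm)]
          have hn : ‖circleMap 0 1 (I.start + Real.pi * I.len) * circleMap 0 p.1 p.2‖ = p.1 := by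
            simp [abs_of_pos (show 0 < p.1 from hp.1)]
          rw [hn, smul_eq_mul]
          -- The Jacobian `r < 1` of polar coordinates is discarded.
          exact mul_le_of_le_one_left' (ENNReal.ofReal_le_one.2 hm.1.2.le)
        · rw [indicator_of_notMem hb]
          simp
    _ ≤ ∫⁻ p, S.indicator (fun p => φ p.1) p := setLIntegral_le_lintegral _ _
    _ = ∫⁻ p in S, φ p.1 := lintegral_indicator hSm _
    _ = _ := by
        rw [hS, Measure.volume_eq_prod, ← Measure.prod_restrict,
          lintegral_prod (fun p : ℝ × ℝ => φ p.1) (hφ.comp measurable_fst).aemeasurable]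
        simp only [lintegral_const, Measure.restrict_apply_univ, Real.volume_Icc]
        rw [lintegral_mul_const _ hφ, mul_comm]
        congr 2
        ring

/-- The integral of a power of `1 - |z|²` over a Carleson box. -/
theorem Arc.lintegral_box_rpow_le {q : ℝ} (hq : -1 < q) :
    ∃ C : ℝ, 0 ≤ C ∧ ∀ I : Arc, ∫⁻ z in I.box, ENNReal.ofReal ((1 - ‖z‖ ^ 2) ^ q) ≤
      ENNReal.ofReal (C * I.len ^ (q + 2)) := by
  -- Bounds `(1 + r)^q` in `(1 - r²)^q = (1 + r)^q (1 - r)^q`: by `2^q` for `q ≥ 0` and by `1` for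
  -- negative `q`, a case that does occur later.
  set c : ℝ := max (2 ^ q) 1 with hc
  have hc0 : 0 ≤ c := le_max_of_le_right zero_le_one
  have hq1 : 0 < q + 1 := by linarith
  have hp := Real.pi_pos
  refine ⟨2 * Real.pi * (c * (q + 1)⁻¹), by positivity, fun I => ?_⟩
  refine (I.lintegral_box_norm_le (φ := fun r => ENNReal.ofReal ((1 - r ^ 2) ^ q))
    (by fun_prop)).trans ?_
  have hl := I.len_pos
  have hl1 := I.len_le_one
  have key : ∫⁻ r in Ico (1 - I.len) 1, ENNReal.ofReal ((1 - r ^ 2) ^ q) ≤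
      ENNReal.ofReal (c * (I.len ^ (q + 1) / (q + 1))) := by
    have hi : IntervalIntegrable (fun r : ℝ => (1 - r) ^ q) volume (1 - I.len) 1 := by
      have := (intervalIntegral.intervalIntegrable_rpow' hq (a := I.len) (b := 0)).comp_sub_left 1
      simpa using this
    have hv : ∫ r in (1 - I.len)..1, (1 - r) ^ q = I.len ^ (q + 1) / (q + 1) := by
      rw [intervalIntegral.integral_comp_sub_left (fun x => x ^ q) 1, integral_rpow (Or.inl hq)]
      simp [Real.zero_rpow hq1.ne']
    rw [← hv, ← intervalIntegral.integral_const_mul,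
      intervalIntegral.integral_of_le (by linarith), ← integral_Ico_eq_integral_Ioc,
      ofReal_integral_eq_lintegral_ofReal]
    · refine setLIntegral_mono' measurableSet_Ico fun r hr => ENNReal.ofReal_le_ofReal ?_
      have hr1 : 0 < 1 - r := by linarith [hr.2]
      have hr0 : 0 ≤ r := by linarith [hr.1]
      have e : (1 : ℝ) - r ^ 2 = (1 + r) * (1 - r) := by ring
      rw [e, Real.mul_rpow (by linarith) hr1.le]
      refine mul_le_mul_of_nonneg_right ?_ (Real.rpow_nonneg hr1.le _)
      rcases le_total 0 q with h | h
      · exact le_max_of_le_left (Real.rpow_le_rpow (by linarith) (by linarith [hr.2]) h)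
      · exact le_max_of_le_right (Real.rpow_le_one_of_one_le_of_nonpos (by linarith) h)
    · exact (intervalIntegrable_iff_integrableOn_Ico_of_le (by linarith)).1 (hi.const_mul c)
    · refine (ae_restrict_iff' measurableSet_Ico).2 (Eventually.of_forall fun r hr => ?_)
      exact mul_nonneg hc0 (Real.rpow_nonneg (by linarith [hr.2]) _)
  refine (mul_le_mul_right key _).trans (le_of_eq ?_)
  rw [← ENNReal.ofReal_mul (by positivity)]
  congr 1
  have : I.len ^ (q + 2) = I.len * I.len ^ (q + 1) := by
    rw [show q + 2 = 1 + (q + 1) by ring, Real.rpow_add hl, Real.rpow_one]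
  rw [this]
  ring

/-- The arc of length one, whose Carleson box is the disc. -/
def Arc.full : Arc := ⟨0, 1, one_pos, le_rfl⟩

theorem Arc.full_box : Arc.full.box = disc := by
  refine Subset.antisymm (Arc.box_subset _) fun z hz => ?_
  have hp := Real.pi_pos
  refine ⟨‖z‖, toIcoMod Real.two_pi_pos 0 z.arg, ?_, mem_ball_zero_iff.1 hz, ?_, ?_⟩
  · simp [Arc.full]
  · have := toIcoMod_mem_Ico Real.two_pi_pos 0 z.arg
    simp only [Arc.angles, Arc.full]
    exact ⟨this.1, by linarith [this.2]⟩
  · have h := self_sub_toIcoDiv_zsmul Real.two_pi_pos 0 z.arg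
    rw [← h, (periodic_circleMap 0 ‖z‖).sub_zsmul_eq]
    simp [circleMap]

/-- Near the circle, an arc centred at `arg a` of length `4 (1 - |a|)` works: for `z = a (1 + w)` in
the ball, `|w| ≤ 1 - |a|`, so the angle moves by at most `|log (1 + w)| ≤ (3/2) |w|`. Away from the
circle the full arc is already short enough. -/
theorem exists_arc_ball_subset_box {a : ℂ} (ha : a ∈ disc) :
    ∃ I : Arc, Metric.ball a ((1 - ‖a‖) / 2) ⊆ I.box ∧
      I.len ≤ 4 * (1 - ‖a‖) := by
  have ha1 : ‖a‖ < 1 := mem_ball_zero_iff.1 ha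
  by_cases h : 1 - ‖a‖ ≤ 1 / 4
  · set h0 := 1 - ‖a‖ with hh
    have hpos : 0 < h0 := by linarith
    have hp := Real.pi_gt_three
    refine ⟨⟨a.arg - Real.pi * (4 * h0), 4 * h0, by linarith, by linarith⟩, fun z hz => ?_,
      le_rfl⟩
    have ha0 : a ≠ 0 := by
      rintro rfl
      simp at hh
      linarith
    rw [mem_ball_iff_norm] at hz
    set w : ℂ := (z - a) / a with hw
    have hzw : z = a * (1 + w) := by
      rw [hw]
      field_simp
      ring
    have hwn : ‖w‖ ≤ h0 := by
      rw [hw, norm_div, div_le_iff₀ (norm_pos_iff.2 ha0)]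
      nlinarith
    have harg : |(1 + w).arg| ≤ 3 / 2 * h0 := by
      rw [← Complex.log_im]
      refine (Complex.abs_im_le_norm _).trans ?_
      exact (Complex.norm_log_one_add_half_le_self (by linarith)).trans (by linarith)
    have hn1 : ‖z‖ ≤ ‖z - a‖ + ‖a‖ := by simpa using norm_add_le (z - a) a
    have hn2 : ‖a‖ ≤ ‖z - a‖ + ‖z‖ := by
      simpa [norm_sub_rev] using norm_add_le (a - z) z
    refine ⟨‖z‖, a.arg + (1 + w).arg, ?_, ?_, ?_, ?_⟩
    · simp only
      linarith
    · linarith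
    · rw [abs_le] at harg
      simp only [Arc.angles, mem_Icc]
      constructor <;> nlinarith [harg.1, harg.2]
    · rw [circleMap, zero_add]
      push_cast
      rw [add_mul, Complex.exp_add, hzw, norm_mul]
      push_cast
      calc a * (1 + w) = (‖a‖ * Complex.exp (a.arg * Complex.I)) *
            (‖1 + w‖ * Complex.exp ((1 + w).arg * Complex.I)) := by
            rw [Complex.norm_mul_exp_arg_mul_I, Complex.norm_mul_exp_arg_mul_I]
        _ = _ := by ring
  · refine ⟨Arc.full, ?_, ?_⟩
    · rw [Arc.full_box]
      intro z hz
      rw [mem_ball_iff_norm] at hz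
      have hn1 : ‖z‖ ≤ ‖z - a‖ + ‖a‖ := by simpa using norm_add_le (z - a) a
      rw [mem_ball_zero_iff]
      linarith
    · simp only [Arc.full]
      linarith

/-! ### Sub-mean value inequalities for squared moduli. -/

theorem enorm_sq_le_lintegral_circleMap {h : ℂ → ℂ} {a : ℂ} {r : ℝ} (hr : 0 < r)
    (hh : DiffContOnCl ℂ h (Metric.ball a r)) :
    ENNReal.ofReal (2 * Real.pi) * ‖h a‖ₑ ^ (2 : ℝ) ≤
      ∫⁻ θ in Ioo (-Real.pi) Real.pi, ‖h (circleMap a r θ)‖ₑ ^ (2 : ℝ) := by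
  have hp := Real.pi_pos
  -- The mean value property is applied to the holomorphic function `h²`, so that the triangle
  -- inequality for integrals yields `|h|²` directly.
  have hsq : DiffContOnCl ℂ (fun z => h z • h z) (Metric.ball a |r|) := by
    rw [abs_of_pos hr]
    exact hh.smul hh
  have h1 := hsq.circleAverage
  rw [Real.circleAverage_def] at h1
  have hper : Function.Periodic (fun θ => h (circleMap a r θ) • h (circleMap a r θ))
      (2 * Real.pi) := fun θ => by
    simp only [periodic_circleMap a r θ]
  have h2 := hper.intervalIntegral_add_eq 0 (-Real.pi)
  rw [zero_add, show -Real.pi + 2 * Real.pi = Real.pi by ring] at h2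
  rw [h2, intervalIntegral.integral_of_le (by linarith), integral_Ioc_eq_integral_Ioo] at h1
  have h3 : (2 * Real.pi : ℝ) • (h a • h a) =
      ∫ θ in Ioo (-Real.pi) Real.pi, h (circleMap a r θ) • h (circleMap a r θ) := by
    rw [← h1, smul_smul, mul_inv_cancel₀ (by positivity), one_smul]
  have h4 := enorm_integral_le_lintegral_enorm (μ := volume.restrict (Ioo (-Real.pi) Real.pi))
    (fun θ => h (circleMap a r θ) • h (circleMap a r θ))
  rw [← h3] at h4
  simp only [enorm_smul, Real.enorm_eq_ofReal (by positivity : (0 : ℝ) ≤ 2 * Real.pi)] at h4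
  simpa only [ENNReal.rpow_ofNat, sq] using h4

/-- The sub-mean value property of `|h|²` over discs. -/
theorem enorm_sq_le_lintegral_ball {h : ℂ → ℂ} {a : ℂ} {ρ : ℝ} (hρ : 0 < ρ)
    (hh : DifferentiableOn ℂ h (Metric.ball a ρ)) :
    ENNReal.ofReal (Real.pi * ρ ^ 2) * ‖h a‖ₑ ^ (2 : ℝ) ≤
      ∫⁻ z in Metric.ball a ρ, ‖h z‖ₑ ^ (2 : ℝ) := by
  have hp := Real.pi_pos
  have hint : ∫⁻ r in Ioo 0 ρ, ENNReal.ofReal r = ENNReal.ofReal (ρ ^ 2 / 2) := by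
    rw [← ofReal_integral_eq_lintegral_ofReal]
    · rw [← integral_Ioc_eq_integral_Ioo, ← intervalIntegral.integral_of_le hρ.le, integral_id]
      simp
    · exact (intervalIntegrable_iff_integrableOn_Ioo_of_le hρ.le).1
        (continuous_id.intervalIntegrable _ _)
    · exact (ae_restrict_iff' measurableSet_Ioo).2 (Eventually.of_forall fun r hr => hr.1.le)
  have hm : Measurable ((Metric.ball a ρ).indicator fun z => ‖h z‖ₑ ^ (2 : ℝ)) := by
    have hc : ContinuousOn (fun z => ‖h z‖ₑ ^ (2 : ℝ)) (Metric.ball a ρ) :=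
      (ENNReal.continuous_rpow_const.comp continuous_enorm).comp_continuousOn hh.continuousOn
    classical
    rw [← piecewise_eq_indicator]
    exact hc.measurable_piecewise continuousOn_const Metric.isOpen_ball.measurableSet
  have hm2 : Measurable fun p : ℝ × ℝ => ENNReal.ofReal p.1 *
      (Metric.ball a ρ).indicator (fun z => ‖h z‖ₑ ^ (2 : ℝ)) (a + circleMap 0 p.1 p.2) := by
    refine (ENNReal.measurable_ofReal.comp measurable_fst).mul (hm.comp ?_)
    apply Continuous.measurable
    unfold circleMap
    fun_prop
  rw [← lintegral_indicator Metric.isOpen_ball.measurableSet,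
    ← lintegral_add_left_eq_self _ a,
    ← Complex.lintegral_comp_polarCoord_symm, polarCoord_target, Measure.volume_eq_prod,
    ← Measure.prod_restrict]
  simp only [polarCoord_symm_eq_circleMap, smul_eq_mul]
  rw [lintegral_prod _ hm2.aemeasurable]
  calc ENNReal.ofReal (Real.pi * ρ ^ 2) * ‖h a‖ₑ ^ (2 : ℝ)
      = ∫⁻ r in Ioo 0 ρ, ENNReal.ofReal r * (ENNReal.ofReal (2 * Real.pi) * ‖h a‖ₑ ^ (2 : ℝ)) := by
        rw [lintegral_mul_const _ (by fun_prop), hint, ← mul_assoc,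
          ← ENNReal.ofReal_mul (by positivity)]
        congr 2
        ring
    _ ≤ ∫⁻ r in Ioo 0 ρ, ∫⁻ θ in Ioo (-Real.pi) Real.pi, ENNReal.ofReal r *
      (Metric.ball a ρ).indicator (fun z => ‖h z‖ₑ ^ (2 : ℝ)) (a + circleMap 0 r θ) := by
        refine setLIntegral_mono' measurableSet_Ioo fun r hr => ?_
        rw [lintegral_const_mul' _ _ ENNReal.ofReal_ne_top]
        refine mul_le_mul_right ((enorm_sq_le_lintegral_circleMap hr.1
          (hh.diffContOnCl_ball (Metric.closedBall_subset_ball hr.2))).trans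
          (le_of_eq (lintegral_congr fun θ => ?_))) _
        have : circleMap a r θ = a + circleMap 0 r θ := by simp [circleMap]
        rw [this, indicator_of_mem]
        simpa [abs_of_pos hr.1] using hr.2
    _ ≤ _ := lintegral_mono_set Ioo_subset_Ioi_self

/-! ### Growth from the Carleson quantities -/

theorem one_sub_norm_pos {z : ℂ} (hz : z ∈ disc) : 0 < 1 - ‖z‖ := by
  linarith [mem_ball_zero_iff.1 hz]

theorem setLIntegral_areaMeasure (S : Set ℂ) (φ : ℂ → ℝ≥0∞) :
    ∫⁻ z in S, φ z ∂areaMeasure = ENNReal.ofReal Real.pi⁻¹ * ∫⁻ z in S, φ z := by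
  rw [areaMeasure, Measure.restrict_smul, lintegral_smul_measure, smul_eq_mul]

theorem carleson_sq (p s : ℝ) (f : HolD) (I : Arc) :
    carleson p s f I ^ (2 : ℝ) = ENNReal.ofReal (I.len ^ (-s)) * (ENNReal.ofReal Real.pi⁻¹ *
      ∫⁻ z in I.box, ‖deriv f z‖ₑ ^ (2 : ℝ) * ENNReal.ofReal ((1 - ‖z‖ ^ 2) ^ p)) := by
  rw [carleson, ← ENNReal.rpow_mul, setLIntegral_areaMeasure]
  norm_num

/-- On the ball of radius `(1 - |a|) / 2` the weight `1 - |z|²` is at least that radius. The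
exponent `p + 2` thus collects `p` from the weight and `2` from the area of the ball; the factor `π`
of that area cancels the normalization of the measure. -/
theorem mul_enorm_deriv_sq_le_carleson_sq {p s : ℝ} (hp : 0 ≤ p) (hs : 0 ≤ s) (f : HolD) {a : ℂ}
    (ha : a ∈ disc) {I : Arc} (hI : Metric.ball a ((1 - ‖a‖) / 2) ⊆ I.box)
    (hI' : I.len ≤ 4 * (1 - ‖a‖)) :
    ENNReal.ofReal ((4 * (1 - ‖a‖)) ^ (-s) * ((1 - ‖a‖) / 2) ^ (p + 2)) *
      ‖deriv f a‖ₑ ^ (2 : ℝ) ≤ carleson p s f I ^ (2 : ℝ) := by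
  have hh := one_sub_norm_pos ha
  set h := 1 - ‖a‖ with hdef
  have hπ := Real.pi_pos
  have hsub : Metric.ball a (h / 2) ⊆ disc := hI.trans I.box_subset
  have h1 := enorm_sq_le_lintegral_ball (half_pos hh) (f.differentiableOn_deriv.mono hsub)
  have h2 : ENNReal.ofReal ((h / 2) ^ p) * ∫⁻ z in Metric.ball a (h / 2), ‖deriv f z‖ₑ ^ (2 : ℝ) ≤
      ∫⁻ z in I.box, ‖deriv f z‖ₑ ^ (2 : ℝ) * ENNReal.ofReal ((1 - ‖z‖ ^ 2) ^ p) := by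
    rw [← lintegral_const_mul' _ _ ENNReal.ofReal_ne_top]
    refine (setLIntegral_mono' Metric.isOpen_ball.measurableSet fun z hz => ?_).trans
      (lintegral_mono_set hI)
    rw [mul_comm]
    refine mul_le_mul_right (ENNReal.ofReal_le_ofReal (Real.rpow_le_rpow (by positivity) ?_ hp)) _
    rw [mem_ball_iff_norm] at hz
    have hn : ‖z‖ ≤ ‖z - a‖ + ‖a‖ := by simpa using norm_add_le (z - a) a
    have hz1 : h / 2 ≤ 1 - ‖z‖ := by linarith
    nlinarith [norm_nonneg z]
  rw [carleson_sq]
  calc ENNReal.ofReal ((4 * h) ^ (-s) * (h / 2) ^ (p + 2)) * ‖deriv f a‖ₑ ^ (2 : ℝ)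
      = ENNReal.ofReal ((4 * h) ^ (-s)) * (ENNReal.ofReal Real.pi⁻¹ * (ENNReal.ofReal ((h / 2) ^ p)
        * (ENNReal.ofReal (Real.pi * (h / 2) ^ 2) * ‖deriv f a‖ₑ ^ (2 : ℝ)))) := by
        rw [← mul_assoc, ← mul_assoc, ← mul_assoc, ← ENNReal.ofReal_mul (by positivity),
          ← ENNReal.ofReal_mul (by positivity), ← ENNReal.ofReal_mul (by positivity),
          Real.rpow_add (by positivity), Real.rpow_two]
        congr 2
        field_simp
    _ ≤ _ := by
        gcongr ?_ * (_ * ?_)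
        · exact ENNReal.ofReal_le_ofReal
            (Real.rpow_le_rpow_of_nonpos I.len_pos hI' (neg_nonpos.2 hs))
        · exact (mul_le_mul_right h1 _).trans h2

/-- Pointwise control of the derivative by the Carleson quantity of an arc of comparable size. -/
theorem exists_enorm_deriv_le_carleson {p s : ℝ} (hp : 0 ≤ p) (hs : 0 ≤ s) :
    ∃ C : ℝ, 0 < C ∧ ∀ f : HolD, ∀ a ∈ disc, ∃ I : Arc, I.len ≤ 4 * (1 - ‖a‖) ∧
      ‖deriv f a‖ₑ ≤
        ENNReal.ofReal (C * (1 - ‖a‖) ^ ((s - 2 - p) / 2)) * carleson p s f I := by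
  set c : ℝ := 4 ^ (-s) * (2⁻¹) ^ (p + 2) with hc
  have hc0 : 0 < c := by positivity
  refine ⟨(c ^ (1 / 2 : ℝ))⁻¹, by positivity, fun f a ha => ?_⟩
  obtain ⟨I, hI, hI'⟩ := exists_arc_ball_subset_box ha
  refine ⟨I, hI', ?_⟩
  have hh := one_sub_norm_pos ha
  have key := mul_enorm_deriv_sq_le_carleson_sq hp hs f ha hI hI'
  set h := 1 - ‖a‖ with hdef
  have e : (4 * h) ^ (-s) * (h / 2) ^ (p + 2) = (c ^ (1 / 2 : ℝ) * h ^ ((p + 2 - s) / 2)) ^ 2 := by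
    have hsq : ∀ x y : ℝ, 0 < x → (x ^ (y / 2)) ^ 2 = x ^ y := fun x y hx => by
      rw [← Real.rpow_natCast, ← Real.rpow_mul hx.le]
      congr 1
      push_cast
      ring
    rw [mul_pow, hsq _ _ hc0, hsq _ _ hh, Real.mul_rpow (by norm_num) hh.le, div_eq_inv_mul,
      Real.mul_rpow (by norm_num) hh.le, show p + 2 - s = -s + (p + 2) by ring,
      Real.rpow_add hh (-s) (p + 2), Real.rpow_one, hc]
    ring
  have hpos : 0 < c ^ (1 / 2 : ℝ) * h ^ ((p + 2 - s) / 2) := by positivity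
  rw [e, ENNReal.ofReal_pow hpos.le, ← ENNReal.rpow_two,
    ← ENNReal.mul_rpow_of_nonneg _ _ (by norm_num),
    ENNReal.rpow_le_rpow_iff (by norm_num)] at key
  have e2 : (c ^ (1 / 2 : ℝ))⁻¹ * h ^ ((s - 2 - p) / 2) =
      (c ^ (1 / 2 : ℝ) * h ^ ((p + 2 - s) / 2))⁻¹ := by
    rw [mul_inv, ← Real.rpow_neg hh.le]
    congr 2
    ring
  rw [e2, ENNReal.ofReal_inv_of_pos hpos, ← ENNReal.div_eq_inv_mul]
  rw [ENNReal.le_div_iff_mul_le (Or.inl (by simpa using hpos)) (Or.inl ENNReal.ofReal_ne_top),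
    mul_comm]
  exact key

/-- Growth of a function from the growth of its derivative. -/
theorem norm_le_of_norm_deriv_le {f : HolD} {M s : ℝ} (hs : 0 < s) (hM : 0 ≤ M)
    (h : ∀ z ∈ disc, ‖deriv f z‖ ≤ M * (1 - ‖z‖) ^ (-1 - s)) {z : ℂ} (hz : z ∈ disc) :
    ‖f z‖ ≤ ‖f 0‖ + M / s * (1 - ‖z‖) ^ (-s) := by
  have hz1 := mem_ball_zero_iff.1 hz
  have hpos : ∀ t ∈ Icc (0 : ℝ) 1, 0 < 1 - t * ‖z‖ := fun t ht => by
    nlinarith [norm_nonneg z, ht.1, ht.2]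
  have hf : ∀ t ∈ Icc (0 : ℝ) 1,
      HasDerivAt (fun t : ℝ => f (t * z)) (deriv f (t * z) * z) t := fun t ht => by
    have h2 : HasDerivAt (fun t : ℝ => (t : ℂ) * z) (1 * z) t :=
      (Complex.ofRealCLM.hasDerivAt (x := t)).mul_const z
    rw [one_mul] at h2
    exact (f.differentiableAt (smul_mem_disc hz ht)).hasDerivAt.comp t h2
  -- The majorant on the segment from `0` to `z`: its derivative is exactly the assumed bound for
  -- the derivative of `t ↦ f (t z)`.
  have hB : ∀ t ∈ Icc (0 : ℝ) 1, HasDerivAt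
      (fun t : ℝ => ‖f 0‖ + M / s * (1 - t * ‖z‖) ^ (-s))
      (M * (1 - t * ‖z‖) ^ (-1 - s) * ‖z‖) t := fun t ht => by
    have h3 : HasDerivAt (fun t : ℝ => 1 - t * ‖z‖) (-(1 * ‖z‖)) t :=
      ((hasDerivAt_id t).mul_const ‖z‖).const_sub 1
    have h4 := ((h3.rpow_const (p := -s) (Or.inl (hpos t ht).ne')).const_mul (M / s)).const_add ‖f 0‖
    refine h4.congr_deriv ?_
    rw [show -s - 1 = -1 - s by ring]
    field_simp
  have key := image_norm_le_of_norm_deriv_right_le_deriv_boundary'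
    (f := fun t : ℝ => f (t * z)) (a := 0) (b := 1)
    (fun t ht => (hf t ht).continuousAt.continuousWithinAt)
    (fun t ht => (hf t (Ico_subset_Icc_self ht)).hasDerivWithinAt)
    (B := fun t : ℝ => ‖f 0‖ + M / s * (1 - t * ‖z‖) ^ (-s))
    (by
      have : 0 ≤ M / s := by positivity
      simpa using this)
    (fun t ht => (hB t ht).continuousAt.continuousWithinAt)
    (fun t ht => (hB t (Ico_subset_Icc_self ht)).hasDerivWithinAt)
    (fun t ht => by
      have h5 := h _ (smul_mem_disc hz (Ico_subset_Icc_self ht))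
      rw [norm_mul (t : ℂ) z, Complex.norm_real, Real.norm_of_nonneg ht.1] at h5
      rw [norm_mul]
      exact mul_le_mul_of_nonneg_right h5 (norm_nonneg z))
    (right_mem_Icc.2 zero_le_one)
  simpa using key

/-- Functions in the unit ball of the Morrey norm have uniformly controlled growth. -/
theorem exists_norm_le_of_morreyNorm_le_one {lam : ℝ} (h0 : 0 < lam) (h1 : lam < 1) :
    ∃ C : ℝ, 0 < C ∧ ∀ f : HolD, morreyNorm lam f ≤ 1 → ∀ z ∈ disc,
      ‖f z‖ ≤ C * (1 - ‖z‖) ^ (-((1 - lam) / 2)) := by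
  obtain ⟨C, hC, hCf⟩ := exists_enorm_deriv_le_carleson (p := 1) zero_le_one h0.le
  have hs : 0 < (1 - lam) / 2 := by linarith
  refine ⟨1 + C / ((1 - lam) / 2), by positivity, fun f hf z hz => ?_⟩
  have hf0 : ‖f 0‖ ≤ 1 := by
    have : ‖f 0‖ₑ ≤ 1 := le_self_add.trans hf
    rw [← ofReal_norm, ENNReal.ofReal_le_one] at this
    exact this
  have hd : ∀ z ∈ disc, ‖deriv f z‖ ≤ C * (1 - ‖z‖) ^ (-1 - (1 - lam) / 2) := fun z hz => by
    obtain ⟨I, -, hI⟩ := hCf f z hz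
    have hz0 := one_sub_norm_pos hz
    have h2 : carleson 1 lam f I ≤ 1 :=
      (le_iSup (carleson 1 lam f) I).trans (le_add_self.trans hf)
    have h3 := hI.trans (mul_le_of_le_one_right' h2)
    rw [← ofReal_norm, ENNReal.ofReal_le_ofReal_iff (by positivity)] at h3
    rwa [show -1 - (1 - lam) / 2 = (lam - 2 - 1) / 2 by ring]
  have h4 := norm_le_of_norm_deriv_le hs hC.le hd hz
  have h5 : 1 ≤ (1 - ‖z‖) ^ (-((1 - lam) / 2)) :=
    Real.one_le_rpow_of_pos_of_le_one_of_nonpos (one_sub_norm_pos hz)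
      (by linarith [norm_nonneg z]) (by linarith)
  rw [add_mul, one_mul]
  linarith

/-! ### Averages over arcs -/

/-- A function whose growth under halving is at most `D * h ^ (-s)` is `O(h ^ (-s))`. -/
theorem le_mul_rpow_neg_of_halving {s D : ℝ} (hs : 0 < s) (hD : 0 ≤ D) {A : ℝ → ℝ}
    (hbase : ∀ h, 1 / 2 < h → h ≤ 1 → A h ≤ D)
    (hstep : ∀ h, 0 < h → h ≤ 1 → A (h / 2) ≤ A h + D * h ^ (-s)) {h : ℝ} (h0 : 0 < h)
    (h1 : h ≤ 1) : A h ≤ D * max 1 (2 ^ s - 1)⁻¹ * h ^ (-s) := by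
  set K := D * max 1 (2 ^ s - 1)⁻¹ with hK
  have h2s : 0 < (2 : ℝ) ^ s - 1 := by
    linarith [Real.one_lt_rpow (by norm_num : (1 : ℝ) < 2) hs]
  have hKD : D ≤ K := le_mul_of_one_le_right hD (le_max_left _ _)
  -- The constant makes the induction close: descending from `2h` to `h` adds `D (2h)^(-s)`, while
  -- the allowed bound gains a factor `2^s`.
  have hK2 : K + D ≤ K * 2 ^ s := by
    have : D * (2 ^ s - 1)⁻¹ ≤ K := mul_le_mul_of_nonneg_left (le_max_right _ _) hD
    rw [← div_eq_mul_inv, div_le_iff₀ h2s] at this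
    linarith
  have big : ∀ h, 1 / 2 < h → h ≤ 1 → A h ≤ K * h ^ (-s) := fun h ha hb => by
    have := Real.one_le_rpow_of_pos_of_le_one_of_nonpos (by linarith : 0 < h) hb
      (neg_nonpos.2 hs.le)
    nlinarith [hbase h ha hb]
  have main : ∀ n : ℕ, ∀ h, (1 / 2 : ℝ) ^ (n + 1) < h → h ≤ 1 → A h ≤ K * h ^ (-s) := by
    intro n
    induction n with
    | zero =>
      intro h ha hb
      exact big h (by simpa using ha) hb
    | succ n ih =>
      intro h ha hb
      rcases lt_or_ge (1 / 2) h with hc | hc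
      · exact big h hc hb
      · have hpos : 0 < h := lt_trans (by positivity) ha
        have e1 := ih (2 * h) (by rw [pow_succ] at ha; linarith) (by linarith)
        have e2 := hstep (2 * h) (by linarith) (by linarith)
        rw [show 2 * h / 2 = h by ring] at e2
        rw [Real.mul_rpow (by norm_num) hpos.le, Real.rpow_neg (by norm_num : (0 : ℝ) ≤ 2)] at e1 e2
        have h2 : (0 : ℝ) < 2 ^ s := by positivity
        have h3 : 0 < h ^ (-s) := Real.rpow_pos_of_pos hpos _
        calc A h ≤ (K + D) * ((2 ^ s)⁻¹ * h ^ (-s)) := by linarith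
          _ ≤ K * 2 ^ s * ((2 ^ s)⁻¹ * h ^ (-s)) :=
              mul_le_mul_of_nonneg_right hK2 (by positivity)
          _ = K * h ^ (-s) := by field_simp
  obtain ⟨n, hn⟩ := exists_pow_lt_of_lt_one h0 (by norm_num : (1 / 2 : ℝ) < 1)
  refine main n h (lt_of_le_of_lt ?_ hn) h1
  exact pow_le_pow_of_le_one (by norm_num) (by norm_num) (Nat.le_succ n)

/-- Cauchy–Schwarz against the constant `1` on an angular interval of length `2π|I|`, which
contributes the square root of `2π|I|`. -/
theorem integral_norm_sub_arcAverage_le {lam N : ℝ} {F : Circle → ℂ} (hN : 0 ≤ N)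
    (hF : AEMeasurable (fun θ : ℝ => F (Circle.exp θ)) volume) {I : Arc}
    (h : oscillation lam F I ≤ ENNReal.ofReal N) :
    ∫ θ in I.angles, ‖F (Circle.exp θ) - arcAverage F I‖ ≤
      2 * Real.pi * N * I.len ^ (1 - (1 - lam) / 2) := by
  have hπ := Real.pi_pos
  have hl := I.len_pos
  have hll : 0 < I.len ^ (-lam) := Real.rpow_pos_of_pos hl _
  have hm : AEMeasurable (fun θ : ℝ => ‖F (Circle.exp θ) - arcAverage F I‖ₑ)
      (volume.restrict I.angles) := (hF.sub_const _).enorm.restrict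
  set X := ∫⁻ θ in I.angles, ‖F (Circle.exp θ) - arcAverage F I‖ₑ ^ (2 : ℝ) with hX
  have hX1 : X ≤ ENNReal.ofReal (2 * Real.pi * I.len ^ lam * N ^ 2) := by
    have h2 := ENNReal.rpow_le_rpow h (by norm_num : (0 : ℝ) ≤ 2)
    rw [oscillation, ← ENNReal.rpow_mul, ← hX, ENNReal.ofReal_rpow_of_nonneg hN (by norm_num)] at h2
    norm_num at h2
    have hc : 0 < I.len ^ (-lam) * (Real.pi⁻¹ * (1 / 2)) := by positivity
    have h3 : X ≤ ENNReal.ofReal (N ^ 2) / ENNReal.ofReal (I.len ^ (-lam) * (Real.pi⁻¹ * (1 / 2))) := by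
      rw [ENNReal.le_div_iff_mul_le (Or.inl (by simpa using hc)) (Or.inl ENNReal.ofReal_ne_top),
        mul_comm]
      exact h2
    rw [← ENNReal.ofReal_div_of_pos hc] at h3
    refine h3.trans (le_of_eq ?_)
    rw [Real.rpow_neg hl.le]
    congr 1
    field_simp
  have hvol : volume I.angles = ENNReal.ofReal (2 * Real.pi * I.len) := by
    rw [Arc.angles, Real.volume_Icc]
    congr 1
    ring
  have hH := ENNReal.lintegral_mul_le_Lp_mul_Lq (volume.restrict I.angles)
    (Real.HolderConjugate.two_two) hm (aemeasurable_const (b := (1 : ℝ≥0∞)))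
  simp only [Pi.mul_apply, mul_one, ENNReal.one_rpow, lintegral_const,
    Measure.restrict_apply_univ, one_mul, hvol] at hH
  rw [integral_eq_lintegral_of_nonneg_ae (Eventually.of_forall fun _ => norm_nonneg _)
    (hF.sub_const _).norm.aestronglyMeasurable.restrict]
  simp only [ofReal_norm]
  refine ENNReal.toReal_le_of_le_ofReal (by positivity) (hH.trans ?_)
  refine (mul_le_mul_left (ENNReal.rpow_le_rpow hX1 (by norm_num)) _).trans (le_of_eq ?_)
  rw [ENNReal.ofReal_rpow_of_nonneg (by positivity) (by norm_num),
    ENNReal.ofReal_rpow_of_nonneg (by positivity) (by norm_num), ← ENNReal.ofReal_mul (by positivity),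
    ← Real.mul_rpow (by positivity) (by positivity)]
  congr 1
  have e : 2 * Real.pi * I.len ^ lam * N ^ 2 * (2 * Real.pi * I.len) =
      (2 * Real.pi * N * I.len ^ (1 - (1 - lam) / 2)) ^ 2 := by
    rw [mul_pow, ← Real.rpow_natCast (I.len ^ _), ← Real.rpow_mul hl.le,
      show (1 - (1 - lam) / 2) * ((2 : ℕ) : ℝ) = lam + 1 by push_cast; ring,
      Real.rpow_add hl, Real.rpow_one]
    ring
  rw [e, ← Real.sqrt_eq_rpow, Real.sqrt_sq (by positivity)]

theorem integrableOn_circle {lam : ℝ} {F : Circle → ℂ}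
    (hF : AEMeasurable (fun θ : ℝ => F (Circle.exp θ)) volume)
    (h : ⨆ I, oscillation lam F I < ⊤) (a : ℝ) :
    IntegrableOn (fun θ : ℝ => F (Circle.exp θ)) (Icc a (a + 2 * Real.pi)) := by
  simpa [Arc.angles] using integrableOn_of_oscillation_lt_top (I := ⟨a, 1, one_pos, le_rfl⟩) hF
    ((le_iSup _ _).trans_lt h)

theorem setIntegral_norm_circle_eq (F : Circle → ℂ) (a : ℝ) :
    ∫ θ in Icc a (a + 2 * Real.pi), ‖F (Circle.exp θ)‖ =
      ∫ θ in (0 : ℝ)..2 * Real.pi, ‖F (Circle.exp θ)‖ := by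
  have hper : Function.Periodic (fun θ : ℝ => ‖F (Circle.exp θ)‖) (2 * Real.pi) := fun θ => by
    simp only [Circle.exp_add, Circle.exp_two_pi, mul_one]
  rw [integral_Icc_eq_integral_Ioc, ← intervalIntegral.integral_of_le
    (by linarith [Real.pi_pos]), hper.intervalIntegral_add_eq a 0, zero_add]

/-- A Campanato condition with exponent below one implies a Morrey condition. -/
theorem exists_setIntegral_norm_le {lam : ℝ} (h1 : lam < 1) {F : Circle → ℂ}
    (hF : AEMeasurable (fun θ : ℝ => F (Circle.exp θ)) volume)
    (h : ⨆ I, oscillation lam F I < ⊤) :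
    ∃ K : ℝ, 0 ≤ K ∧ ∀ a r : ℝ, 0 < r → r ≤ 1 →
      ∫ θ in Icc a (a + 2 * Real.pi * r), ‖F (Circle.exp θ)‖ ≤ K * r ^ (1 - (1 - lam) / 2) := by
  have hπ := Real.pi_pos
  have hs : 0 < (1 - lam) / 2 := by linarith
  set s := (1 - lam) / 2 with hsdef
  set N := (⨆ I, oscillation lam F I).toReal with hN
  have hN0 : 0 ≤ N := ENNReal.toReal_nonneg
  have hosc : ∀ I, oscillation lam F I ≤ ENNReal.ofReal N := fun I => by
    rw [hN, ENNReal.ofReal_toReal h.ne]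
    exact le_iSup _ I
  set P := ∫ θ in (0 : ℝ)..2 * Real.pi, ‖F (Circle.exp θ)‖ with hP
  have hP0 : 0 ≤ P := intervalIntegral.integral_nonneg (by positivity) fun _ _ => norm_nonneg _
  -- `P / π` bounds the averages over arcs of length above `1/2`; `2N` is the price of one halving.
  set D := max (P / Real.pi) (2 * N) with hD
  have hD0 : 0 ≤ D := le_max_of_le_right (by positivity)
  set K := D * max 1 (2 ^ s - 1)⁻¹ with hK
  have hK0 : 0 ≤ K := mul_nonneg hD0 (le_max_of_le_left zero_le_one)
  have hsub : ∀ a r r' : ℝ, r ≤ r' →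
      Icc a (a + 2 * Real.pi * r) ⊆ Icc a (a + 2 * Real.pi * r') := fun a r r' hr =>
    Icc_subset_Icc_right (by gcongr)
  have hint : ∀ a r : ℝ, r ≤ 1 →
      IntegrableOn (fun θ : ℝ => F (Circle.exp θ)) (Icc a (a + 2 * Real.pi * r)) :=
    fun a r hr => (integrableOn_circle hF h a).mono_set (by simpa using hsub a r 1 hr)
  have hconst : ∀ (a r : ℝ) (c : ℂ), IntegrableOn (fun _ : ℝ => c) (Icc a (a + 2 * Real.pi * r)) :=
    fun a r c => integrableOn_const isCompact_Icc.measure_lt_top.ne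
  have hvol : ∀ a r : ℝ, 0 ≤ r → volume.real (Icc a (a + 2 * Real.pi * r)) = 2 * Real.pi * r := by
    intro a r hr
    rw [Real.volume_real_Icc_of_le (by nlinarith)]
    ring
  have hdev : ∀ a r : ℝ, 0 < r → r ≤ 1 → ∫ θ in Icc a (a + 2 * Real.pi * r),
      ‖F (Circle.exp θ) - ((1 / r * (1 / (2 * Real.pi)) : ℝ) : ℂ) *
        ∫ θ in Icc a (a + 2 * Real.pi * r), F (Circle.exp θ)‖ ≤ 2 * Real.pi * N * r ^ (1 - s) :=
    fun a r hr hr1 => integral_norm_sub_arcAverage_le hN0 hF (hosc ⟨a, r, hr, hr1⟩)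
  -- With the left endpoint fixed, the average over the first half of an arc differs from the
  -- average over the whole by at most twice the mean deviation, that is `2N r^(-s)`. Summing these
  -- geometric errors over dyadic scales is the halving lemma.
  have havg : ∀ a r : ℝ, 0 < r → r ≤ 1 → ‖((1 / r * (1 / (2 * Real.pi)) : ℝ) : ℂ) *
      ∫ θ in Icc a (a + 2 * Real.pi * r), F (Circle.exp θ)‖ ≤ K * r ^ (-s) := by
    intro a r hr hr1
    refine le_mul_rpow_neg_of_halving (A := fun r => ‖((1 / r * (1 / (2 * Real.pi)) : ℝ) : ℂ) *
      ∫ θ in Icc a (a + 2 * Real.pi * r), F (Circle.exp θ)‖) hs hD0 ?_ ?_ hr hr1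
    · intro r hr hr1
      have hr0 : 0 < r := by linarith
      refine le_trans ?_ (le_max_left _ _)
      rw [norm_mul, Complex.norm_real, Real.norm_of_nonneg (by positivity)]
      have e1 : ‖∫ θ in Icc a (a + 2 * Real.pi * r), F (Circle.exp θ)‖ ≤ P := by
        refine (norm_integral_le_integral_norm _).trans ?_
        rw [hP, ← setIntegral_norm_circle_eq F a]
        refine setIntegral_mono_set (integrableOn_circle hF h a).norm
          (Eventually.of_forall fun _ => norm_nonneg _) (LE.le.eventuallyLE ?_)
        simpa using hsub a r 1 hr1
      have e2 : 1 / r * (1 / (2 * Real.pi)) ≤ 1 / Real.pi := by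
        have e3 : 1 / r ≤ 2 := by
          rw [div_le_iff₀ hr0]
          linarith
        calc 1 / r * (1 / (2 * Real.pi)) ≤ 2 * (1 / (2 * Real.pi)) := by gcongr
          _ = 1 / Real.pi := by field_simp
      calc _ ≤ 1 / Real.pi * P := by gcongr
        _ = P / Real.pi := by ring
    · intro r hr hr1
      set c : ℂ := ((1 / r * (1 / (2 * Real.pi)) : ℝ) : ℂ) *
        ∫ θ in Icc a (a + 2 * Real.pi * r), F (Circle.exp θ) with hc
      have e0 : ((1 / (r / 2) * (1 / (2 * Real.pi)) : ℝ) : ℂ) *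
          ∫ θ in Icc a (a + 2 * Real.pi * (r / 2)), F (Circle.exp θ) =
          c + ((1 / (r / 2) * (1 / (2 * Real.pi)) : ℝ) : ℂ) *
          ∫ θ in Icc a (a + 2 * Real.pi * (r / 2)), (F (Circle.exp θ) - c) := by
        rw [integral_sub (hint a (r / 2) (by linarith)) (hconst a _ c), setIntegral_const,
          hvol a (r / 2) (by positivity), mul_sub, Complex.real_smul, ← mul_assoc,
          ← Complex.ofReal_mul, show 1 / (r / 2) * (1 / (2 * Real.pi)) * (2 * Real.pi * (r / 2)) = 1
            by field_simp]
        push_cast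
        ring
      rw [e0]
      refine (norm_add_le _ _).trans (add_le_add_right ?_ _)
      rw [norm_mul, Complex.norm_real, Real.norm_of_nonneg (by positivity)]
      have e1 : ‖∫ θ in Icc a (a + 2 * Real.pi * (r / 2)), (F (Circle.exp θ) - c)‖ ≤
          2 * Real.pi * N * r ^ (1 - s) := by
        refine (norm_integral_le_integral_norm _).trans (le_trans ?_ (hdev a r hr hr1))
        exact setIntegral_mono_set ((hint a r hr1).sub (hconst a r c)).norm
          (Eventually.of_forall fun _ => norm_nonneg _)
          (LE.le.eventuallyLE (hsub a _ _ (by linarith)))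
      calc _ ≤ 1 / (r / 2) * (1 / (2 * Real.pi)) * (2 * Real.pi * N * r ^ (1 - s)) := by gcongr
        _ = 2 * N * r ^ (-s) := by
            rw [sub_eq_add_neg, Real.rpow_add hr, Real.rpow_one]
            field_simp
        _ ≤ D * r ^ (-s) :=
            mul_le_mul_of_nonneg_right (le_max_right _ _) (Real.rpow_nonneg hr.le _)
  refine ⟨2 * Real.pi * (N + K), by positivity, fun a r hr hr1 => ?_⟩
  set c : ℂ := ((1 / r * (1 / (2 * Real.pi)) : ℝ) : ℂ) *
        ∫ θ in Icc a (a + 2 * Real.pi * r), F (Circle.exp θ) with hc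
  have hi : IntegrableOn (fun θ => ‖F (Circle.exp θ) - c‖) (Icc a (a + 2 * Real.pi * r)) :=
    ((hint a r hr1).sub (hconst a r c)).norm
  calc ∫ θ in Icc a (a + 2 * Real.pi * r), ‖F (Circle.exp θ)‖
      ≤ ∫ θ in Icc a (a + 2 * Real.pi * r), (‖F (Circle.exp θ) - c‖ + ‖c‖) := by
        refine setIntegral_mono (hint a r hr1).norm (hi.add (hconst a r c).norm) fun θ => ?_
        simpa using norm_add_le (F (Circle.exp θ) - c) c
    _ = (∫ θ in Icc a (a + 2 * Real.pi * r), ‖F (Circle.exp θ) - c‖) + 2 * Real.pi * r * ‖c‖ := by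
        rw [integral_add hi (hconst a r c).norm, setIntegral_const, hvol a r hr.le, smul_eq_mul]
    _ ≤ 2 * Real.pi * N * r ^ (1 - s) + 2 * Real.pi * r * (K * r ^ (-s)) :=
        add_le_add (hdev a r hr hr1) (mul_le_mul_of_nonneg_left (havg a r hr hr1) (by positivity))
    _ = 2 * Real.pi * (N + K) * r ^ (1 - s) := by
        rw [sub_eq_add_neg, Real.rpow_add hr, Real.rpow_one]
        ring

/-! ### Growth of functions in the Morrey space -/

/-- The kernel `1 / max r |θ - φ|` stands in for `1 / |e^{iθ} - z|` with `1 - |z| = r` and `arg z =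
φ`. Replacing `r` by `r / 2` changes it only where `|θ - φ| ≤ r`, and there it is at most `2 / r`;
the Morrey bound for `∫ |F|` over that interval makes the increase `O(r^(-s))`, so the halving lemma
applies again. -/
theorem exists_setIntegral_norm_div_max_le {lam : ℝ} (h0 : 0 < lam) (h1 : lam < 1) {F : Circle → ℂ}
    (hF : AEMeasurable (fun θ : ℝ => F (Circle.exp θ)) volume)
    (h : ⨆ I, oscillation lam F I < ⊤) :
    ∃ K : ℝ, 0 ≤ K ∧ ∀ φ r : ℝ, 0 < r → r ≤ 1 →
      ∫ θ in Icc (φ - Real.pi) (φ + Real.pi), ‖F (Circle.exp θ)‖ * (max r |θ - φ|)⁻¹ ≤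
        K * r ^ (-((1 - lam) / 2)) := by
  have hπ := Real.pi_gt_three
  have hs : 0 < (1 - lam) / 2 := by linarith
  obtain ⟨K, hK0, hK⟩ := exists_setIntegral_norm_le h1 hF h
  set s := (1 - lam) / 2 with hsdef
  set P := ∫ θ in (0 : ℝ)..2 * Real.pi, ‖F (Circle.exp θ)‖ with hP
  have hP0 : 0 ≤ P := intervalIntegral.integral_nonneg (by positivity) fun _ _ => norm_nonneg _
  set D := max (2 * P) (2 * K) with hD
  have hD0 : 0 ≤ D := le_max_of_le_left (by positivity)
  refine ⟨D * max 1 (2 ^ s - 1)⁻¹, mul_nonneg hD0 (le_max_of_le_left zero_le_one),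
    fun φ r hr hr1 => ?_⟩
  have hE : Icc (φ - Real.pi) (φ + Real.pi) = Icc (φ - Real.pi) (φ - Real.pi + 2 * Real.pi) := by
    congr 1
    ring
  have hint : IntegrableOn (fun θ : ℝ => ‖F (Circle.exp θ)‖)
      (Icc (φ - Real.pi) (φ + Real.pi)) := by
    rw [hE]
    exact (integrableOn_circle hF h _).norm
  have hker : ∀ r : ℝ, 0 < r → IntegrableOn
      (fun θ : ℝ => ‖F (Circle.exp θ)‖ * (max r |θ - φ|)⁻¹)
      (Icc (φ - Real.pi) (φ + Real.pi)) := fun r hr => by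
    refine hint.mul_bdd (c := r⁻¹) ?_ (Eventually.of_forall fun θ => ?_)
    · exact (Continuous.inv₀ (by fun_prop) fun θ => (lt_max_of_lt_left hr).ne').aestronglyMeasurable
    · have : 0 < max r |θ - φ| := lt_max_of_lt_left hr
      rw [Real.norm_of_nonneg (by positivity)]
      gcongr
      exact le_max_left _ _
  refine le_mul_rpow_neg_of_halving (A := fun r => ∫ θ in Icc (φ - Real.pi) (φ + Real.pi),
    ‖F (Circle.exp θ)‖ * (max r |θ - φ|)⁻¹) hs hD0 ?_ ?_ hr hr1
  · intro r hr hr1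
    have hr0 : 0 < r := by linarith
    refine le_trans ?_ (le_max_left _ _)
    rw [hP, ← setIntegral_norm_circle_eq F (φ - Real.pi), ← hE, ← integral_const_mul]
    refine setIntegral_mono (hker r hr0) (hint.const_mul 2) fun θ => ?_
    simp only
    rw [mul_comm]
    refine mul_le_mul_of_nonneg_right ?_ (norm_nonneg _)
    rw [inv_le_comm₀ (lt_max_of_lt_left hr0) (by norm_num)]
    exact le_max_of_le_left (by linarith)
  · intro r hr hr1
    have hS : Icc (φ - r) (φ + r) ⊆ Icc (φ - Real.pi) (φ + Real.pi) :=
      Icc_subset_Icc (by linarith) (by linarith)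
    have hi2 : IntegrableOn (fun θ => (Icc (φ - r) (φ + r)).indicator
        (fun θ => ‖F (Circle.exp θ)‖ * (2 / r)) θ) (Icc (φ - Real.pi) (φ + Real.pi)) :=
      (hint.mul_const _).indicator measurableSet_Icc
    calc ∫ θ in Icc (φ - Real.pi) (φ + Real.pi), ‖F (Circle.exp θ)‖ * (max (r / 2) |θ - φ|)⁻¹
        ≤ ∫ θ in Icc (φ - Real.pi) (φ + Real.pi), (‖F (Circle.exp θ)‖ * (max r |θ - φ|)⁻¹ +
          (Icc (φ - r) (φ + r)).indicator (fun θ => ‖F (Circle.exp θ)‖ * (2 / r)) θ) := by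
          refine setIntegral_mono (hker _ (by positivity)) ((hker r hr).add hi2) fun θ => ?_
          simp only
          by_cases hθ : θ ∈ Icc (φ - r) (φ + r)
          · rw [indicator_of_mem hθ, ← mul_add]
            refine mul_le_mul_of_nonneg_left ?_ (norm_nonneg _)
            have a1 : (max (r / 2) |θ - φ|)⁻¹ ≤ 2 / r := by
              rw [inv_le_comm₀ (lt_max_of_lt_left (by positivity)) (by positivity), inv_div]
              exact le_max_left _ _
            have a2 : 0 ≤ (max r |θ - φ|)⁻¹ := inv_nonneg.2 (le_max_of_le_left hr.le)
            linarith
          · rw [indicator_of_notMem hθ, add_zero]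
            have a3 : r < |θ - φ| := by
              by_contra hc
              push Not at hc
              rw [abs_le] at hc
              exact hθ ⟨by linarith [hc.1], by linarith [hc.2]⟩
            rw [max_eq_right a3.le, max_eq_right (by linarith)]
      _ = (∫ θ in Icc (φ - Real.pi) (φ + Real.pi), ‖F (Circle.exp θ)‖ * (max r |θ - φ|)⁻¹) +
          (∫ θ in Icc (φ - r) (φ + r), ‖F (Circle.exp θ)‖) * (2 / r) := by
          rw [integral_add (hker r hr) hi2, setIntegral_indicator measurableSet_Icc,
            inter_eq_self_of_subset_right hS, integral_mul_const]
      _ ≤ _ := by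
          refine add_le_add_right ?_ _
          -- An angular interval of length `2r` has normalized length `r / π`.
          have e : Icc (φ - r) (φ + r) = Icc (φ - r) (φ - r + 2 * Real.pi * (r / Real.pi)) := by
            congr 1
            field_simp
            ring
          have h5 := hK (φ - r) (r / Real.pi) (by positivity)
            ((div_le_one (by positivity)).2 (by linarith))
          rw [← e] at h5
          have h6 : (r / Real.pi) ^ (1 - s) ≤ r ^ (1 - s) :=
            Real.rpow_le_rpow (by positivity) (div_le_self hr.le (by linarith))
              (by linarith)
          calc _ ≤ K * r ^ (1 - s) * (2 / r) := by
                gcongr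
                exact h5.trans (mul_le_mul_of_nonneg_left h6 hK0)
            _ = 2 * K * r ^ (-s) := by
              rw [sub_eq_add_neg, Real.rpow_add hr, Real.rpow_one]
              field_simp
            _ ≤ D * r ^ (-s) :=
              mul_le_mul_of_nonneg_right (le_max_right _ _) (Real.rpow_nonneg hr.le _)

/-! ### Cauchy's formula and bounds through boundary values. -/

theorem max_le_pi_mul_norm_circleMap_sub {z : ℂ} (hz : z ∈ disc) {θ : ℝ}
    (hθ : |θ - z.arg| ≤ Real.pi) :
    max (1 - ‖z‖) |θ - z.arg| ≤ Real.pi * ‖circleMap 0 1 θ - z‖ := by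
  have hπ := Real.pi_gt_three
  have hz1 := mem_ball_zero_iff.1 hz
  have hu : ‖circleMap 0 1 θ‖ = 1 := by simp
  have h1 : 1 - ‖z‖ ≤ ‖circleMap 0 1 θ - z‖ := by
    have := norm_sub_norm_le (circleMap 0 1 θ) z
    rwa [hu] at this
  refine max_le (by nlinarith [norm_nonneg (circleMap 0 1 θ - z)]) ?_
  -- After rotating `z` to the positive axis, its distance to `1` is at most its distance to
  -- `e^{iψ}`, where `ψ = θ - arg z`. Hence `|e^{iψ} - 1| = 2 |sin (ψ/2)|` is at most twice the
  -- latter, and Jordan's inequality for the sine finishes.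
  have h2 : ‖circleMap 0 1 θ - z‖ = ‖Complex.exp (Complex.I * (θ - z.arg : ℝ)) - ‖z‖‖ := by
    have e : circleMap 0 1 θ - z = Complex.exp (z.arg * Complex.I) *
        (Complex.exp (Complex.I * (θ - z.arg : ℝ)) - ‖z‖) := by
      rw [mul_sub, ← Complex.exp_add]
      conv_lhs => rw [← Complex.norm_mul_exp_arg_mul_I z]
      simp only [circleMap, zero_add, Complex.ofReal_one, one_mul]
      push_cast
      ring_nf
    rw [e, norm_mul, Complex.norm_exp_ofReal_mul_I, one_mul]
  have h3 : ‖Complex.exp (Complex.I * (θ - z.arg : ℝ)) - 1‖ ≤ 2 * ‖circleMap 0 1 θ - z‖ := by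
    have a1 : ‖((‖z‖ : ℝ) : ℂ) - 1‖ = 1 - ‖z‖ := by
      rw [← Complex.ofReal_one, ← Complex.ofReal_sub, Complex.norm_real, Real.norm_eq_abs,
        abs_sub_comm, abs_of_pos (by linarith)]
    have a2 := norm_add_le (Complex.exp (Complex.I * (θ - z.arg : ℝ)) - ‖z‖) (((‖z‖ : ℝ) : ℂ) - 1)
    rw [sub_add_sub_cancel, ← h2, a1] at a2
    linarith
  rw [Complex.norm_exp_I_mul_ofReal_sub_one, norm_mul, Real.norm_eq_abs, Real.norm_eq_abs,
    abs_of_pos (by norm_num : (0 : ℝ) < 2)] at h3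
  have h4 := Real.mul_abs_le_abs_sin (x := (θ - z.arg) / 2) (by
    rw [abs_div, abs_of_pos (by norm_num : (0 : ℝ) < 2)]
    linarith)
  rw [abs_div, abs_of_pos (by norm_num : (0 : ℝ) < 2)] at h4
  have h5 : |θ - z.arg| / Real.pi ≤ ‖circleMap 0 1 θ - z‖ := by
    calc |θ - z.arg| / Real.pi = 2 / Real.pi * (|θ - z.arg| / 2) := by ring
      _ ≤ _ := by linarith
  rwa [div_le_iff₀ (by linarith), mul_comm] at h5

/-- Cauchy's formula on the unit circle for the dilate `w ↦ f (r w)`, which is holomorphic across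
the closed disc; the kernel `ζ / (ζ - z)` has modulus `1 / |ζ - z|`. -/
theorem norm_dilate_le (f : HolD) {r : ℝ} (hr : r ∈ Ioo (0 : ℝ) 1) {z : ℂ} (hz : z ∈ disc) :
    2 * Real.pi * ‖f (r * z)‖ ≤
      ∫ θ in (0 : ℝ)..2 * Real.pi, ‖f (circleMap 0 r θ)‖ * ‖circleMap 0 1 θ - z‖⁻¹ := by
  have hπ := Real.pi_pos
  have hd : DiffContOnCl ℂ (fun w => f (r * w)) (Metric.ball 0 |1|) := by
    rw [abs_one]
    apply DifferentiableOn.diffContOnCl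
    rw [closure_ball _ one_ne_zero]
    refine f.differentiableOn.comp (by fun_prop) fun w hw => ?_
    rw [mem_closedBall_zero_iff] at hw
    rw [mem_ball_zero_iff, norm_mul, Complex.norm_real, Real.norm_of_nonneg hr.1.le]
    nlinarith [hr.1, hr.2]
  have h1 := hd.circleAverage_smul_div (w := z) (by simpa using hz)
  rw [Real.circleAverage_def] at h1
  rw [← h1, norm_smul, Real.norm_of_nonneg (by positivity), ← mul_assoc,
    mul_inv_cancel₀ (by positivity), one_mul]
  refine (intervalIntegral.norm_integral_le_integral_norm (by positivity)).trans (le_of_eq ?_)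
  refine intervalIntegral.integral_congr fun θ _ => ?_
  simp only [sub_zero, norm_smul, norm_div, norm_circleMap_zero, abs_one, one_div]
  rw [mul_comm]
  congr 3
  simp [circleMap]

/-- The limit `r → 1` in the dilated formula has no evident dominating function. The modulus is
therefore truncated at height `K`: the truncated part converges by dominated convergence, the excess
is `O(1/K)` uniformly in `r` by the `H²` bound, and `K → ∞` at the end. -/
theorem norm_le_of_isBoundaryFunction {f : HolD} (hf : IsHardy f) {F : Circle → ℂ}
    (hF : IsBoundaryFunction f F)
    (hFi : IntegrableOn (fun θ : ℝ => F (Circle.exp θ)) (Icc 0 (2 * Real.pi)))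
    {z : ℂ} (hz : z ∈ disc) :
    2 * Real.pi * ‖f z‖ ≤
      ∫ θ in (0 : ℝ)..2 * Real.pi, ‖F (Circle.exp θ)‖ * ‖circleMap 0 1 θ - z‖⁻¹ := by
  have hπ := Real.pi_pos
  obtain ⟨C, hC⟩ := hf
  have hz0 := one_sub_norm_pos hz
  set h := 1 - ‖z‖ with hh
  have hk : ∀ θ, ‖circleMap 0 1 θ - z‖⁻¹ ≤ h⁻¹ := fun θ => by
    refine inv_anti₀ hz0 ?_
    have := norm_sub_norm_le (circleMap 0 1 θ) z
    rwa [norm_circleMap_zero, abs_one] at this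
  have hk0 : ∀ θ, 0 ≤ ‖circleMap 0 1 θ - z‖⁻¹ := fun θ => by positivity
  have hkc : Continuous fun θ => ‖circleMap 0 1 θ - z‖⁻¹ := by
    refine Continuous.inv₀ ((continuous_circleMap 0 1).sub continuous_const).norm fun θ h0 => ?_
    have := norm_sub_norm_le (circleMap 0 1 θ) z
    rw [h0] at this
    simp at this
    linarith
  set T := ∫ θ in (0 : ℝ)..2 * Real.pi, ‖F (Circle.exp θ)‖ * ‖circleMap 0 1 θ - z‖⁻¹ with hT
  have key : ∀ K : ℝ, 0 < K → 2 * Real.pi * ‖f z‖ ≤ T + 2 * Real.pi * C * h⁻¹ * K⁻¹ := by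
    intro K hK
    set u : ℕ → ℝ := fun n => 1 - 1 / ((n : ℝ) + 2) with hu
    have hu01 : ∀ n, u n ∈ Ioo (0 : ℝ) 1 := fun n => by
      have a1 : (0 : ℝ) < 1 / ((n : ℝ) + 2) := by positivity
      have a2 : (1 : ℝ) / ((n : ℝ) + 2) < 1 := by
        rw [div_lt_one (by positivity)]
        linarith [(n.cast_nonneg : (0 : ℝ) ≤ n)]
      constructor <;> simp only [hu] <;> linarith
    have hu1 : Tendsto u atTop (𝓝 1) := by
      have h1 : Tendsto (fun n : ℕ => 1 / ((n : ℝ) + 2)) atTop (𝓝 0) :=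
        tendsto_const_nhds.div_atTop (tendsto_atTop_add_const_right _ _ tendsto_natCast_atTop_atTop)
      simpa only [hu, sub_zero] using h1.const_sub 1
    have hu2 : Tendsto u atTop (𝓝[<] 1) :=
      tendsto_nhdsWithin_iff.2 ⟨hu1, Eventually.of_forall fun n => (hu01 n).2⟩
    have hl : Tendsto (fun n => 2 * Real.pi * ‖f (u n * z)‖) atTop (𝓝 (2 * Real.pi * ‖f z‖)) := by
      have h2 : Tendsto (fun n => (u n : ℂ) * z) atTop (𝓝 z) := by
        have := (Complex.continuous_ofReal.tendsto 1).comp hu1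
        simpa using this.mul_const z
      exact (((f.differentiableAt hz).continuousAt.tendsto.comp h2).norm).const_mul _
    have hr : Tendsto (fun n => (∫ θ in (0 : ℝ)..2 * Real.pi,
        min ‖f (circleMap 0 (u n) θ)‖ K * ‖circleMap 0 1 θ - z‖⁻¹) + 2 * Real.pi * C * h⁻¹ * K⁻¹)
        atTop (𝓝 ((∫ θ in (0 : ℝ)..2 * Real.pi,
        min ‖F (Circle.exp θ)‖ K * ‖circleMap 0 1 θ - z‖⁻¹) + 2 * Real.pi * C * h⁻¹ * K⁻¹)) := by
      refine Tendsto.add_const _ ?_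
      refine intervalIntegral.tendsto_integral_filter_of_dominated_convergence
        (fun _ => K * h⁻¹) (Eventually.of_forall fun n => ?_)
        (Eventually.of_forall fun n => Eventually.of_forall fun θ _ => ?_)
        intervalIntegrable_const ?_
      · exact (((f.continuous_circle (hu01 n)).norm.min continuous_const).mul
          hkc).aestronglyMeasurable
      · rw [Real.norm_of_nonneg (mul_nonneg (le_min (norm_nonneg _) hK.le) (hk0 θ))]
        exact mul_le_mul (min_le_right _ _) (hk θ) (hk0 θ) hK.le
      · filter_upwards [hF] with θ hθ _
        exact ((hθ.comp hu2).norm.min tendsto_const_nhds).mul_const _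
    refine (le_of_tendsto_of_tendsto' hl hr fun n => ?_).trans (add_le_add_left ?_ _)
    · have cf := (f.continuous_circle (hu01 n)).norm
      have i1 : IntervalIntegrable (fun θ => min ‖f (circleMap 0 (u n) θ)‖ K *
          ‖circleMap 0 1 θ - z‖⁻¹) volume 0 (2 * Real.pi) :=
        ((cf.min continuous_const).mul hkc).intervalIntegrable _ _
      have i2 : IntervalIntegrable (fun θ => h⁻¹ * K⁻¹ * ‖f (circleMap 0 (u n) θ)‖ ^ 2) volume 0
          (2 * Real.pi) := ((cf.pow 2).const_mul _).intervalIntegrable _ _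
      refine (norm_dilate_le f (hu01 n) hz).trans ?_
      calc ∫ θ in (0 : ℝ)..2 * Real.pi, ‖f (circleMap 0 (u n) θ)‖ * ‖circleMap 0 1 θ - z‖⁻¹
          ≤ ∫ θ in (0 : ℝ)..2 * Real.pi, (min ‖f (circleMap 0 (u n) θ)‖ K *
            ‖circleMap 0 1 θ - z‖⁻¹ + h⁻¹ * K⁻¹ * ‖f (circleMap 0 (u n) θ)‖ ^ 2) := by
            refine intervalIntegral.integral_mono (by positivity)
              ((cf.mul hkc).intervalIntegrable _ _) (i1.add i2) fun θ => ?_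
            simp only
            set x := ‖f (circleMap 0 (u n) θ)‖ with hx
            have hx0 : 0 ≤ x := norm_nonneg _
            -- Where `x` exceeds `K`, it is at most `x² / K`; this brings in the second moment
            -- controlled by the Hardy condition.
            have hxK : x ≤ min x K + K⁻¹ * x ^ 2 := by
              rcases le_total x K with hc | hc
              · rw [min_eq_left hc]
                have : 0 ≤ K⁻¹ * x ^ 2 := by positivity
                linarith
              · rw [min_eq_right hc]
                have : x ≤ K⁻¹ * x ^ 2 := by
                  rw [inv_mul_eq_div, le_div_iff₀ hK]
                  nlinarith
                linarith
            calc x * ‖circleMap 0 1 θ - z‖⁻¹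
                ≤ (min x K + K⁻¹ * x ^ 2) * ‖circleMap 0 1 θ - z‖⁻¹ :=
                  mul_le_mul_of_nonneg_right hxK (hk0 θ)
              _ = min x K * ‖circleMap 0 1 θ - z‖⁻¹ +
                  K⁻¹ * x ^ 2 * ‖circleMap 0 1 θ - z‖⁻¹ := add_mul _ _ _
              _ ≤ min x K * ‖circleMap 0 1 θ - z‖⁻¹ + K⁻¹ * x ^ 2 * h⁻¹ := by
                  exact add_le_add_right (mul_le_mul_of_nonneg_left (hk θ) (by positivity)) _
              _ = _ := by ring
        _ ≤ _ := by
            rw [intervalIntegral.integral_add i1 i2, intervalIntegral.integral_const_mul]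
            have h6 := hC (u n) (hu01 n)
            rw [one_div, inv_mul_le_iff₀ (by positivity)] at h6
            calc _ ≤ (∫ θ in (0 : ℝ)..2 * Real.pi, min ‖f (circleMap 0 (u n) θ)‖ K *
                  ‖circleMap 0 1 θ - z‖⁻¹) + h⁻¹ * K⁻¹ * (2 * Real.pi * C) := by gcongr
              _ = _ := by ring
    · have hFm := hF.aemeasurable.norm
      have i0 : IntervalIntegrable (fun θ => ‖F (Circle.exp θ)‖ * ‖circleMap 0 1 θ - z‖⁻¹)
          volume 0 (2 * Real.pi) := by
        rw [intervalIntegrable_iff_integrableOn_Icc_of_le (by positivity)]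
        refine hFi.norm.mul_bdd (c := h⁻¹) hkc.aestronglyMeasurable
          (Eventually.of_forall fun θ => ?_)
        rw [Real.norm_of_nonneg (hk0 θ)]
        exact hk θ
      refine intervalIntegral.integral_mono (by positivity) (i0.mono_fun ?_ ?_) i0 fun θ => ?_
      · exact ((hFm.min aemeasurable_const).mul hkc.measurable.aemeasurable).aestronglyMeasurable.restrict
      · refine Eventually.of_forall fun θ => ?_
        have hm : 0 ≤ min ‖F (Circle.exp θ)‖ K := le_min (norm_nonneg _) hK.le
        simp only
        rw [norm_mul, norm_mul, norm_norm, Real.norm_of_nonneg hm]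
        exact mul_le_mul_of_nonneg_right (min_le_left _ _) (norm_nonneg _)
      · exact mul_le_mul_of_nonneg_right (min_le_left _ _) (hk0 θ)
  have hlim : Tendsto (fun K : ℝ => T + 2 * Real.pi * C * h⁻¹ * K⁻¹) atTop (𝓝 (T + 2 * Real.pi * C * h⁻¹ * 0)) :=
    (tendsto_inv_atTop_zero.const_mul _).const_add _
  rw [mul_zero, add_zero] at hlim
  exact ge_of_tendsto hlim ((eventually_gt_atTop 0).mono fun K hK => key K hK)

/-- Growth of a single function in the analytic Morrey space. -/
theorem exists_norm_le_of_mem_morrey {lam : ℝ} (h0 : 0 < lam) (h1 : lam < 1) {f : HolD} (hf : f ∈ Morrey lam) :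
    ∃ C : ℝ, ∀ z ∈ disc, ‖f z‖ ≤ C * (1 - ‖z‖) ^ (-((1 - lam) / 2)) := by
  obtain ⟨hH, F, hF, hosc⟩ := hf
  have hπ := Real.pi_pos
  obtain ⟨K, hK0, hK⟩ := exists_setIntegral_norm_div_max_le h0 h1 hF.aemeasurable hosc
  refine ⟨K / 2, fun z hz => ?_⟩
  have hz0 := one_sub_norm_pos hz
  have hint0 := integrableOn_circle hF.aemeasurable hosc 0
  rw [zero_add] at hint0
  have h2 := norm_le_of_isBoundaryFunction hH hF hint0 hz
  have hper : Function.Periodic (fun θ => ‖F (Circle.exp θ)‖ * ‖circleMap 0 1 θ - z‖⁻¹)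
      (2 * Real.pi) := fun θ => by
    simp only [Circle.exp_add, Circle.exp_two_pi, mul_one, periodic_circleMap 0 1 θ]
  -- The period is recentred at `arg z`, so that `|θ - arg z| ≤ π` and the kernel comparison is
  -- valid.
  have h3 := hper.intervalIntegral_add_eq 0 (z.arg - Real.pi)
  rw [zero_add, show z.arg - Real.pi + 2 * Real.pi = z.arg + Real.pi by ring] at h3
  rw [h3, intervalIntegral.integral_of_le (by linarith), ← integral_Icc_eq_integral_Ioc] at h2
  have hint : IntegrableOn (fun θ : ℝ => ‖F (Circle.exp θ)‖)
      (Icc (z.arg - Real.pi) (z.arg + Real.pi)) := by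
    have := (integrableOn_circle hF.aemeasurable hosc (z.arg - Real.pi)).norm
    rwa [show z.arg - Real.pi + 2 * Real.pi = z.arg + Real.pi by ring] at this
  have h4 : ∫ θ in Icc (z.arg - Real.pi) (z.arg + Real.pi),
      ‖F (Circle.exp θ)‖ * ‖circleMap 0 1 θ - z‖⁻¹ ≤
      Real.pi * ∫ θ in Icc (z.arg - Real.pi) (z.arg + Real.pi),
        ‖F (Circle.exp θ)‖ * (max (1 - ‖z‖) |θ - z.arg|)⁻¹ := by
    rw [← integral_const_mul]
    have hi : IntegrableOn (fun θ => Real.pi * (‖F (Circle.exp θ)‖ *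
        (max (1 - ‖z‖) |θ - z.arg|)⁻¹)) (Icc (z.arg - Real.pi) (z.arg + Real.pi)) := by
      refine (hint.mul_bdd (c := (1 - ‖z‖)⁻¹) ?_ (Eventually.of_forall fun θ => ?_)).const_mul _
      · exact (Continuous.inv₀ (by fun_prop)
          fun θ => (lt_max_of_lt_left hz0).ne').aestronglyMeasurable
      · have : 0 < max (1 - ‖z‖) |θ - z.arg| := lt_max_of_lt_left hz0
        rw [Real.norm_of_nonneg (by positivity)]
        gcongr
        exact le_max_left _ _
    refine integral_mono_of_nonneg (Eventually.of_forall fun θ => by positivity) hi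
      ((ae_restrict_iff' measurableSet_Icc).2 (Eventually.of_forall fun θ hθ => ?_))
    have hm := max_le_pi_mul_norm_circleMap_sub hz (θ := θ) (abs_le.2
      ⟨by linarith [hθ.1], by linarith [hθ.2]⟩)
    have hm0 : 0 < max (1 - ‖z‖) |θ - z.arg| := lt_max_of_lt_left hz0
    have hn0 : 0 < ‖circleMap 0 1 θ - z‖ := by
      by_contra hc
      have : ‖circleMap 0 1 θ - z‖ = 0 := le_antisymm (not_lt.1 hc) (norm_nonneg _)
      rw [this, mul_zero] at hm
      linarith
    simp only
    rw [mul_left_comm]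
    refine mul_le_mul_of_nonneg_left ?_ (norm_nonneg _)
    rw [inv_le_iff_one_le_mul₀ hn0, mul_assoc, mul_left_comm, ← div_eq_inv_mul, le_div_iff₀ hm0]
    linarith
  have h5 := hK z.arg (1 - ‖z‖) hz0 (by linarith [norm_nonneg z])
  have h6 : 2 * Real.pi * ‖f z‖ ≤ Real.pi * (K * (1 - ‖z‖) ^ (-((1 - lam) / 2))) :=
    h2.trans (h4.trans (mul_le_mul_of_nonneg_left h5 hπ.le))
  have h7 : 2 * ‖f z‖ ≤ K * (1 - ‖z‖) ^ (-((1 - lam) / 2)) :=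
    le_of_mul_le_mul_left (by linarith) hπ
  linarith

/-! ### The test functions -/

/-- The Poisson kernel `(1 - |w|²) / |ζ - w|²` reproduces the constant harmonic function `1`. -/
theorem lintegral_inv_sq_norm_circleMap_sub {w : ℂ} (hw : w ∈ disc) :
    ∫⁻ θ in Ioo (-Real.pi) Real.pi, ENNReal.ofReal ((‖circleMap 0 1 θ - w‖ ^ 2)⁻¹) =
      ENNReal.ofReal (2 * Real.pi / (1 - ‖w‖ ^ 2)) := by
  have hπ := Real.pi_pos
  have hw1 := disc_weight_pos ⟨w, hw⟩
  simp only at hw1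
  have hharm : InnerProductSpace.HarmonicOnNhd (fun _ : ℂ => (1 : ℝ)) (Metric.closedBall 0 1) :=
    fun _ _ => InnerProductSpace.harmonicAt_const (1 : ℝ)
  have h1 := hharm.circleAverage_poissonKernel_smul hw
  rw [Real.circleAverage_def] at h1
  have hper : Function.Periodic (fun θ => (‖circleMap 0 1 θ - w‖ ^ 2)⁻¹) (2 * Real.pi) :=
    fun θ => by simp only [periodic_circleMap 0 1 θ]
  have hc : Continuous fun θ => (‖circleMap 0 1 θ - w‖ ^ 2)⁻¹ := by
    refine Continuous.inv₀ (((continuous_circleMap 0 1).sub continuous_const).norm.pow 2)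
      fun θ h0 => ?_
    have h2 := norm_sub_norm_le (circleMap 0 1 θ) w
    rw [pow_eq_zero_iff two_ne_zero] at h0
    rw [h0, norm_circleMap_zero, abs_one] at h2
    linarith [one_sub_norm_pos hw]
  have h3 : ∫ θ in (0 : ℝ)..2 * Real.pi, (‖circleMap 0 1 θ - w‖ ^ 2)⁻¹ =
      2 * Real.pi / (1 - ‖w‖ ^ 2) := by
    have e : ∀ θ : ℝ, (poissonKernel 0 w • fun _ : ℂ => (1 : ℝ)) (circleMap 0 1 θ) =
        (1 - ‖w‖ ^ 2) * (‖circleMap 0 1 θ - w‖ ^ 2)⁻¹ := fun θ => by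
      simp [poissonKernel_def, div_eq_mul_inv]
    simp only [e, intervalIntegral.integral_const_mul, smul_eq_mul] at h1
    field_simp at h1 ⊢
    linarith
  rw [← h3]
  have h4 := hper.intervalIntegral_add_eq 0 (-Real.pi)
  rw [zero_add, show -Real.pi + 2 * Real.pi = Real.pi by ring] at h4
  rw [h4, intervalIntegral.integral_of_le (by linarith), integral_Ioc_eq_integral_Ioo,
    ofReal_integral_eq_lintegral_ofReal]
  · exact (hc.integrableOn_Icc (a := -Real.pi) (b := Real.pi)).mono_set Ioo_subset_Icc_self
  · exact Eventually.of_forall fun θ => by positivity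

/-- Turns the Szegő denominator on the circle of radius `r` into the distance from the unit circle
to `r a`, ready for the Poisson integral. -/
theorem norm_one_sub_conj_mul_circleMap (a : ℂ) {r : ℝ} (θ : ℝ) :
    ‖1 - conj a * circleMap 0 r θ‖ = ‖circleMap 0 1 θ - r * a‖ := by
  have e : conj (circleMap 0 1 θ) * circleMap 0 1 θ = 1 := by
    rw [mul_comm, Complex.mul_conj, Complex.normSq_eq_norm_sq]
    simp
  have e2 : circleMap 0 r θ = r * circleMap 0 1 θ := by simp [circleMap]
  have : 1 - conj a * circleMap 0 r θ = conj (circleMap 0 1 θ - r * a) * circleMap 0 1 θ := by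
    rw [map_sub, sub_mul, e, map_mul, Complex.conj_ofReal, e2]
    ring
  rw [this, norm_mul, Complex.norm_conj, norm_circleMap_zero, abs_one, mul_one]

theorem one_sub_norm_le_norm_one_sub_conj_mul (a z : ℂ) (hz : ‖z‖ ≤ 1) :
    1 - ‖a‖ ≤ ‖1 - conj a * z‖ := by
  have h := norm_sub_norm_le 1 (conj a * z)
  rw [norm_one, norm_mul, Complex.norm_conj] at h
  nlinarith [norm_nonneg a]

theorem integral_inv_sq_one_sub_mul {ρ : ℝ} (h0 : 0 ≤ ρ) (h1 : ρ < 1) :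
    ∫⁻ r in Ioo (0 : ℝ) 1, ENNReal.ofReal (((1 - ρ * r) ^ 2)⁻¹) = ENNReal.ofReal (1 - ρ)⁻¹ := by
  have hpos : ∀ r ∈ Icc (0 : ℝ) 1, 0 < 1 - ρ * r := fun r hr => by nlinarith [hr.1, hr.2]
  have hd : ∀ r ∈ uIcc (0 : ℝ) 1, HasDerivAt (fun r => r / (1 - ρ * r)) (((1 - ρ * r) ^ 2)⁻¹) r := by
    intro r hr
    rw [uIcc_of_le zero_le_one] at hr
    have hne := (hpos r hr).ne'
    have h2 : HasDerivAt (fun r => 1 - ρ * r) (-(ρ * 1)) r :=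
      ((hasDerivAt_id r).const_mul ρ).const_sub 1
    refine ((hasDerivAt_id r).div h2 hne).congr_deriv ?_
    simp only [id]
    field_simp
    ring
  have hc : ContinuousOn (fun r => ((1 - ρ * r) ^ 2)⁻¹) (uIcc 0 1) := by
    rw [uIcc_of_le zero_le_one]
    exact ContinuousOn.inv₀ (by fun_prop) fun r hr => (pow_pos (hpos r hr) 2).ne'
  have h3 := intervalIntegral.integral_eq_sub_of_hasDerivAt hd hc.intervalIntegrable
  rw [intervalIntegral.integral_of_le zero_le_one, integral_Ioc_eq_integral_Ioo] at h3
  rw [← ofReal_integral_eq_lintegral_ofReal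
    ((intervalIntegrable_iff_integrableOn_Ioo_of_le zero_le_one).1 hc.intervalIntegrable)
    (Eventually.of_forall fun r => by positivity), h3]
  simp

/-- The fourth power is split in two. With `r = |z|` and `ρ = |a|`, one factor is at most `(1 -
ρr)^(-2)` and absorbs the weight `1 - r² ≤ 2 (1 - ρr)`; the other is integrated in the angle by the
Poisson formula. What remains is `∫ (1 - ρr)^(-2) dr = (1 - ρ)^(-1)`. -/
theorem lintegral_disc_le {a : ℂ} (ha : a ∈ disc) :
    ∫⁻ z in disc, ENNReal.ofReal ((1 - ‖z‖ ^ 2) * (‖1 - conj a * z‖ ^ 4)⁻¹) ≤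
      ENNReal.ofReal (4 * Real.pi * (1 - ‖a‖)⁻¹) := by
  have hπ := Real.pi_pos
  have ha1 := mem_ball_zero_iff.1 ha
  set ρ := ‖a‖ with hρ
  have hρ0 : 0 ≤ ρ := norm_nonneg a
  have hm : Measurable fun p : ℝ × ℝ =>
      ENNReal.ofReal (2 * (1 - ρ * p.1)⁻¹ * (‖circleMap 0 1 p.2 - p.1 * a‖ ^ 2)⁻¹) := by
    have : Measurable fun p : ℝ × ℝ => circleMap 0 1 p.2 - p.1 * a := by
      apply Continuous.measurable
      unfold circleMap
      fun_prop
    have h2 := (this.norm.pow_const 2).inv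
    fun_prop
  rw [← lintegral_indicator Metric.isOpen_ball.measurableSet,
    ← Complex.lintegral_comp_polarCoord_symm, polarCoord_target]
  have hS : MeasurableSet (Ioo (0 : ℝ) 1 ×ˢ Ioo (-Real.pi) Real.pi) :=
    measurableSet_Ioo.prod measurableSet_Ioo
  calc ∫⁻ p in Ioi (0 : ℝ) ×ˢ Ioo (-Real.pi) Real.pi, ENNReal.ofReal p.1 • disc.indicator
        (fun z => ENNReal.ofReal ((1 - ‖z‖ ^ 2) * (‖1 - conj a * z‖ ^ 4)⁻¹))
        (Complex.polarCoord.symm p)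
      ≤ ∫⁻ p in Ioi (0 : ℝ) ×ˢ Ioo (-Real.pi) Real.pi,
          (Ioo (0 : ℝ) 1 ×ˢ Ioo (-Real.pi) Real.pi).indicator (fun p => ENNReal.ofReal
          (2 * (1 - ρ * p.1)⁻¹ * (‖circleMap 0 1 p.2 - p.1 * a‖ ^ 2)⁻¹)) p := by
        refine setLIntegral_mono' (measurableSet_Ioi.prod measurableSet_Ioo) fun p hp => ?_
        rw [polarCoord_symm_eq_circleMap, smul_eq_mul]
        have hp0 : 0 < p.1 := hp.1
        by_cases h : p.1 < 1
        · rw [indicator_of_mem (by simpa [abs_of_pos hp0] using h),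
            indicator_of_mem (show p ∈ Ioo (0 : ℝ) 1 ×ˢ Ioo (-Real.pi) Real.pi from
              ⟨⟨hp0, h⟩, hp.2⟩), norm_one_sub_conj_mul_circleMap]
          refine (mul_le_of_le_one_left' (ENNReal.ofReal_le_one.2 h.le)).trans
            (ENNReal.ofReal_le_ofReal ?_)
          have hq : 0 < 1 - ρ * p.1 := by nlinarith
          have hq2 : 1 - ρ * p.1 ≤ ‖circleMap 0 1 p.2 - p.1 * a‖ := by
            have := norm_sub_norm_le (circleMap 0 1 p.2) (p.1 * a)
            rw [norm_circleMap_zero, abs_one, norm_mul, Complex.norm_real,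
              Real.norm_of_nonneg hp0.le] at this
            linarith
          set x := ‖circleMap 0 1 p.2 - p.1 * a‖ with hx
          have hx0 : 0 < x := hq.trans_le hq2
          have e1 : (1 - ‖circleMap 0 p.1 p.2‖ ^ 2) ≤ 2 * (1 - ρ * p.1) := by
            rw [norm_circleMap_zero, abs_of_pos hp0]
            nlinarith
          have e2 : (x ^ 2)⁻¹ ≤ ((1 - ρ * p.1) ^ 2)⁻¹ :=
            inv_anti₀ (by positivity) (pow_le_pow_left₀ hq.le hq2 2)
          calc _ ≤ 2 * (1 - ρ * p.1) * (x ^ 4)⁻¹ :=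
                mul_le_mul_of_nonneg_right e1 (by positivity)
            _ = 2 * (1 - ρ * p.1) * (x ^ 2)⁻¹ * (x ^ 2)⁻¹ := by
                field_simp
            _ ≤ 2 * (1 - ρ * p.1) * ((1 - ρ * p.1) ^ 2)⁻¹ * (x ^ 2)⁻¹ := by gcongr
            _ = _ := by field_simp
        · rw [indicator_of_notMem (by simpa [abs_of_pos hp0] using h), mul_zero]
          exact zero_le
    _ ≤ ∫⁻ p, (Ioo (0 : ℝ) 1 ×ˢ Ioo (-Real.pi) Real.pi).indicator (fun p => ENNReal.ofReal
          (2 * (1 - ρ * p.1)⁻¹ * (‖circleMap 0 1 p.2 - p.1 * a‖ ^ 2)⁻¹)) p :=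
        setLIntegral_le_lintegral _ _
    _ = ∫⁻ r in Ioo (0 : ℝ) 1, ∫⁻ θ in Ioo (-Real.pi) Real.pi, ENNReal.ofReal
          (2 * (1 - ρ * r)⁻¹ * (‖circleMap 0 1 θ - r * a‖ ^ 2)⁻¹) := by
        rw [lintegral_indicator hS, Measure.volume_eq_prod, ← Measure.prod_restrict,
          lintegral_prod _ hm.aemeasurable]
    _ ≤ ∫⁻ r in Ioo (0 : ℝ) 1,
          ENNReal.ofReal (4 * Real.pi) * ENNReal.ofReal (((1 - ρ * r) ^ 2)⁻¹) := by
        refine setLIntegral_mono' measurableSet_Ioo fun r hr => ?_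
        have hq : 0 < 1 - ρ * r := by nlinarith [hr.1, hr.2]
        have hn : ‖(r : ℂ) * a‖ = ρ * r := by
          rw [norm_mul, Complex.norm_real, Real.norm_of_nonneg hr.1.le, mul_comm]
        have hra : (r : ℂ) * a ∈ disc := by
          rw [mem_ball_zero_iff, hn]
          linarith
        have hq0 : 0 ≤ 2 * (1 - ρ * r)⁻¹ := by positivity
        simp only [ENNReal.ofReal_mul hq0]
        rw [lintegral_const_mul' _ _ ENNReal.ofReal_ne_top,
          lintegral_inv_sq_norm_circleMap_sub hra, ← ENNReal.ofReal_mul hq0,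
          ← ENNReal.ofReal_mul (by positivity), hn]
        refine ENNReal.ofReal_le_ofReal ?_
        have e : 1 - (ρ * r) ^ 2 = (1 + ρ * r) * (1 - ρ * r) := by ring
        have h2 : 0 ≤ ρ * r := mul_nonneg hρ0 hr.1.le
        rw [e, div_eq_mul_inv, mul_inv]
        have h3 : (1 + ρ * r)⁻¹ ≤ 1 := inv_le_one_of_one_le₀ (by linarith)
        calc _ = 4 * Real.pi * ((1 - ρ * r) ^ 2)⁻¹ * (1 + ρ * r)⁻¹ := by
              field_simp
              ring
          _ ≤ 4 * Real.pi * ((1 - ρ * r) ^ 2)⁻¹ * 1 := by gcongr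
          _ = _ := mul_one _
    _ = _ := by
        rw [lintegral_const_mul' _ _ ENNReal.ofReal_ne_top, integral_inv_sq_one_sub_mul hρ0 ha1,
          ← ENNReal.ofReal_mul (by positivity)]

/-! ### The kernel functions -/

theorem one_sub_conj_mul_ne_zero {a z : ℂ} (ha : a ∈ disc) (hz : ‖z‖ ≤ 1) :
    1 - conj a * z ≠ 0 := by
  have h := one_sub_norm_le_norm_one_sub_conj_mul a z hz
  have h2 := one_sub_norm_pos ha
  intro h0
  rw [h0, norm_zero] at h
  linarith

theorem hasDerivAt_inv_one_sub_conj_mul {a z : ℂ} (ha : a ∈ disc) (hz : z ∈ disc) :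
    HasDerivAt (fun z => (1 - conj a * z)⁻¹) (conj a / (1 - conj a * z) ^ 2) z := by
  have h1 : HasDerivAt (fun z => 1 - conj a * z) (-(conj a * 1)) z :=
    ((hasDerivAt_id z).const_mul (conj a)).const_sub 1
  refine (h1.inv (one_sub_conj_mul_ne_zero ha (mem_ball_zero_iff.1 hz).le)).congr_deriv ?_
  simp

/-- The Szegő kernel `z ↦ (1 - conj a * z)⁻¹`. -/
def szego (a : ℂ) (ha : a ∈ disc) : HolD :=
  ⟨disc.indicator fun z => (1 - conj a * z)⁻¹,
    DifferentiableOn.congr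
      (fun _ hz => (hasDerivAt_inv_one_sub_conj_mul ha hz).differentiableAt.differentiableWithinAt)
      fun _ hz => indicator_of_mem hz _,
    fun _ hz => indicator_of_notMem hz _⟩

theorem szego_apply {a z : ℂ} (ha : a ∈ disc) (hz : z ∈ disc) :
    szego a ha z = (1 - conj a * z)⁻¹ :=
  indicator_of_mem hz fun z => (1 - conj a * z)⁻¹

theorem deriv_szego {a z : ℂ} (ha : a ∈ disc) (hz : z ∈ disc) :
    deriv (szego a ha) z = conj a / (1 - conj a * z) ^ 2 := by
  have h : (szego a ha : ℂ → ℂ) =ᶠ[𝓝 z] fun z => (1 - conj a * z)⁻¹ := by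
    filter_upwards [Metric.isOpen_ball.mem_nhds hz] with w hw using szego_apply ha hw
  rw [h.deriv_eq]
  exact (hasDerivAt_inv_one_sub_conj_mul ha hz).deriv

theorem norm_szego_le {a z : ℂ} (ha : a ∈ disc) (hz : z ∈ disc) :
    ‖szego a ha z‖ ≤ (1 - ‖a‖)⁻¹ := by
  rw [szego_apply ha hz, norm_inv]
  exact inv_anti₀ (one_sub_norm_pos ha)
    (one_sub_norm_le_norm_one_sub_conj_mul a z (mem_ball_zero_iff.1 hz).le)

theorem isHardy_szego {a : ℂ} (ha : a ∈ disc) : IsHardy (szego a ha) := by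
  refine ⟨((1 - ‖a‖)⁻¹) ^ 2, fun r hr => ?_⟩
  have hπ := Real.pi_pos
  have h1 : ∫ θ in (0 : ℝ)..2 * Real.pi, ‖szego a ha (circleMap 0 r θ)‖ ^ 2 ≤
      ∫ _ in (0 : ℝ)..2 * Real.pi, ((1 - ‖a‖)⁻¹) ^ 2 := by
    refine intervalIntegral.integral_mono (by positivity)
      ((((szego a ha).continuous_circle hr).norm.pow 2).intervalIntegrable _ _)
      intervalIntegrable_const fun θ => ?_
    exact pow_le_pow_left₀ (norm_nonneg _) (norm_szego_le ha (circleMap_mem_disc hr θ)) 2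
  rw [intervalIntegral.integral_const, sub_zero, smul_eq_mul] at h1
  rw [one_div, inv_mul_le_iff₀ (by positivity)]
  exact h1

theorem isBoundaryFunction_szego {a : ℂ} (ha : a ∈ disc) :
    IsBoundaryFunction (szego a ha) fun ζ => (1 - conj a * ζ)⁻¹ := by
  refine Eventually.of_forall fun θ => ?_
  have h1 : Tendsto (fun r : ℝ => (1 - conj a * circleMap 0 r θ)⁻¹) (𝓝[<] 1)
      (𝓝 (1 - conj a * (Circle.exp θ : ℂ))⁻¹) := by
    have e : (Circle.exp θ : ℂ) = circleMap 0 (1 : ℝ) θ := by simp [circleMap]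
    rw [e]
    have hc : Continuous fun r : ℝ => 1 - conj a * circleMap 0 r θ := by
      unfold circleMap
      fun_prop
    exact ((hc.tendsto 1).inv₀ (one_sub_conj_mul_ne_zero ha (by simp))).mono_left
      nhdsWithin_le_nhds
  refine h1.congr' ?_
  filter_upwards [Ioo_mem_nhdsLT (show (0 : ℝ) < 1 by norm_num)] with r hr
  exact (szego_apply ha (circleMap_mem_disc hr θ)).symm

theorem norm_circle_exp_sub_le (x y : ℝ) : ‖(Circle.exp x : ℂ) - Circle.exp y‖ ≤ |x - y| := by
  have e : (Circle.exp x : ℂ) - Circle.exp y =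
      Circle.exp y * (Complex.exp (Complex.I * (x - y : ℝ)) - 1) := by
    rw [mul_sub, mul_one, Circle.coe_exp, Circle.coe_exp, ← Complex.exp_add]
    push_cast
    ring_nf
  rw [e, norm_mul, Circle.norm_coe, one_mul]
  exact Real.norm_exp_I_mul_ofReal_sub_one_le

theorem norm_sub_arcAverage_le {F : Circle → ℂ} (hF : Continuous fun θ : ℝ => F (Circle.exp θ))
    {I : Arc} {c : ℂ} {M : ℝ} (h : ∀ θ ∈ I.angles, ‖F (Circle.exp θ) - c‖ ≤ M) :
    ‖c - arcAverage F I‖ ≤ M := by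
  have hπ := Real.pi_pos
  have hl := I.len_pos
  have hvol : volume.real I.angles = 2 * Real.pi * I.len := by
    rw [Arc.angles, Real.volume_real_Icc_of_le (by nlinarith)]
    ring
  have hi : IntegrableOn (fun θ : ℝ => F (Circle.exp θ)) I.angles := hF.integrableOn_Icc
  have e : arcAverage F I - c = ((1 / I.len * (1 / (2 * Real.pi)) : ℝ) : ℂ) *
      ∫ θ in I.angles, (F (Circle.exp θ) - c) := by
    rw [integral_sub hi (integrableOn_const isCompact_Icc.measure_lt_top.ne),
      setIntegral_const, hvol, mul_sub, Complex.real_smul, ← mul_assoc, ← Complex.ofReal_mul,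
      show 1 / I.len * (1 / (2 * Real.pi)) * (2 * Real.pi * I.len) = 1 by field_simp]
    simp [arcAverage]
  rw [norm_sub_rev, e, norm_mul, Complex.norm_real, Real.norm_of_nonneg (by positivity)]
  have h2 := norm_setIntegral_le_of_norm_le_const (μ := volume)
    (isCompact_Icc.measure_lt_top : volume I.angles < ⊤) h
  rw [← Arc.angles, hvol] at h2
  calc _ ≤ 1 / I.len * (1 / (2 * Real.pi)) * (M * (2 * Real.pi * I.len)) := by gcongr
    _ = M := by field_simp

/-- The boundary function is Lipschitz in the angle, so its squared oscillation integral over `I` is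
`O(|I|^3)`, better than `|I|^lam`. The constant depends on `a`, which suffices for membership;
uniformity is a matter of the Carleson norm. -/
theorem szego_mem_morrey {lam : ℝ} (h1 : lam < 1) {a : ℂ} (ha : a ∈ disc) :
    szego a ha ∈ Morrey lam := by
  have hπ := Real.pi_pos
  have ha0 := one_sub_norm_pos ha
  refine ⟨isHardy_szego ha, _, isBoundaryFunction_szego ha, ?_⟩
  set F : Circle → ℂ := fun ζ => (1 - conj a * ζ)⁻¹ with hF
  set L := ((1 - ‖a‖) ^ 2)⁻¹ with hL
  have hL0 : 0 ≤ L := by positivity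
  have hlip : ∀ x y : ℝ, ‖F (Circle.exp x) - F (Circle.exp y)‖ ≤ L * |x - y| := by
    intro x y
    have nx := one_sub_norm_le_norm_one_sub_conj_mul a (Circle.exp x) (by simp)
    have ny := one_sub_norm_le_norm_one_sub_conj_mul a (Circle.exp y) (by simp)
    rw [hF]
    simp only
    rw [inv_sub_inv (one_sub_conj_mul_ne_zero ha (by simp)) (one_sub_conj_mul_ne_zero ha (by simp)),
      norm_div, norm_mul, sub_sub_sub_cancel_left, ← mul_sub, norm_mul, Complex.norm_conj,
      div_eq_inv_mul]
    refine mul_le_mul ?_ ?_ (by positivity) hL0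
    · rw [hL, sq]
      exact inv_anti₀ (by positivity) (mul_le_mul nx ny ha0.le (norm_nonneg _))
    · refine (mul_le_of_le_one_left (norm_nonneg _) (by linarith)).trans
        (norm_circle_exp_sub_le x y)
  have hFc : Continuous fun θ : ℝ => F (Circle.exp θ) := by
    refine Continuous.inv₀ (by fun_prop) fun θ => one_sub_conj_mul_ne_zero ha (by simp)
  have hosc : ∀ I : Arc, oscillation lam F I ≤
      ENNReal.ofReal ((L * (2 * Real.pi)) ^ 2) ^ (1 / 2 : ℝ) := fun I => by
    have hl := I.len_pos
    have hl1 := I.len_le_one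
    refine ENNReal.rpow_le_rpow ?_ (by norm_num)
    have hpt : ∀ θ ∈ I.angles, ‖F (Circle.exp θ) - arcAverage F I‖ₑ ^ (2 : ℝ) ≤
        ENNReal.ofReal ((L * (2 * Real.pi * I.len)) ^ 2) := fun θ hθ => by
      have h2 : ‖F (Circle.exp θ) - arcAverage F I‖ ≤ L * (2 * Real.pi * I.len) := by
        refine norm_sub_arcAverage_le hFc fun φ hφ => (hlip φ θ).trans ?_
        refine mul_le_mul_of_nonneg_left (abs_le.2 ?_) hL0
        rw [Arc.angles, mem_Icc] at hθ hφ
        constructor <;> linarith [hθ.1, hθ.2, hφ.1, hφ.2]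
      rw [ENNReal.rpow_two, ← ofReal_norm, ← ENNReal.ofReal_pow (norm_nonneg _)]
      exact ENNReal.ofReal_le_ofReal (pow_le_pow_left₀ (norm_nonneg _) h2 2)
    have hvol : volume I.angles = ENNReal.ofReal (2 * Real.pi * I.len) := by
      rw [Arc.angles, Real.volume_Icc]
      congr 1
      ring
    have h3 : ∫⁻ θ in I.angles, ‖F (Circle.exp θ) - arcAverage F I‖ₑ ^ (2 : ℝ) ≤
        ENNReal.ofReal ((L * (2 * Real.pi * I.len)) ^ 2 * (2 * Real.pi * I.len)) := by
      refine (setLIntegral_mono' measurableSet_Icc hpt).trans (le_of_eq ?_)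
      rw [setLIntegral_const, ENNReal.ofReal_mul (by positivity), ← Arc.angles, hvol]
    have hll : 0 < I.len ^ (-lam) := Real.rpow_pos_of_pos hl _
    refine (mul_le_mul_right h3 _).trans ?_
    rw [← ENNReal.ofReal_mul (by positivity)]
    refine ENNReal.ofReal_le_ofReal ?_
    have e : I.len ^ (-lam) * (1 / (2 * Real.pi)) *
        ((L * (2 * Real.pi * I.len)) ^ 2 * (2 * Real.pi * I.len)) =
        (L * (2 * Real.pi)) ^ 2 * I.len ^ (-lam + 3) := by
      rw [Real.rpow_add hl, show (3 : ℝ) = ((3 : ℕ) : ℝ) by norm_num, Real.rpow_natCast]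
      field_simp
    rw [e]
    exact mul_le_of_le_one_right (by positivity) (Real.rpow_le_one hl.le hl1 (by linarith))
  exact (iSup_le hosc).trans_lt (ENNReal.rpow_lt_top_of_nonneg (by norm_num) ENNReal.ofReal_ne_top)

/-- The test functions `(1 - |a|²)^((1 + lam) / 2) / (1 - conj a * z)`. -/
def testFun (lam : ℝ) (a : ℂ) (ha : a ∈ disc) : HolD :=
  (((1 - ‖a‖ ^ 2) ^ ((1 + lam) / 2) : ℝ) : ℂ) • szego a ha

theorem testFun_mem_morrey {lam : ℝ} (h1 : lam < 1) {a : ℂ} (ha : a ∈ disc) :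
    testFun lam a ha ∈ Morrey lam :=
  (Morrey lam).smul_mem _ (szego_mem_morrey h1 ha)

theorem rpow_half_sq {x : ℝ} (hx : 0 ≤ x) (y : ℝ) : (x ^ (y / 2)) ^ 2 = x ^ y := by
  rw [← Real.rpow_natCast, ← Real.rpow_mul hx]
  congr 1
  push_cast
  ring

/-- Short boxes, `|I| ≤ 1 - |a|`, do not see the singularity: the denominator is at least `1 - |a|`
and the weight integrates to `O(|I|^3)`. For longer boxes the integral over the whole disc is small
enough. The factor `(1 - |a|²)^(1 + lam)` of the squared derivative balances both cases. -/
theorem exists_carleson_testFun_le {lam : ℝ} (h0 : 0 < lam) (h1 : lam < 1) :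
    ∃ C : ℝ, 0 ≤ C ∧ ∀ (a : ℂ) (ha : a ∈ disc) (I : Arc),
      carleson 1 lam (testFun lam a ha) I ≤ ENNReal.ofReal C := by
  have hπ := Real.pi_pos
  obtain ⟨C₁, hC₁, hbox⟩ := Arc.lintegral_box_rpow_le (q := 1) (by norm_num)
  set C₂ := max C₁ (4 * Real.pi) with hC₂
  have hC₂0 : 0 ≤ C₂ := le_max_of_le_left hC₁
  refine ⟨(4 * Real.pi⁻¹ * C₂) ^ (1 / 2 : ℝ), by positivity, fun a ha I => ?_⟩
  have hh := one_sub_norm_pos ha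
  have hw := disc_weight_pos ⟨a, ha⟩
  simp only at hw
  set h := 1 - ‖a‖ with hdef
  have hl := I.len_pos
  have hl1 := I.len_le_one
  rw [← ENNReal.ofReal_rpow_of_nonneg (by positivity) (by norm_num), carleson,
    setLIntegral_areaMeasure]
  refine ENNReal.rpow_le_rpow ?_ (by norm_num)
  have hcle : (1 - ‖a‖ ^ 2) ^ (1 + lam) ≤ 4 * h ^ (1 + lam) := by
    calc (1 - ‖a‖ ^ 2) ^ (1 + lam) ≤ (2 * h) ^ (1 + lam) := by
          refine Real.rpow_le_rpow hw.le ?_ (by linarith)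
          nlinarith [norm_nonneg a]
      _ = 2 ^ (1 + lam) * h ^ (1 + lam) := Real.mul_rpow (by norm_num) hh.le
      _ ≤ 2 ^ (2 : ℝ) * h ^ (1 + lam) := by
          gcongr
          · norm_num
          · linarith
      _ = _ := by norm_num
  have hpt : ∀ z ∈ I.box, ‖deriv (testFun lam a ha) z‖ₑ ^ (2 : ℝ) *
      ENNReal.ofReal ((1 - ‖z‖ ^ 2) ^ (1 : ℝ)) ≤ ENNReal.ofReal (4 * h ^ (1 + lam)) *
      ENNReal.ofReal ((1 - ‖z‖ ^ 2) * (‖1 - conj a * z‖ ^ 4)⁻¹) := fun z hz => by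
    have hzd := I.box_subset hz
    have hzw := disc_weight_pos ⟨z, hzd⟩
    simp only at hzw
    rw [testFun, HolD.deriv_smul _ _ hzd, deriv_szego ha hzd, ENNReal.rpow_two, ← ofReal_norm,
      ← ENNReal.ofReal_pow (norm_nonneg _), ← ENNReal.ofReal_mul (by positivity),
      ← ENNReal.ofReal_mul (by positivity), Real.rpow_one]
    refine ENNReal.ofReal_le_ofReal ?_
    rw [norm_mul, Complex.norm_real, Real.norm_of_nonneg (by positivity), norm_div,
      Complex.norm_conj, norm_pow, mul_pow, rpow_half_sq hw.le, div_pow, ← pow_mul]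
    have ha2 : ‖a‖ ^ 2 ≤ 1 := by linarith
    calc _ ≤ 4 * h ^ (1 + lam) * (1 / ‖1 - conj a * z‖ ^ (2 * 2)) * (1 - ‖z‖ ^ 2) := by gcongr
      _ = _ := by ring
  have hmain : ∫⁻ z in I.box, ENNReal.ofReal ((1 - ‖z‖ ^ 2) * (‖1 - conj a * z‖ ^ 4)⁻¹) ≤
      ENNReal.ofReal (C₂ * (I.len ^ lam * h ^ (-(1 + lam)))) := by
    rcases le_total I.len h with hc | hc
    · have hz4 : ∀ z ∈ I.box, ENNReal.ofReal ((1 - ‖z‖ ^ 2) * (‖1 - conj a * z‖ ^ 4)⁻¹) ≤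
          ENNReal.ofReal ((h ^ 4)⁻¹) * ENNReal.ofReal ((1 - ‖z‖ ^ 2) ^ (1 : ℝ)) := fun z hz => by
        have hzd := I.box_subset hz
        have hzw := disc_weight_pos ⟨z, hzd⟩
        simp only at hzw
        have hn := one_sub_norm_le_norm_one_sub_conj_mul a z (mem_ball_zero_iff.1 hzd).le
        rw [← ENNReal.ofReal_mul (by positivity), Real.rpow_one, mul_comm]
        refine ENNReal.ofReal_le_ofReal ?_
        gcongr
      refine (setLIntegral_mono' I.measurableSet_box hz4).trans ?_
      rw [lintegral_const_mul' _ _ ENNReal.ofReal_ne_top]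
      refine (mul_le_mul_right (hbox I) _).trans ?_
      rw [← ENNReal.ofReal_mul (by positivity)]
      refine ENNReal.ofReal_le_ofReal ?_
      have e1 : I.len ^ ((1 : ℝ) + 2) ≤ I.len ^ lam * h ^ (3 - lam) := by
        rw [show (1 : ℝ) + 2 = lam + (3 - lam) by ring, Real.rpow_add hl]
        gcongr
        linarith
      have e2 : (h ^ 4)⁻¹ * h ^ (3 - lam) = h ^ (-(1 + lam)) := by
        rw [← Real.rpow_natCast, ← Real.rpow_neg hh.le, ← Real.rpow_add hh]
        congr 1
        push_cast
        ring
      calc (h ^ 4)⁻¹ * (C₁ * I.len ^ ((1 : ℝ) + 2))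
          ≤ (h ^ 4)⁻¹ * (C₂ * (I.len ^ lam * h ^ (3 - lam))) := by
            gcongr
            exact le_max_left _ _
        _ = C₂ * (I.len ^ lam * ((h ^ 4)⁻¹ * h ^ (3 - lam))) := by ring
        _ = _ := by rw [e2]
    · refine (lintegral_mono_set I.box_subset).trans ((lintegral_disc_le ha).trans ?_)
      refine ENNReal.ofReal_le_ofReal ?_
      have e1 : (1 - ‖a‖)⁻¹ ≤ I.len ^ lam * h ^ (-(1 + lam)) := by
        have e2 : h⁻¹ = h ^ lam * h ^ (-(1 + lam)) := by
          rw [← Real.rpow_add hh, ← Real.rpow_neg_one]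
          congr 1
          ring
        rw [← hdef, e2]
        gcongr
      gcongr
      exact le_max_right _ _
  have hstep : ∫⁻ z in I.box, ‖deriv (testFun lam a ha) z‖ₑ ^ (2 : ℝ) *
      ENNReal.ofReal ((1 - ‖z‖ ^ 2) ^ (1 : ℝ)) ≤ ENNReal.ofReal (4 * C₂ * I.len ^ lam) := by
    refine (setLIntegral_mono' I.measurableSet_box hpt).trans ?_
    rw [lintegral_const_mul' _ _ ENNReal.ofReal_ne_top]
    refine (mul_le_mul_right hmain _).trans (le_of_eq ?_)
    rw [← ENNReal.ofReal_mul (by positivity)]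
    congr 1
    rw [Real.rpow_neg hh.le]
    field_simp
  refine (mul_le_mul_right (mul_le_mul_right hstep _) _).trans (le_of_eq ?_)
  rw [← ENNReal.ofReal_mul (by positivity), ← ENNReal.ofReal_mul (by positivity)]
  congr 1
  rw [Real.rpow_neg hl.le]
  field_simp

theorem exists_morreyNorm_testFun_le {lam : ℝ} (h0 : 0 < lam) (h1 : lam < 1) :
    ∃ C : ℝ, 0 < C ∧ ∀ (a : ℂ) (ha : a ∈ disc),
      morreyNorm lam (testFun lam a ha) ≤ ENNReal.ofReal C := by
  obtain ⟨C, hC, hCf⟩ := exists_carleson_testFun_le h0 h1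
  refine ⟨1 + C, by positivity, fun a ha => ?_⟩
  have hw := disc_weight_pos ⟨a, ha⟩
  simp only at hw
  rw [morreyNorm, ENNReal.ofReal_add zero_le_one hC]
  refine add_le_add ?_ (iSup_le (hCf a ha))
  rw [← ofReal_norm]
  refine ENNReal.ofReal_le_ofReal ?_
  rw [testFun, HolD.smul_apply, szego_apply ha (by simp), mul_zero, sub_zero, inv_one, mul_one,
    Complex.norm_real, Real.norm_of_nonneg (by positivity)]
  exact Real.rpow_le_one hw.le (by nlinarith [norm_nonneg a]) (by linarith)

/-! ### The little Bloch condition -/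

/-- The little Bloch type condition `(1 - |z|)^b |g'(z)| → 0` as `|z| → 1`. -/
def IsLittleBloch (b : ℝ) (g : HolD) : Prop :=
  ∀ ε > 0, ∃ δ > 0, ∀ z ∈ disc, 1 - ‖z‖ < δ → (1 - ‖z‖) ^ b * ‖deriv g z‖ ≤ ε

theorem IsLittleBloch.exists_bound {b : ℝ} (hb : 0 ≤ b) {g : HolD} (h : IsLittleBloch b g) :
    ∃ M : ℝ, 0 ≤ M ∧ ∀ z ∈ disc, (1 - ‖z‖) ^ b * ‖deriv g z‖ ≤ M := by
  obtain ⟨δ, hδ, hδz⟩ := h 1 one_pos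
  have hsub : Metric.closedBall (0 : ℂ) (1 - δ) ⊆ disc :=
    Metric.closedBall_subset_ball (by linarith)
  obtain ⟨B, hB⟩ := (isCompact_closedBall (0 : ℂ) (1 - δ)).exists_bound_of_continuousOn
    (g.differentiableOn_deriv.continuousOn.mono hsub)
  refine ⟨max 1 B, le_max_of_le_left zero_le_one, fun z hz => ?_⟩
  rcases lt_or_ge (1 - ‖z‖) δ with hc | hc
  · exact (hδz z hz hc).trans (le_max_left _ _)
  · refine le_trans ?_ ((hB z (by rw [mem_closedBall_zero_iff]; linarith)).trans (le_max_right _ _))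
    exact mul_le_of_le_one_left (norm_nonneg _)
      (Real.rpow_le_one (one_sub_norm_pos hz).le (by linarith [norm_nonneg z]) hb)

/-- In the pointwise bound with `s = p - lam + 1` the exponent `(s - 2 - p) / 2` equals `-(1 + lam)
/ 2`, so `p` drops out; the arc attached to `z` shrinks as `|z| → 1`. -/
theorem IsLittleBloch.of_mem_littleBlochMorrey {p lam : ℝ} (h1 : lam < 1) (hp : 1 < p) {g : HolD}
    (hg : g ∈ LittleBlochMorrey p lam) : IsLittleBloch ((1 + lam) / 2) g := by
  intro ε hε
  obtain ⟨C, hC, hCf⟩ := exists_enorm_deriv_le_carleson (p := p) (s := p - lam + 1)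
    (by linarith) (by linarith)
  have h2 : ∀ᶠ x in 𝓝 (0 : ℝ≥0∞), x ≤ ENNReal.ofReal (ε / C) :=
    Iic_mem_nhds (by simpa using div_pos hε hC)
  obtain ⟨t, ht, hts⟩ := mem_comap.1 (hg.2.eventually h2)
  obtain ⟨d, hd, hdt⟩ := Metric.mem_nhds_iff.1 ht
  refine ⟨d / 4, by positivity, fun z hz hzd => ?_⟩
  obtain ⟨I, hI, hIz⟩ := hCf g z hz
  have hz0 := one_sub_norm_pos hz
  have h3 : carleson p (p - lam + 1) g I ≤ ENNReal.ofReal (ε / C) := by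
    refine hts (hdt ?_)
    rw [mem_ball_zero_iff, Real.norm_of_nonneg I.len_pos.le]
    linarith
  have h4 := hIz.trans (mul_le_mul_right h3 _)
  rw [← ENNReal.ofReal_mul (by positivity), ← ofReal_norm,
    ENNReal.ofReal_le_ofReal_iff (by positivity),
    show (p - lam + 1 - 2 - p) / 2 = -((1 + lam) / 2) by ring, Real.rpow_neg hz0.le] at h4
  have h5 : 0 < (1 - ‖z‖) ^ ((1 + lam) / 2) := Real.rpow_pos_of_pos hz0 _
  calc _ ≤ (1 - ‖z‖) ^ ((1 + lam) / 2) * (C * ((1 - ‖z‖) ^ ((1 + lam) / 2))⁻¹ * (ε / C)) := by gcongr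
    _ = ε := by field_simp

theorem exists_carleson_le_of_box_bound {p lam : ℝ} (h0 : 0 < lam) (h1 : lam < 1) (hp : 1 < p) :
    ∃ K : ℝ, 0 < K ∧ ∀ (g : HolD) (I : Arc) (ε : ℝ), 0 ≤ ε →
      (∀ z ∈ I.box, (1 - ‖z‖) ^ ((1 + lam) / 2) * ‖deriv g z‖ ≤ ε) →
      carleson p (p - lam + 1) g I ≤ ENNReal.ofReal (ε * K) := by
  have hπ := Real.pi_pos
  obtain ⟨C, hC, hbox⟩ := Arc.lintegral_box_rpow_le (q := p - 1 - lam) (by linarith)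
  -- The summand `1` only keeps the constant positive, since `C` may vanish.
  refine ⟨(4 * Real.pi⁻¹ * C + 1) ^ (1 / 2 : ℝ), by positivity, fun g I ε hε h => ?_⟩
  have hl := I.len_pos
  have hpt : ∀ z ∈ I.box, ‖deriv g z‖ₑ ^ (2 : ℝ) * ENNReal.ofReal ((1 - ‖z‖ ^ 2) ^ p) ≤
      ENNReal.ofReal (4 * ε ^ 2) * ENNReal.ofReal ((1 - ‖z‖ ^ 2) ^ (p - 1 - lam)) := fun z hz => by
    have hzd := I.box_subset hz
    have hz0 := one_sub_norm_pos hzd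
    have hw := disc_weight_pos ⟨z, hzd⟩
    simp only at hw
    rw [ENNReal.rpow_two, ← ofReal_norm, ← ENNReal.ofReal_pow (norm_nonneg _),
      ← ENNReal.ofReal_mul (by positivity), ← ENNReal.ofReal_mul (by positivity)]
    refine ENNReal.ofReal_le_ofReal ?_
    have e1 := pow_le_pow_left₀ (by positivity) (h z hz) 2
    rw [mul_pow, rpow_half_sq hz0.le] at e1
    have e2 : (1 - ‖z‖ ^ 2) ^ (1 + lam) ≤ 4 * (1 - ‖z‖) ^ (1 + lam) := by
      calc (1 - ‖z‖ ^ 2) ^ (1 + lam) ≤ (2 * (1 - ‖z‖)) ^ (1 + lam) := by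
            refine Real.rpow_le_rpow hw.le ?_ (by linarith)
            nlinarith [norm_nonneg z]
        _ = 2 ^ (1 + lam) * (1 - ‖z‖) ^ (1 + lam) := Real.mul_rpow (by norm_num) hz0.le
        _ ≤ 2 ^ (2 : ℝ) * (1 - ‖z‖) ^ (1 + lam) := by
            gcongr
            · norm_num
            · linarith
        _ = _ := by norm_num
    calc ‖deriv g z‖ ^ 2 * (1 - ‖z‖ ^ 2) ^ p
        = ‖deriv g z‖ ^ 2 * ((1 - ‖z‖ ^ 2) ^ (1 + lam) * (1 - ‖z‖ ^ 2) ^ (p - 1 - lam)) := by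
          rw [← Real.rpow_add hw]
          congr 2
          ring
      _ ≤ ‖deriv g z‖ ^ 2 * (4 * (1 - ‖z‖) ^ (1 + lam) * (1 - ‖z‖ ^ 2) ^ (p - 1 - lam)) := by
          gcongr
      _ = 4 * ((1 - ‖z‖) ^ (1 + lam) * ‖deriv g z‖ ^ 2) * (1 - ‖z‖ ^ 2) ^ (p - 1 - lam) := by ring
      _ ≤ _ := by gcongr
  have hint : ∫⁻ z in I.box, ‖deriv g z‖ₑ ^ (2 : ℝ) * ENNReal.ofReal ((1 - ‖z‖ ^ 2) ^ p) ≤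
      ENNReal.ofReal (4 * ε ^ 2 * (C * I.len ^ (p - lam + 1))) := by
    refine (setLIntegral_mono' I.measurableSet_box hpt).trans ?_
    rw [lintegral_const_mul' _ _ ENNReal.ofReal_ne_top,
      ENNReal.ofReal_mul (p := 4 * ε ^ 2) (by positivity), show p - lam + 1 = p - 1 - lam + 2 by ring]
    exact mul_le_mul_right (hbox I) _
  have hK : ε * (4 * Real.pi⁻¹ * C + 1) ^ (1 / 2 : ℝ) =
      (ε ^ 2 * (4 * Real.pi⁻¹ * C + 1)) ^ (1 / 2 : ℝ) := by
    rw [Real.mul_rpow (by positivity) (by positivity), ← Real.sqrt_eq_rpow (ε ^ 2),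
      Real.sqrt_sq hε]
  rw [hK, ← ENNReal.ofReal_rpow_of_nonneg (by positivity) (by norm_num), carleson,
    setLIntegral_areaMeasure]
  refine ENNReal.rpow_le_rpow ?_ (by norm_num)
  refine (mul_le_mul_right (mul_le_mul_right hint _) _).trans ?_
  rw [← ENNReal.ofReal_mul (by positivity), ← ENNReal.ofReal_mul (by positivity)]
  refine ENNReal.ofReal_le_ofReal ?_
  rw [Real.rpow_neg hl.le]
  have h3 : 0 < I.len ^ (p - lam + 1) := Real.rpow_pos_of_pos hl _
  calc _ = ε ^ 2 * (4 * Real.pi⁻¹ * C) := by field_simp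
    _ ≤ _ := by gcongr; linarith

theorem IsLittleBloch.mem_littleBlochMorrey {p lam : ℝ} (h0 : 0 < lam) (h1 : lam < 1) (hp : 1 < p)
    {g : HolD} (hg : IsLittleBloch ((1 + lam) / 2) g) : g ∈ LittleBlochMorrey p lam := by
  obtain ⟨K, hK, hKf⟩ := exists_carleson_le_of_box_bound h0 h1 hp
  obtain ⟨M, hM, hMz⟩ := hg.exists_bound (by linarith)
  constructor
  · exact (iSup_le fun I => hKf g I M hM fun z hz => hMz z (I.box_subset hz)).trans_lt
      ENNReal.ofReal_lt_top
  · rw [ENNReal.tendsto_nhds_zero]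
    intro ε hε
    obtain ⟨e, he0, heε⟩ : ∃ e : ℝ, 0 < e ∧ ENNReal.ofReal (e * K) ≤ ε := by
      rcases eq_or_ne ε ⊤ with rfl | htop
      · exact ⟨1, one_pos, le_top⟩
      · refine ⟨ε.toReal / K, div_pos (ENNReal.toReal_pos hε.ne' htop) hK, ?_⟩
        rw [div_mul_cancel₀ _ hK.ne', ENNReal.ofReal_toReal htop]
    obtain ⟨δ, hδ, hδz⟩ := hg e he0
    -- Points of `S(I)` satisfy `1 - |z| ≤ |I|`, so short arcs have boxes inside the rim where the
    -- symbol is small.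
    refine mem_comap.2 ⟨Iio δ, Iio_mem_nhds hδ, fun I hI => ?_⟩
    refine (hKf g I e he0.le fun z hz => hδz z (I.box_subset hz) ?_).trans heε
    obtain ⟨r, θ, hr, hr1, -, rfl⟩ := hz
    have hI' : I.len < δ := hI
    rw [norm_circleMap_zero, abs_of_nonneg (by linarith [I.len_le_one])]
    linarith

/-! ### Derivatives of the integral operators -/

theorem deriv_primitive {h : ℂ → ℂ} (hh : DifferentiableOn ℂ h disc) {z : ℂ} (hz : z ∈ disc) :
    deriv (primitive h hh) z = h z := by
  obtain ⟨P, hP⟩ := hh.isExactOn_ball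
  have key : ∀ z ∈ disc, primitive h hh z = P z - P 0 := by
    intro z hz
    rw [primitive_apply h hh hz]
    have h1 : ∀ t ∈ uIcc (0 : ℝ) 1,
        HasDerivAt (fun t : ℝ => P (t * z)) (h (t * z) * z) t := by
      intro t ht
      rw [uIcc_of_le zero_le_one] at ht
      have h2 : HasDerivAt (fun t : ℝ => (t : ℂ) * z) (1 * z) t :=
        (Complex.ofRealCLM.hasDerivAt (x := t)).mul_const z
      rw [one_mul] at h2
      exact (hP _ (smul_mem_disc hz ht)).comp t h2
    have h3 := intervalIntegral.integral_eq_sub_of_hasDerivAt h1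
      (intervalIntegrable_segment hh hz)
    simpa [segmentIntegral] using h3
  have h2 : (primitive h hh : ℂ → ℂ) =ᶠ[𝓝 z] fun z => P z - P 0 := by
    filter_upwards [Metric.isOpen_ball.mem_nhds hz] with w hw using key w hw
  rw [h2.deriv_eq]
  exact ((hP z hz).sub_const _).deriv

theorem deriv_volterraT (g f : HolD) {z : ℂ} (hz : z ∈ disc) :
    deriv (volterraT g f) z = f z * deriv g z :=
  deriv_primitive (f.differentiableOn_mul_deriv g) hz

theorem deriv_companionI (g f : HolD) {z : ℂ} (hz : z ∈ disc) :
    deriv (companionI g f) z = deriv f z * g z :=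
  deriv_primitive (f.differentiableOn_deriv_mul g) hz

theorem volterraT_apply_zero (g f : HolD) : volterraT g f 0 = 0 := by
  have h : volterraT g f 0 = segmentIntegral (fun w => f w * deriv g w) 0 :=
    primitive_apply _ (f.differentiableOn_mul_deriv g) (by simp)
  rw [h]
  simp [segmentIntegral]

theorem blochQuantity_volterraT_le {lam : ℝ} {g f : HolD} {C : ℝ}
    (z : disc) (hf : ‖f z‖ ≤ C * (1 - ‖(z : ℂ)‖) ^ (-((1 - lam) / 2))) :
    blochQuantity (volterraT g f) z ≤
      2 * C * ((1 - ‖(z : ℂ)‖) ^ ((1 + lam) / 2) * ‖deriv g z‖) := by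
  have hz0 := one_sub_norm_pos z.2
  have hw : 1 - ‖(z : ℂ)‖ ^ 2 ≤ 2 * (1 - ‖(z : ℂ)‖) := by nlinarith [norm_nonneg (z : ℂ)]
  rw [blochQuantity, deriv_volterraT g f z.2, norm_mul]
  have e : (1 - ‖(z : ℂ)‖) ^ ((1 + lam) / 2) =
      (1 - ‖(z : ℂ)‖) * (1 - ‖(z : ℂ)‖) ^ (-((1 - lam) / 2)) := by
    rw [show (1 + lam) / 2 = 1 + -((1 - lam) / 2) by ring, Real.rpow_add hz0, Real.rpow_one]
  calc _ ≤ 2 * (1 - ‖(z : ℂ)‖) * (C * (1 - ‖(z : ℂ)‖) ^ (-((1 - lam) / 2)) * ‖deriv g z‖) := by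
        gcongr
    _ = _ := by
        rw [e]
        ring

theorem volterraT_mem_bloch {lam : ℝ} (h0 : 0 < lam) {g : HolD}
    (hg : IsLittleBloch ((1 + lam) / 2) g) {f : HolD} {C : ℝ}
    (hf : ∀ z ∈ disc, ‖f z‖ ≤ C * (1 - ‖z‖) ^ (-((1 - lam) / 2))) : volterraT g f ∈ Bloch := by
  obtain ⟨M, hM, hMz⟩ := hg.exists_bound (by linarith)
  have hC : 0 ≤ C := by
    have := (norm_nonneg _).trans (hf 0 (by simp))
    simpa using this
  refine ⟨2 * C * M, ?_⟩
  rintro _ ⟨z, rfl⟩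
  exact (blochQuantity_volterraT_le z (hf z z.2)).trans
    (mul_le_mul_of_nonneg_left (hMz z z.2) (by positivity))

/-! ### Normal families -/

/-- Cauchy's estimate on a slightly larger disc makes the family equi-Lipschitz, and a finite net
with an `ε/3` argument upgrades pointwise convergence. The filter is arbitrary, so that ultrafilters
may be used. -/
theorem tendstoUniformlyOn_closedBall_of_pointwise {ι : Type*} {l : Filter ι} [l.NeBot]
    {F : ι → HolD} {v : ℂ → ℂ} (hF : ∀ r < 1, ∃ B : ℝ, ∀ i, ∀ z, ‖z‖ ≤ r → ‖F i z‖ ≤ B)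
    (hv : ∀ z ∈ disc, Tendsto (fun i => F i z) l (𝓝 (v z))) {r : ℝ} (hr : r < 1) :
    TendstoUniformlyOn (fun i => F i) v l (Metric.closedBall 0 r) := by
  set ρ := (1 - r) / 2 with hρ
  have hρ0 : 0 < ρ := by linarith
  obtain ⟨B, hB⟩ := hF (r + ρ) (by linarith)
  have hsub : Metric.closedBall (0 : ℂ) r ⊆ disc := Metric.closedBall_subset_ball hr
  set L := max (B / ρ) 1 with hL
  have hL0 : 0 < L := lt_max_of_lt_right one_pos
  have hLip : ∀ i, ∀ x ∈ Metric.closedBall (0 : ℂ) r, ∀ y ∈ Metric.closedBall (0 : ℂ) r,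
      ‖F i y - F i x‖ ≤ L * ‖y - x‖ := fun i x hx y hy => by
    refine (convex_closedBall (0 : ℂ) r).norm_image_sub_le_of_norm_deriv_le
      (fun z hz => (F i).differentiableAt (hsub hz)) (fun z hz => ?_) hx hy
    refine le_trans ?_ (le_max_left _ _)
    rw [mem_closedBall_zero_iff] at hz
    have hzρ : Metric.closedBall z ρ ⊆ disc := fun w hw => by
      rw [mem_closedBall_iff_norm] at hw
      rw [mem_ball_zero_iff]
      have := norm_add_le (w - z) z
      rw [sub_add_cancel] at this
      linarith
    refine Complex.norm_deriv_le_of_forall_mem_sphere_norm_le hρ0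
      ((F i).differentiableOn.diffContOnCl_ball hzρ) fun w hw => hB i w ?_
    rw [mem_sphere_iff_norm] at hw
    have := norm_add_le (w - z) z
    rw [sub_add_cancel] at this
    linarith
  have hvLip : ∀ x ∈ Metric.closedBall (0 : ℂ) r, ∀ y ∈ Metric.closedBall (0 : ℂ) r,
      ‖v y - v x‖ ≤ L * ‖y - x‖ := fun x hx y hy =>
    le_of_tendsto ((hv y (hsub hy)).sub (hv x (hsub hx))).norm
      (Eventually.of_forall fun i => hLip i x hx y hy)
  rw [Metric.tendstoUniformlyOn_iff]
  intro ε hε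
  obtain ⟨t, hts, htf, htc⟩ := (isCompact_closedBall (0 : ℂ) r).finite_cover_balls
    (e := ε / (3 * L)) (by positivity)
  have hev : ∀ᶠ i in l, ∀ c ∈ t, dist (F i c) (v c) < ε / 3 :=
    (eventually_all_finite htf).2 fun c hc =>
      (hv c (hsub (hts hc))).eventually (Metric.ball_mem_nhds _ (by positivity))
  filter_upwards [hev] with i hi z hz
  obtain ⟨c, hc, hzc⟩ := mem_iUnion₂.1 (htc hz)
  rw [mem_ball_iff_norm, lt_div_iff₀ (by positivity)] at hzc
  have e1 := hvLip c (hts hc) z hz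
  have e2 := hLip i z hz c (hts hc)
  have e3 := hi c hc
  rw [norm_sub_rev c z] at e2
  rw [dist_eq_norm, norm_sub_rev] at e3
  rw [dist_eq_norm]
  have e4 : v z - F i z = (v z - v c) + (v c - F i c) + (F i c - F i z) := by ring
  rw [e4]
  have e5 := norm_add₃_le (a := v z - v c) (b := v c - F i c) (c := F i c - F i z)
  linarith

theorem exists_holD_of_pointwise {ι : Type*} {l : Filter ι} [l.NeBot]
    {F : ι → HolD} {v : ℂ → ℂ} (hF : ∀ r < 1, ∃ B : ℝ, ∀ i, ∀ z, ‖z‖ ≤ r → ‖F i z‖ ≤ B)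
    (hv : ∀ z ∈ disc, Tendsto (fun i => F i z) l (𝓝 (v z))) :
    ∃ u : HolD, ∀ z ∈ disc, u z = v z := by
  have hloc : TendstoLocallyUniformlyOn (fun i => (F i : ℂ → ℂ)) v l disc := by
    intro s hs x hx
    have hx1 := mem_ball_zero_iff.1 hx
    refine ⟨Metric.closedBall 0 ((1 + ‖x‖) / 2), mem_nhdsWithin_of_mem_nhds ?_,
      tendstoUniformlyOn_closedBall_of_pointwise hF hv (by linarith) s hs⟩
    refine mem_of_superset (Metric.isOpen_ball.mem_nhds ?_) Metric.ball_subset_closedBall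
    rw [mem_ball_zero_iff]
    linarith
  have hd := hloc.differentiableOn (Eventually.of_forall fun i => (F i).differentiableOn)
    Metric.isOpen_ball
  exact ⟨⟨disc.indicator v, hd.congr fun z hz => indicator_of_mem hz _,
    fun z hz => indicator_of_notMem hz _⟩, fun z hz => indicator_of_mem hz v⟩

/-- The functions with growth at most `C (1 - |z|)^(-s)`. -/
def growthBall (C s : ℝ) : Set HolD := {u | ∀ z ∈ disc, ‖u z‖ ≤ C * (1 - ‖z‖) ^ (-s)}

theorem growthBall_locally_bounded {C s : ℝ} (hC : 0 ≤ C) (hs : 0 ≤ s) :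
    ∀ r < 1, ∃ B : ℝ, ∀ u : growthBall C s, ∀ z, ‖z‖ ≤ r → ‖(u : HolD) z‖ ≤ B := fun r hr => by
  refine ⟨C * (1 - r) ^ (-s), fun u z hz => ?_⟩
  refine (u.2 z (mem_ball_zero_iff.2 (by linarith))).trans (mul_le_mul_of_nonneg_left ?_ hC)
  exact Real.rpow_le_rpow_of_nonpos (by linarith) (by linarith) (neg_nonpos.2 hs)

/-- Montel's theorem for ultrafilters: each evaluation takes values in a compact disc, hence
converges along `l`, and the limit inherits both the growth bound and holomorphy. -/
theorem exists_tendsto_of_ultrafilter_growthBall {C s : ℝ} (hC : 0 ≤ C) (hs : 0 ≤ s)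
    (l : Ultrafilter (growthBall C s)) :
    ∃ u : growthBall C s, ∀ z ∈ disc, Tendsto (fun w : growthBall C s => (w : HolD) z) l
      (𝓝 ((u : HolD) z)) := by
  have hlim : ∀ z : ℂ, ∃ y : ℂ, z ∈ disc → ‖y‖ ≤ C * (1 - ‖z‖) ^ (-s) ∧
      Tendsto (fun w : growthBall C s => (w : HolD) z) l (𝓝 y) := fun z => by
    by_cases hz : z ∈ disc
    · obtain ⟨y, hy, hly⟩ := (isCompact_closedBall (0 : ℂ) (C * (1 - ‖z‖) ^ (-s))).ultrafilter_le_nhds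
        (l.map fun w : growthBall C s => (w : HolD) z)
        (by
          rw [le_principal_iff, Ultrafilter.coe_map, mem_map]
          exact univ_mem' fun w => mem_closedBall_zero_iff.2 (w.2 z hz))
      exact ⟨y, fun _ => ⟨mem_closedBall_zero_iff.1 hy, hly⟩⟩
    · exact ⟨0, fun h => absurd h hz⟩
  choose v hv using hlim
  obtain ⟨u, hu⟩ := exists_holD_of_pointwise (growthBall_locally_bounded hC hs)
    fun z hz => (hv z hz).2
  exact ⟨⟨u, fun z hz => by rw [hu z hz]; exact (hv z hz).1⟩,
    fun z hz => by simpa only [hu z hz] using (hv z hz).2⟩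

theorem blochQuantity_le_norm (f : Bloch) (z : disc) : blochQuantity (f : HolD) z ≤ ‖f‖ := by
  rw [Bloch.norm_def]
  have := le_ciSup f.2 z
  linarith [norm_nonneg ((f : HolD) 0)]

/-- The image under `T_g` of a growth ball is compact when `g` is in the little Bloch type space. -/
theorem isCompact_volterraT_growthBall {lam : ℝ} (h0 : 0 < lam) (h1 : lam < 1) {g : HolD}
    (hg : IsLittleBloch ((1 + lam) / 2) g) {C : ℝ} (hC : 0 < C) :
    IsCompact {y : Bloch | ∃ u ∈ growthBall C ((1 - lam) / 2), (y : HolD) = volterraT g u} := by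
  have hs : 0 ≤ (1 - lam) / 2 := by linarith
  set s := (1 - lam) / 2 with hsdef
  set Φ : growthBall C s → Bloch := fun u => ⟨volterraT g u, volterraT_mem_bloch h0 hg u.2⟩ with hΦ
  have hK : {y : Bloch | ∃ u ∈ growthBall C s, (y : HolD) = volterraT g u} = range Φ := by
    ext y
    constructor
    · rintro ⟨u, hu, hy⟩
      exact ⟨⟨u, hu⟩, Subtype.ext hy.symm⟩
    · rintro ⟨u, rfl⟩
      exact ⟨u, u.2, rfl⟩
  rw [hK]
  obtain ⟨M, hM, hMz⟩ := hg.exists_bound (by linarith)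
  have main : ∀ l : Ultrafilter (growthBall C s), ∃ u, Tendsto Φ l (𝓝 (Φ u)) := by
    intro l
    obtain ⟨u, hu⟩ := exists_tendsto_of_ultrafilter_growthBall hC.le hs l
    refine ⟨u, ?_⟩
    rw [Metric.tendsto_nhds]
    intro ε hε
    -- At the rim the difference of two members grows with constant `2C`, so its image has Bloch
    -- quantity at most `2 · 2C · ε / (8C) = ε / 2`.
    obtain ⟨δ, hδ, hδz⟩ := hg (ε / (8 * C)) (by positivity)
    have hunif := tendstoUniformlyOn_closedBall_of_pointwise (growthBall_locally_bounded hC.le hs)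
      hu (r := 1 - δ) (by linarith)
    rw [Metric.tendstoUniformlyOn_iff] at hunif
    -- On the remaining closed ball uniform closeness suffices against the global bound `M`; `M + 1`
    -- avoids a zero denominator.
    filter_upwards [hunif (ε / (4 * (M + 1))) (by positivity)] with w hw
    have hbound : ‖Φ w - Φ u‖ ≤ ε / 2 := by
      have e0 : ((Φ w - Φ u : Bloch) : HolD) = volterraT g ((w : HolD) - u) := by
        rw [map_sub]
        rfl
      rw [Bloch.norm_def, e0, volterraT_apply_zero, norm_zero, zero_add]
      refine ciSup_le fun z => ?_
      have hsub : ((w : HolD) - u : HolD) z = (w : HolD) z - (u : HolD) z := rfl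
      have hz0 := one_sub_norm_pos z.2
      rcases lt_or_ge (1 - ‖(z : ℂ)‖) δ with hc | hc
      · have e1 : ‖((w : HolD) - u : HolD) z‖ ≤ 2 * C * (1 - ‖(z : ℂ)‖) ^ (-s) := by
          rw [hsub]
          have := norm_sub_le ((w : HolD) z) ((u : HolD) z)
          linarith [w.2 z z.2, u.2 z z.2]
        refine (blochQuantity_volterraT_le z e1).trans ?_
        calc _ ≤ 2 * (2 * C) * (ε / (8 * C)) := by
              gcongr
              exact hδz z z.2 hc
          _ = ε / 2 := by
              field_simp
              norm_num
      · have e1 : ‖((w : HolD) - u : HolD) z‖ ≤ ε / (4 * (M + 1)) * (1 - ‖(z : ℂ)‖) ^ (-s) := by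
          have e2 := hw z (by rw [mem_closedBall_zero_iff]; linarith)
          rw [dist_eq_norm, norm_sub_rev] at e2
          rw [hsub]
          refine e2.le.trans (le_mul_of_one_le_right (by positivity) ?_)
          exact Real.one_le_rpow_of_pos_of_le_one_of_nonpos hz0
            (by linarith [norm_nonneg (z : ℂ)]) (by linarith)
        refine (blochQuantity_volterraT_le z e1).trans ?_
        calc _ ≤ 2 * (ε / (4 * (M + 1))) * (M + 1) := by
              gcongr
              linarith [hMz z z.2]
          _ = ε / 2 := by
              field_simp
              norm_num
    rw [dist_eq_norm]
    linarith
  -- A cluster point of a filter on the range is found by pulling the filter back to the growth ball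
  -- and refining it to an ultrafilter.
  intro f hf hfK
  have hne : (comap Φ f).NeBot := comap_neBot_iff.2 fun t ht => by
    obtain ⟨y, hyt, ⟨u, rfl⟩⟩ := hf.nonempty_of_mem (inter_mem ht (le_principal_iff.1 hfK))
    exact ⟨u, hyt⟩
  obtain ⟨u, hu⟩ := main (Ultrafilter.of (comap Φ f))
  refine ⟨Φ u, mem_range_self u, ?_⟩
  have hle : map Φ (Ultrafilter.of (comap Φ f)) ≤ f :=
    (map_mono (Ultrafilter.of_le _)).trans map_comap_le
  exact NeBot.mono inferInstance (le_inf hu hle)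

/-! ### Compactness -/

/-- Some ball about zero is mapped into a compact set, and one scaling brings every test function
into that ball. The radius is an extended real, hence the finite positive `e` below it. -/
theorem IsCompactMorreyBloch.exists_isCompact {lam : ℝ} (h0 : 0 < lam) (h1 : lam < 1)
    {T : HolD →ₗ[ℂ] HolD} (hT : IsCompactMorreyBloch lam T) :
    ∃ c : ℝ, 0 < c ∧ ∃ K : Set Bloch, IsCompact K ∧ ∀ (a : ℂ) (ha : a ∈ disc),
      ∃ y ∈ K, (y : HolD) = T ((c : ℂ) • testFun lam a ha) := by
  obtain ⟨h, K, hK, hKT⟩ := hT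
  obtain ⟨C, hC, hCf⟩ := exists_morreyNorm_testFun_le h0 h1
  obtain ⟨ε, hε, hεK⟩ := EMetric.mem_nhds_iff.1 hKT
  obtain ⟨e, he, heε⟩ := ENNReal.lt_iff_exists_nnreal_btwn.1 hε
  have he0 : 0 < (e : ℝ) := by exact_mod_cast he
  refine ⟨e / C, by positivity, K, hK, fun a ha => ?_⟩
  set x : Morrey lam := ⟨((e / C : ℝ) : ℂ) • testFun lam a ha,
    (Morrey lam).smul_mem _ (testFun_mem_morrey h1 ha)⟩ with hx
  refine ⟨T.restrict h x, hεK ?_, rfl⟩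
  have hd : edist x 0 = morreyNorm lam (((e / C : ℝ) : ℂ) • testFun lam a ha) := by
    have : edist x 0 = morreyNorm lam ((x : HolD) - (0 : HolD)) := rfl
    rw [this, sub_zero]
  rw [Metric.mem_eball, hd, morreyNorm_smul]
  refine lt_of_le_of_lt ?_ heε
  refine (mul_le_mul_right (hCf a ha) _).trans (le_of_eq ?_)
  rw [← ofReal_norm, Complex.norm_real, Real.norm_of_nonneg (by positivity),
    ← ENNReal.ofReal_mul (by positivity), div_mul_cancel₀ _ hC.ne', ENNReal.ofReal_coe_nnreal]

/-! ### Necessity of the conditions on the symbol. -/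

theorem testFun_apply (lam : ℝ) {a z : ℂ} (ha : a ∈ disc) (hz : z ∈ disc) :
    testFun lam a ha z = (((1 - ‖a‖ ^ 2) ^ ((1 + lam) / 2) : ℝ) : ℂ) * (1 - conj a * z)⁻¹ := by
  rw [testFun, HolD.smul_apply, szego_apply ha hz]

theorem one_sub_conj_mul_self (a : ℂ) : 1 - conj a * a = ((1 - ‖a‖ ^ 2 : ℝ) : ℂ) := by
  rw [mul_comm, Complex.mul_conj, Complex.normSq_eq_norm_sq]
  push_cast
  ring

/-- The companion operator is compact only for the zero symbol. -/
theorem eq_zero_of_isCompactMorreyBloch_companionI {lam : ℝ} (h0 : 0 < lam) (h1 : lam < 1)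
    {g : HolD} (hT : IsCompactMorreyBloch lam (companionI g)) : g = 0 := by
  obtain ⟨c, hc, K, hK, hKf⟩ := hT.exists_isCompact h0 h1
  obtain ⟨R, hR⟩ := hK.isBounded.exists_norm_le
  have hs : 0 < (1 - lam) / 2 := by linarith
  -- The Bloch quantity of the image of the test function for `a`, evaluated at `a` itself. Only the
  -- boundedness of `K` is used.
  have hbd : ∀ a ∈ disc, c * ‖a‖ * ‖g a‖ ≤ R * (1 - ‖a‖ ^ 2) ^ ((1 - lam) / 2) := fun a ha => by
    obtain ⟨y, hy, hyT⟩ := hKf a ha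
    have hw := disc_weight_pos ⟨a, ha⟩
    simp only at hw
    have e1 := (blochQuantity_le_norm y ⟨a, ha⟩).trans (hR y hy)
    rw [hyT, map_smul, blochQuantity_smul, blochQuantity, deriv_companionI g _ ha, testFun,
      HolD.deriv_smul _ _ ha, deriv_szego ha ha, one_sub_conj_mul_self, norm_mul, norm_mul,
      norm_div, norm_pow, Complex.norm_conj, Complex.norm_real, Complex.norm_real,
      Complex.norm_real, Real.norm_of_nonneg hc.le, Real.norm_of_nonneg hw.le,
      Real.norm_of_nonneg (Real.rpow_nonneg hw.le _)] at e1
    have e2 : (1 - ‖a‖ ^ 2) ^ ((1 + lam) / 2) * (1 - ‖a‖ ^ 2) ^ ((1 - lam) / 2) =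
        1 - ‖a‖ ^ 2 := by
      rw [← Real.rpow_add hw, show (1 + lam) / 2 + (1 - lam) / 2 = 1 by ring, Real.rpow_one]
    set A := (1 - ‖a‖ ^ 2) ^ ((1 + lam) / 2) with hA
    set B := (1 - ‖a‖ ^ 2) ^ ((1 - lam) / 2) with hB
    have hB0 : 0 < B := Real.rpow_pos_of_pos hw _
    calc c * ‖a‖ * ‖g a‖ = c * ((1 - ‖a‖ ^ 2) *
          (A * (‖a‖ / (1 - ‖a‖ ^ 2) ^ 2) * ‖g a‖)) * B := by
          have e3 : A * B * (1 - ‖a‖ ^ 2) / (1 - ‖a‖ ^ 2) ^ 2 = 1 := by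
            rw [e2]
            field_simp
          calc c * ‖a‖ * ‖g a‖ = c * ‖a‖ * ‖g a‖ *
                (A * B * (1 - ‖a‖ ^ 2) / (1 - ‖a‖ ^ 2) ^ 2) := by rw [e3, mul_one]
            _ = _ := by ring
      _ ≤ R * B := mul_le_mul_of_nonneg_right e1 hB0.le
  have hR0 : 0 ≤ R := by
    obtain ⟨y, hy, -⟩ := hKf 0 (by simp)
    exact (norm_nonneg y).trans (hR y hy)
  refine HolD.ext_disc fun z hz => ?_
  have hz1 := mem_ball_zero_iff.1 hz
  -- Maximum principle on the circle of radius `r`; keeping `r > 1/2` costs a factor `2` for the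
  -- division by `|a|`.
  have key : ∀ r ∈ Ioo (max ‖z‖ (1 / 2)) 1,
      ‖g z‖ ≤ 2 * R / c * (1 - r ^ 2) ^ ((1 - lam) / 2) := fun r hr => by
    have hr2 : 1 / 2 < r := (le_max_right _ _).trans_lt hr.1
    have hzr : ‖z‖ < r := (le_max_left _ _).trans_lt hr.1
    have hd : DiffContOnCl ℂ g (Metric.ball 0 r) :=
      g.differentiableOn.diffContOnCl_ball (Metric.closedBall_subset_ball hr.2)
    refine Complex.norm_le_of_forall_mem_frontier_norm_le Metric.isBounded_ball hd (fun a ha => ?_)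
      (subset_closure (mem_ball_zero_iff.2 hzr))
    rw [frontier_ball _ (by linarith), mem_sphere_zero_iff_norm] at ha
    have h2 := hbd a (mem_ball_zero_iff.2 (by linarith [hr.2]))
    rw [ha] at h2
    rw [div_mul_eq_mul_div, le_div_iff₀ hc]
    nlinarith [mul_nonneg hc.le (norm_nonneg (g a))]
  have hlim : Tendsto (fun r : ℝ => 2 * R / c * (1 - r ^ 2) ^ ((1 - lam) / 2)) (𝓝[<] 1) (𝓝 0) := by
    have hcont : Continuous fun r : ℝ => 2 * R / c * (1 - r ^ 2) ^ ((1 - lam) / 2) :=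
      continuous_const.mul ((by fun_prop : Continuous fun r : ℝ => 1 - r ^ 2).rpow_const
        fun _ => Or.inr hs.le)
    have := (hcont.tendsto 1).mono_left (nhdsWithin_le_nhds (s := Iio 1))
    simpa [Real.zero_rpow hs.ne'] using this
  have h3 : ‖g z‖ ≤ 0 := ge_of_tendsto hlim
    (mem_of_superset (Ioo_mem_nhdsLT (max_lt hz1 (by norm_num))) key)
  simpa using h3

/-- The symbol of a compact Volterra operator is in the little Bloch type space. -/
theorem isLittleBloch_of_isCompactMorreyBloch_volterraT {lam : ℝ} (h0 : 0 < lam) (h1 : lam < 1)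
    {g : HolD} (hT : IsCompactMorreyBloch lam (volterraT g)) :
    IsLittleBloch ((1 + lam) / 2) g := by
  obtain ⟨c, hc, K, hK, hKf⟩ := hT.exists_isCompact h0 h1
  set b := (1 + lam) / 2 with hb
  have hb0 : 0 < b := by linarith
  by_contra hcon
  simp only [IsLittleBloch, not_forall, not_exists, not_and, not_le] at hcon
  obtain ⟨ε, hε, hcon⟩ := hcon
  -- Points tending to the circle at which the little Bloch quantity stays above `ε`.
  choose a ha haδ haε using fun n : ℕ => by
    simpa only [exists_prop] using hcon (1 / ((n : ℝ) + 1)) (by positivity)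
  choose y hyK hyT using fun n => hKf (a n) (ha n)
  obtain ⟨φ, -, ψ, hψ, hφ⟩ := hK.tendsto_subseq hyK
  have hnorm : Tendsto (fun n => ‖y (ψ n) - φ‖) atTop (𝓝 0) :=
    tendsto_iff_norm_sub_tendsto_zero.1 hφ
  have hderiv : ∀ n, ∀ z ∈ disc, deriv (y n : HolD) z =
      c * (((1 - ‖a n‖ ^ 2) ^ b : ℝ) : ℂ) * (1 - conj (a n) * z)⁻¹ * deriv g z := fun n z hz => by
    rw [hyT, deriv_volterraT g _ hz, HolD.smul_apply, testFun_apply lam (ha n) hz, ← hb]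
    ring
  have hsub : ∀ n, ∀ z ∈ disc, deriv ((y n - φ : Bloch) : HolD) z =
      deriv (y n : HolD) z - deriv (φ : HolD) z := fun n z hz => by
    have h2 := HolD.deriv_add ((y n - φ : Bloch) : HolD) (φ : HolD) hz
    rw [← Submodule.coe_add, sub_add_cancel] at h2
    rw [h2, add_sub_cancel_right]
  have ha1 : Tendsto (fun n => 1 - ‖a n‖ ^ 2) atTop (𝓝 0) := by
    have h2 : Tendsto (fun n : ℕ => 2 * (1 / ((n : ℝ) + 1))) atTop (𝓝 0) := by
      simpa using tendsto_one_div_add_atTop_nhds_zero_nat.const_mul (2 : ℝ)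
    refine squeeze_zero (fun n => (disc_weight_pos ⟨a n, ha n⟩).le) (fun n => ?_) h2
    have h3 := haδ n
    have h4 := one_sub_norm_pos (ha n)
    nlinarith [norm_nonneg (a n)]
  -- At fixed `z` the denominators stay at least `1 - |z|` while `(1 - |a n|²)^b → 0`; Bloch
  -- convergence implies pointwise convergence of derivatives, so the two limits agree.
  have hφ0 : ∀ z ∈ disc, deriv (φ : HolD) z = 0 := fun z hz => by
    have hw := disc_weight_pos ⟨z, hz⟩
    simp only at hw
    have hz0 := one_sub_norm_pos hz
    have hy0 : Tendsto (fun n => deriv (y n : HolD) z) atTop (𝓝 0) := by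
      have h2 : Tendsto (fun n => c * (1 - ‖a n‖ ^ 2) ^ b * (1 - ‖z‖)⁻¹ * ‖deriv g z‖) atTop
          (𝓝 (c * 0 ^ b * (1 - ‖z‖)⁻¹ * ‖deriv g z‖)) :=
        (((ha1.rpow_const (Or.inr hb0.le)).const_mul c).mul_const _).mul_const _
      rw [Real.zero_rpow hb0.ne', mul_zero, zero_mul, zero_mul] at h2
      refine squeeze_zero_norm (fun n => ?_) h2
      have hwn := disc_weight_pos ⟨a n, ha n⟩
      simp only at hwn
      rw [hderiv n z hz, norm_mul, norm_mul, norm_mul, Complex.norm_real, Complex.norm_real,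
        Real.norm_of_nonneg hc.le, Real.norm_of_nonneg (Real.rpow_nonneg hwn.le _), norm_inv]
      have h3 : (1 - ‖z‖) ≤ ‖1 - conj (a n) * z‖ := by
        have h4 := norm_sub_norm_le 1 (conj (a n) * z)
        rw [norm_one, norm_mul, Complex.norm_conj] at h4
        nlinarith [norm_nonneg z, mem_ball_zero_iff.1 (ha n)]
      gcongr
    have h5 : Tendsto (fun n => deriv (y (ψ n) : HolD) z - deriv (φ : HolD) z) atTop (𝓝 0) := by
      have h6 : Tendsto (fun n => (1 - ‖z‖ ^ 2)⁻¹ * ‖y (ψ n) - φ‖) atTop (𝓝 0) := by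
        simpa using hnorm.const_mul ((1 - ‖z‖ ^ 2)⁻¹)
      refine squeeze_zero_norm (fun n => ?_) h6
      rw [← hsub _ z hz, ← div_eq_inv_mul, le_div_iff₀ hw, mul_comm]
      exact blochQuantity_le_norm (y (ψ n) - φ) ⟨z, hz⟩
    have h7 := (hy0.comp hψ.tendsto_atTop).sub h5
    simp only [Function.comp_def, sub_sub_cancel, sub_zero] at h7
    exact tendsto_nhds_unique tendsto_const_nhds h7
  -- Evaluation at `a m`: the weight cancels the kernel value `(1 - |a m|²)⁻¹`, leaving `c (1 - |a
  -- m|²)^b |g'(a m)|`. This contradicts `hnorm`.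
  have hlow : ∀ n, c * ε ≤ ‖y (ψ n) - φ‖ := fun n => by
    set m := ψ n with hm
    have hwm := disc_weight_pos ⟨a m, ha m⟩
    simp only at hwm
    refine le_trans ?_ (blochQuantity_le_norm (y m - φ) ⟨a m, ha m⟩)
    rw [blochQuantity, hsub m _ (ha m), hφ0 _ (ha m), sub_zero, hderiv m _ (ha m),
      one_sub_conj_mul_self, norm_mul, norm_mul, norm_mul, norm_inv, Complex.norm_real,
      Complex.norm_real, Complex.norm_real, Real.norm_of_nonneg hc.le,
      Real.norm_of_nonneg (Real.rpow_nonneg hwm.le _), Real.norm_of_nonneg hwm.le]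
    have h2 := one_sub_norm_pos (ha m)
    have h3 : (1 - ‖a m‖) ^ b ≤ (1 - ‖a m‖ ^ 2) ^ b :=
      Real.rpow_le_rpow h2.le (by nlinarith [norm_nonneg (a m)]) hb0.le
    calc c * ε ≤ c * ((1 - ‖a m‖ ^ 2) ^ b * ‖deriv g (a m)‖) := by
          refine mul_le_mul_of_nonneg_left ((haε m).le.trans ?_) hc.le
          gcongr
      _ = _ := by field_simp
  have := ge_of_tendsto' hnorm hlow
  have : 0 < c * ε := by positivity
  linarith

/-! ### Sufficiency, and the zero symbol. -/

theorem isCompactMorreyBloch_volterraT {lam : ℝ} (h0 : 0 < lam) (h1 : lam < 1) {g : HolD}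
    (hg : IsLittleBloch ((1 + lam) / 2) g) : IsCompactMorreyBloch lam (volterraT g) := by
  obtain ⟨C, hC, hCf⟩ := exists_norm_le_of_morreyNorm_le_one h0 h1
  refine ⟨fun f hf => ?_, _, isCompact_volterraT_growthBall h0 h1 hg hC, ?_⟩
  · obtain ⟨D, hD⟩ := exists_norm_le_of_mem_morrey h0 h1 hf
    exact volterraT_mem_bloch h0 hg hD
  -- The open unit ball of the norm lies in a growth ball, whose image is the compact set supplied
  -- above.
  · refine mem_of_superset (Metric.eball_mem_nhds (0 : Morrey lam) one_pos) fun f hf => ?_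
    refine ⟨f, hCf f ?_, rfl⟩
    have hd : edist f 0 = morreyNorm lam ((f : HolD) - (0 : HolD)) := rfl
    rw [Metric.mem_eball, hd, sub_zero] at hf
    exact hf.le

theorem isCompactMorreyBloch_companionI_zero (lam : ℝ) :
    IsCompactMorreyBloch lam (companionI 0) := by
  have hz : ∀ f : HolD, companionI 0 f = 0 := fun f => by
    refine HolD.ext_disc fun z hz => ?_
    have h : companionI 0 f z = segmentIntegral (fun w => deriv f w * (0 : HolD) w) z :=
      primitive_apply _ (f.differentiableOn_deriv_mul 0) hz
    rw [h]
    simp [segmentIntegral]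
  have hm : ∀ f ∈ Morrey lam, companionI 0 f ∈ Bloch := fun f _ => by
    rw [hz]
    exact Bloch.zero_mem
  refine ⟨hm, {0}, isCompact_singleton, univ_mem' fun f => Subtype.ext (hz f)⟩

end MorreyBloch

end

theorem mainTheorem5 (lam p : ℝ) (hlam0 : 0 < lam) (hlam1 : lam < 1) (hp : 1 < p)
    (g : MorreyBloch.HolD) :
    (MorreyBloch.IsCompactMorreyBloch lam (MorreyBloch.companionI g) ↔ g = 0) ∧
    (MorreyBloch.IsCompactMorreyBloch lam (MorreyBloch.volterraT g) ↔
      g ∈ MorreyBloch.LittleBlochMorrey p lam) := by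
  refine ⟨⟨MorreyBloch.eq_zero_of_isCompactMorreyBloch_companionI hlam0 hlam1, ?_⟩, fun h => ?_,
    fun h => ?_⟩
  · rintro rfl
    exact MorreyBloch.isCompactMorreyBloch_companionI_zero lam
  · exact (MorreyBloch.isLittleBloch_of_isCompactMorreyBloch_volterraT hlam0 hlam1
      h).mem_littleBlochMorrey hlam0 hlam1 hp
  · exact MorreyBloch.isCompactMorreyBloch_volterraT hlam0 hlam1
      (MorreyBloch.IsLittleBloch.of_mem_littleBlochMorrey hlam1 hp h)
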